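/- Let $1\le k\le n$ be integers, let $p>1$ be a real number, and let $\alpha$ be a linear endomorphism of $\mathbf R^{n-1}$. Let $G=\mathbf R^{n-1}\rtimes_\alpha\mathbf R$ be the Lie group $\mathbf R^{n-1}\times\mathbf R$ with multiplication $(h,t)(h',t')=(h+e^{t\alpha}h',\,t+t')$, equipped with a left-invariant Riemannian metric. For $j\ge 0$ let $\Omega^{j,p}(G)$ be the space of differential $j$-forms on $G$ that are $L^p$ and whose exterior derivative, in the sense of distributions, is $L^p$, and let $$T^{k,p}(G)=\overline{d\,\Omega^{k-1,p}(G)}\,/\,d\,\Omega^{k-1,p}(G),$$ the closure being taken in the space of $L^p$ $k$-forms, be the torsion of the $L^p$-cohomology of $G$ in degree $k$. Let $\lambda_1\le\dots\le\lambda_{n-1}$ be the real parts of the complex eigenvalues of $\alpha$, repeated according to algebraic multiplicity. For $0\le j\le n-1$ put $w_j=\lambda_1+\dots+\lambda_j$ (the sum of the $j$ smallest) and $W_j=\lambda_{n-j}+\dots+\lambda_{n-1}$ (the sum of the $j$ largest); thus $w_0=W_0=0$ and $w_{n-1}=\operatorname{tr}\alpha$. Say that $p$ is critical in degree $j$ if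 $\operatorname{tr}(\alpha)/p$ is the real part of a complex eigenvalue of the endomorphism of $\Lambda^j(\mathbf R^{n-1})^*$ induced by $\alpha^\top$ as a derivation, $\omega\mapsto\sum_i\omega(v_1,\dots,\alpha v_i,\dots,v_j)$. If $$w_{k-1}<\frac{w_{n-1}}{p}<W_{k-1}$$ and $p$ is not critical in degree $k-1$, then $T^{k,p}(G)\neq 0$. -/

import Mathlib

set_option maxSynthPendingDepth 3

open MeasureTheory Filter Topology

noncomputable section

/-! ### `L^p`-cohomology of a vector space with a Riemannian metric given by an orthonormal frame -/

namespace LpCoh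

variable {E : Type*} [NormedAddCommGroup E] [NormedSpace ℝ E]
variable {ι : Type*}

/-- Fields of `k`-covectors (differential `k`-forms without any regularity) on the manifold `E`. -/
abbrev Form (E : Type*) [NormedAddCommGroup E] [NormedSpace ℝ E] (k : ℕ) : Type _ :=
  E → E [⋀^Fin k]→L[ℝ] ℝ

/-- Components of the form `ω` at `x` in the frame `X`, indexed by all maps `Fin k → ι`, normalised
so that the Euclidean norm of the array is the pointwise norm of `ω` for the Riemannian metric of
which `X` is an orthonormal frame:
`‖coeff X ω x‖² = (1 / k!) ∑_f ω_x(X_{f 1}, …, X_{f k})² = ∑_{i₁ < ⋯ < i_k} ω_x(X_{i₁}, …, X_{i_k})²`.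
-/
def coeff (X : E → ι → E) {k : ℕ} (ω : Form E k) (x : E) : EuclideanSpace ℝ (Fin k → ι) :=
  WithLp.toLp 2 fun f => (Real.sqrt (k.factorial : ℝ))⁻¹ * ω x fun i => X x (f i)

theorem coeff_zero (X : E → ι → E) (k : ℕ) : coeff X (0 : Form E k) = 0 := by
  ext x f; simp [coeff]

theorem coeff_add (X : E → ι → E) {k : ℕ} (ω η : Form E k) :
    coeff X (ω + η) = coeff X ω + coeff X η := by
  ext x f; simp [coeff, mul_add]

theorem coeff_smul (X : E → ι → E) {k : ℕ} (c : ℝ) (ω : Form E k) :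
    coeff X (c • ω) = c • coeff X ω := by
  ext x f; simp [coeff]; ring

theorem coeff_sub (X : E → ι → E) {k : ℕ} (ω η : Form E k) :
    coeff X (ω - η) = coeff X ω - coeff X η := by
  ext x f; simp [coeff, mul_sub]

variable [Fintype ι] [MeasureSpace E]

/-- `η` is the exterior derivative of `ω` in the sense of distributions. Both forms have locally
integrable components, and for all constant vector fields `v₀, …, v_k` the function
`η(v₀, …, v_k)` is the distribution `∑ i, (-1)^i ∂_{v i} (ω(v₀, …, v_{i-1}, v_{i+1}, …, v_k))`. -/
structure IsWeakExtDeriv {k : ℕ} (ω : Form E k) (η : Form E (k + 1)) : Prop where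
  locallyIntegrable : ∀ v : Fin k → E, LocallyIntegrable (fun x => ω x v) volume
  locallyIntegrable_deriv : ∀ v : Fin (k + 1) → E, LocallyIntegrable (fun x => η x v) volume
  integral_eq : ∀ φ : E → ℝ, ContDiff ℝ (⊤ : ℕ∞) φ → HasCompactSupport φ → ∀ v : Fin (k + 1) → E,
    ∫ x, φ x * η x v =
      -∑ i : Fin (k + 1), (-1 : ℝ) ^ (i : ℕ) * ∫ x, fderiv ℝ φ x (v i) * ω x (i.removeNth v)

theorem IsWeakExtDeriv.zero (k : ℕ) : IsWeakExtDeriv (0 : Form E k) (0 : Form E (k + 1)) where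
  locallyIntegrable v := by simpa using locallyIntegrable_zero
  locallyIntegrable_deriv v := by simpa using locallyIntegrable_zero
  integral_eq φ _ _ v := by simp

theorem IsWeakExtDeriv.smul {k : ℕ} {ω : Form E k} {η : Form E (k + 1)}
    (h : IsWeakExtDeriv ω η) (c : ℝ) : IsWeakExtDeriv (c • ω) (c • η) where
  locallyIntegrable v := (h.locallyIntegrable v).smul c
  locallyIntegrable_deriv v := (h.locallyIntegrable_deriv v).smul c
  integral_eq φ hφ hc v := by
    have e : ∀ (f g : E → ℝ), ∫ x, f x * (c * g x) = c * ∫ x, f x * g x := fun f g => by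
      rw [← integral_const_mul]
      exact integral_congr_ae (Eventually.of_forall fun x => by ring)
    simp only [Pi.smul_apply, ContinuousAlternatingMap.smul_apply, smul_eq_mul, e]
    rw [h.integral_eq φ hφ hc v, mul_neg, Finset.mul_sum]
    congr 1
    exact Finset.sum_congr rfl fun i _ => by ring

theorem IsWeakExtDeriv.add [OpensMeasurableSpace E] {k : ℕ}
    {ω ω' : Form E k} {η η' : Form E (k + 1)}
    (h : IsWeakExtDeriv ω η) (h' : IsWeakExtDeriv ω' η') :
    IsWeakExtDeriv (ω + ω') (η + η') where
  locallyIntegrable v := (h.locallyIntegrable v).add (h'.locallyIntegrable v)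
  locallyIntegrable_deriv v := 
    (h.locallyIntegrable_deriv v).add (h'.locallyIntegrable_deriv v)
  integral_eq φ hφ hc v := by
    have key : ∀ (g : E → ℝ), LocallyIntegrable g volume → Integrable (fun x => φ x * g x) volume :=
      fun g hg => by
        simpa [smul_eq_mul] using hg.integrable_smul_left_of_hasCompactSupport hφ.continuous hc
    have key' : ∀ (g : E → ℝ) (w : E), LocallyIntegrable g volume →
        Integrable (fun x => fderiv ℝ φ x w * g x) volume := fun g w hg => by
      have hcont : Continuous fun x => fderiv ℝ φ x w :=
        (hφ.continuous_fderiv (by simp)).clm_apply continuous_const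
      have hsupp : HasCompactSupport fun x => fderiv ℝ φ x w := hc.fderiv_apply (𝕜 := ℝ) w
      simpa [smul_eq_mul] using hg.integrable_smul_left_of_hasCompactSupport hcont hsupp
    simp only [Pi.add_apply, ContinuousAlternatingMap.add_apply, mul_add]
    rw [integral_add (key _ (h.locallyIntegrable_deriv v)) (key _ (h'.locallyIntegrable_deriv v)),
      h.integral_eq φ hφ hc v, h'.integral_eq φ hφ hc v, ← neg_add, ← Finset.sum_add_distrib]
    congr 1
    refine Finset.sum_congr rfl fun i _ => ?_
    rw [integral_add (key' _ _ (h.locallyIntegrable _)) (key' _ _ (h'.locallyIntegrable _)),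
      mul_add]

/-- The space `L^pΩ^k` of `L^p` forms (as actual fields of covectors, not identified when they agree
almost everywhere) for the metric with orthonormal frame `X` and Riemannian volume `μ`. -/
def lpForms (X : E → ι → E) (μ : Measure E) (p : ℝ) (k : ℕ) : Submodule ℝ (Form E k) where
  carrier := {ω | MemLp (coeff X ω) (ENNReal.ofReal p) μ}
  zero_mem' := by simp [coeff_zero]
  add_mem' {a b} ha hb := by
    simp only [Set.mem_ofPred_eq, coeff_add] at *
    exact ha.add hb
  smul_mem' c a ha := by
    simp only [Set.mem_ofPred_eq, coeff_smul] at *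
    exact ha.const_smul c

variable [OpensMeasurableSpace E]

/-- The space `im d ⊆ L^pΩ^k` of differentials of the forms in `Ω^{k-1,p} = L^p ∩ d⁻¹ L^p`. In degree
`0` it is zero, that is, it consists of the forms that vanish almost everywhere. -/
def exactForms (X : E → ι → E) (μ : Measure E) (p : ℝ) : (k : ℕ) → Submodule ℝ (Form E k)
  | 0 =>
    { carrier := {ω | coeff X ω =ᵐ[μ] 0}
      zero_mem' := by simp [coeff_zero]
      add_mem' := fun {a b} ha hb => by
        simp only [Set.mem_ofPred_eq, coeff_add] at *
        simpa using ha.add hb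
      smul_mem' := fun c a ha => by
        simp only [Set.mem_ofPred_eq, coeff_smul] at *
        simpa using ha.const_smul c }
  | k + 1 =>
    { carrier := {ω | ω ∈ lpForms X μ p (k + 1) ∧ ∃ β ∈ lpForms X μ p k, IsWeakExtDeriv β ω}
      zero_mem' := ⟨zero_mem _, 0, zero_mem _, IsWeakExtDeriv.zero k⟩
      add_mem' := by
        rintro a b ⟨ha, β, hβ, hβa⟩ ⟨hb, γ, hγ, hγb⟩
        exact ⟨add_mem ha hb, β + γ, add_mem hβ hγ, hβa.add hγb⟩
      smul_mem' := by
        rintro c a ⟨ha, β, hβ, hβa⟩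
        exact ⟨Submodule.smul_mem _ c ha, c • β, Submodule.smul_mem _ c hβ, hβa.smul c⟩ }

theorem exactForms_le (X : E → ι → E) (μ : Measure E) (p : ℝ) (k : ℕ) :
    exactForms X μ p k ≤ lpForms X μ p k := by
  cases k with
  | zero =>
    intro ω hω
    have h : coeff X ω =ᵐ[μ] 0 := hω
    exact (memLp_congr_ae h).2 MemLp.zero
  | succ k => exact fun ω hω => hω.1

/-- The closure of `im d` in `L^pΩ^k` for the `L^p` norm. -/
def closedExactForms (X : E → ι → E) (μ : Measure E) (p : ℝ) (k : ℕ) : Submodule ℝ (Form E k) where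
  carrier := {ω | ω ∈ lpForms X μ p k ∧ ∃ η : ℕ → Form E k, (∀ j, η j ∈ exactForms X μ p k) ∧
    Tendsto (fun j => eLpNorm (coeff X (ω - η j)) (ENNReal.ofReal p) μ) atTop (𝓝 0)}
  zero_mem' := ⟨zero_mem _, 0, fun _ => zero_mem _, by simp [coeff_zero]⟩
  add_mem' := by
    rintro a b ⟨ha, η, hη, hηa⟩ ⟨hb, θ, hθ, hθb⟩
    refine ⟨add_mem ha hb, η + θ, fun j => add_mem (hη j) (hθ j), ?_⟩
    have hsum := ENNReal.Tendsto.const_mul (a := ENNReal.LpAddConst (ENNReal.ofReal p)) (hηa.add hθb)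
      (Or.inr (ENNReal.LpAddConst_lt_top _).ne)
    simp only [add_zero, mul_zero] at hsum
    refine tendsto_of_tendsto_of_tendsto_of_le_of_le tendsto_const_nhds hsum
      (fun _ => bot_le) fun j => ?_
    have e : a + b - (η + θ) j = (a - η j) + (b - θ j) := by
      simp only [Pi.add_apply]; abel
    have h1 : MemLp (coeff X (a - η j)) (ENNReal.ofReal p) μ :=
      sub_mem ha (exactForms_le X μ p k (hη j))
    have h2 : MemLp (coeff X (b - θ j)) (ENNReal.ofReal p) μ :=
      sub_mem hb (exactForms_le X μ p k (hθ j))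
    simp only [e, coeff_add]
    exact eLpNorm_add_le' h1.1 h2.1 _
  smul_mem' := by
    rintro c a ⟨ha, η, hη, hηa⟩
    refine ⟨Submodule.smul_mem _ c ha, fun j => c • η j, fun j => Submodule.smul_mem _ c (hη j), ?_⟩
    have hmul := ENNReal.Tendsto.const_mul (a := ‖c‖ₑ) hηa (Or.inr (by simp))
    simpa only [← smul_sub, coeff_smul, eLpNorm_const_smul, mul_zero] using hmul

/-- The torsion `T^{k,p}`, the quotient of the closure of `im d` by `im d` in degree `k`. Forms that
vanish almost everywhere lie in `im d`, so that it does not matter for the quotient whether forms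
are identified when they agree almost everywhere. -/
abbrev Torsion (X : E → ι → E) (μ : Measure E) (p : ℝ) (k : ℕ) : Type _ :=
  closedExactForms X μ p k ⧸ (exactForms X μ p k).submoduleOf (closedExactForms X μ p k)

/-- The Riemannian volume of the metric with orthonormal frame `X`, written with the help of a basis
`b` of `E`: Haar measure normalised by `b` with the density `1 / |det_b (X x)|` at `x`. It gives an
infinitesimal parallelepiped on `X x` the volume `1` and does not depend on `b`. -/
def frameVolume [BorelSpace E] [DecidableEq ι] (b : Module.Basis ι ℝ E) (X : E → ι → E) :
    Measure E :=
  b.addHaar.withDensity fun x => ENNReal.ofReal |b.det (X x)|⁻¹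

end LpCoh

/-! ### Semi-direct products of a vector space by `ℝ` -/

namespace Semidirect

open LpCoh

variable {H : Type*} [NormedAddCommGroup H] [NormedSpace ℝ H] [CompleteSpace H]

theorem exp_add_apply (α : H →L[ℝ] H) (s t : ℝ) (v : H) :
    NormedSpace.exp ((s + t) • α) v = NormedSpace.exp (s • α) (NormedSpace.exp (t • α) v) := by
  let _ : NormedAlgebra ℚ (H →L[ℝ] H) := NormedAlgebra.restrictScalars ℚ ℝ _
  rw [add_smul, NormedSpace.exp_add_of_commute ((Commute.refl α).smul_left s |>.smul_right t)]
  rfl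

/-- The group `H ⋊_α ℝ`, that is, `H × ℝ` with `(h, t) (h', t') = (h + e^{tα} h', t + t')`. -/
@[reducible] def group (α : H →L[ℝ] H) : Group (H × ℝ) where
  mul x y := (x.1 + NormedSpace.exp (x.2 • α) y.1, x.2 + y.2)
  one := 0
  inv x := (-NormedSpace.exp (-x.2 • α) x.1, -x.2)
  mul_assoc x y z := by
    change ((x.1 + NormedSpace.exp (x.2 • α) y.1) + NormedSpace.exp ((x.2 + y.2) • α) z.1,
      x.2 + y.2 + z.2) = (x.1 + NormedSpace.exp (x.2 • α) (y.1 + NormedSpace.exp (y.2 • α) z.1),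
      x.2 + (y.2 + z.2))
    rw [exp_add_apply, map_add, add_assoc, add_assoc]
  one_mul x := by
    change ((0 : H) + NormedSpace.exp ((0 : ℝ) • α) x.1, (0 : ℝ) + x.2) = x
    simp [NormedSpace.exp_zero]
  mul_one x := by
    change (x.1 + NormedSpace.exp (x.2 • α) (0 : H), x.2 + (0 : ℝ)) = x
    simp
  inv_mul_cancel x := by
    change (-NormedSpace.exp (-x.2 • α) x.1 + NormedSpace.exp (-x.2 • α) x.1, -x.2 + x.2) =
      ((0, 0) : H × ℝ)
    simp

/-- Left translation by `x` in `H ⋊_α ℝ`. -/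
def leftMul (α : H →L[ℝ] H) (x y : H × ℝ) : H × ℝ := (group α).mul x y

/-- The left-invariant frame on `H ⋊_α ℝ` that extends a family `b` of vectors of the Lie algebra,
the tangent space at the identity `0`. -/
def leftFrame (α : H →L[ℝ] H) {ι : Type*} (b : ι → H × ℝ) (x : H × ℝ) (i : ι) : H × ℝ :=
  fderiv ℝ (leftMul α x) 0 (b i)

theorem leftFrame_apply (α : H →L[ℝ] H) {ι : Type*} (b : ι → H × ℝ) (x : H × ℝ) (i : ι) :
    leftFrame α b x i = (NormedSpace.exp (x.2 • α) (b i).1, (b i).2) := by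
  have h : HasFDerivAt (leftMul α x)
      (((NormedSpace.exp (x.2 • α)).comp (ContinuousLinearMap.fst ℝ H ℝ)).prod
        (ContinuousLinearMap.snd ℝ H ℝ)) 0 :=
    (((NormedSpace.exp (x.2 • α)).comp (ContinuousLinearMap.fst ℝ H ℝ)).hasFDerivAt.const_add
      x.1).prodMk ((ContinuousLinearMap.snd ℝ H ℝ).hasFDerivAt.const_add x.2)
  rw [leftFrame, h.fderiv]
  rfl

/-- The torsion `T^{k,p}(G)` in the `L^p`-cohomology of `G = H ⋊_α ℝ` with the left-invariant
Riemannian metric for which the basis `b` of the Lie algebra `H × ℝ` is orthonormal. -/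
abbrev Torsion [MeasureSpace H] [BorelSpace (H × ℝ)] (α : H →L[ℝ] H) {ι : Type*} [Fintype ι]
    [DecidableEq ι] (b : Module.Basis ι ℝ (H × ℝ)) (p : ℝ) (k : ℕ) : Type _ :=
  LpCoh.Torsion (leftFrame α b) (frameVolume b (leftFrame α b)) p k

/-- `p` is critical in degree `k` for `H ⋊_α ℝ` if `tr α / p` is the real part of an eigenvalue `z`
of the endomorphism induced by the transpose of `α` as a derivation on `Λ^k H^*`,
`ω ↦ ∑ i, ω(v₁, …, α v_i, …, v_k)`. Eigenvectors are complex valued alternating forms. -/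
def IsCritical (α : H →L[ℝ] H) (p : ℝ) (k : ℕ) : Prop :=
  ∃ (z : ℂ) (ω : H [⋀^Fin k]→ₗ[ℝ] ℂ), ω ≠ 0 ∧
    (∀ v : Fin k → H, ∑ i, ω (Function.update v i (α (v i))) = z * ω v) ∧
    z.re = LinearMap.trace ℝ H (α : H →ₗ[ℝ] H) / p

/-- The eigenvalues of `α` in `ℂ`, repeated according to algebraic multiplicity. -/
def eigenvalues [FiniteDimensional ℝ H] (α : H →L[ℝ] H) : Multiset ℂ :=
  ((α : H →ₗ[ℝ] H).charpoly.map (algebraMap ℝ ℂ)).roots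

/-- `w_k`, the sum of the first `k` of the numbers `lam`. -/
def lowerSum {m : ℕ} (lam : Fin m → ℝ) (k : ℕ) : ℝ := ∑ i ∈ Finset.univ.filter fun i : Fin m => (i : ℕ) < k, lam i

/-- `W_k`, the sum of the last `k` of the numbers `lam`. -/
def upperSum {m : ℕ} (lam : Fin m → ℝ) (k : ℕ) : ℝ := ∑ i ∈ Finset.univ.filter fun i : Fin m => m ≤ (i : ℕ) + k, lam i

end Semidirect

end

/-! Write H = ℝ^{n-1}, c₀ = tr α / p and k = l + 2; for k = 1 the two inequalities contradict each
other. At (h, t) the left-invariant frame is the Lie algebra basis moved by e^{tα} in the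
H-direction, and the Riemannian volume has density e^{-t tr α} up to a constant. The L^p-norm of a
form ω pulled back from H is therefore governed by e^{-c₀t} ω(e^{tα}·, …, e^{tα}·). As p is not
critical, the (k-1)-forms on H are the sum of a space V, for which this weighted flow decays as t →
+∞, and a space W, for which it decays as t → -∞ (`exists_decaying_add`). The inequalities w_{k-1} <
c₀ < W_{k-1} provide eigenforms showing that V and W are both proper.

Choose a linear P with values in V such that 1 - P has values in W. If ξ ∧ P(ξ ∧ c) vanished for all
covectors ξ and all (k-2)-forms c, then P would be a homothety, and V or W would be everything. So
some c and ξ give a non-zero value (`exists_split_covectorWedge`). Put A(ζ) = P(ζ ∧ c) and B(ζ) = ζ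
∧ c - A(ζ).

For a bump function ρ on H and cut-offs f, g of the time that switch off near t = T and t = -T,
consider η = d(f A(dρ) + g B(dρ)). Since A(dρ) + B(dρ) = d(ρc), the part of η without dt is (f - g)
dA(dρ), and the rest consists of f' dt ∧ A(dρ) near T and g' dt ∧ B(dρ) near -T, which are small for
large T. Replacing ρ by ρ(·/R) with R large after T is fixed makes the second-order middle part
small as well, compared with R⁻¹ (`exists_exact_block`). The coefficient of η in the slab 0 ≤ t ≤ 1
is still detected by a test function whose pairing with every dβ is bounded by a multiple of ‖β‖_p;
after normalisation this multiple does not depend on R (`exists_test_function`, `exists_block`).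

Hence there are exact forms η_j with disjoint supports and norms at most 4^{-j}, each pairing to 1
with a test function, where the pairings with dβ are at most D‖β‖_p. The sum of 2^j η_j is a limit
of exact forms. If it were dβ, then 2^j ≤ D‖β‖_p would hold for all j
(`nontrivial_torsion_of_disjoint_exactForms`). -/

noncomputable section

/-! ### Invariant families of vectors with a prescribed part of the spectrum -/

namespace Module.End

/-- As `f - μ` maps into `ker φ`, the endomorphism `f` acts on the one-dimensional quotient by `ker
φ` as `μ`. Determinants are multiplicative along an invariant subspace, so the identity holds after
evaluation at every `x`. -/
theorem charpoly_eq_charpoly_restrict_ker_mul {V : Type*} [AddCommGroup V] [Module ℂ V]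
    [FiniteDimensional ℂ V] (f : Module.End ℂ V) (μ : ℂ) (φ : V →ₗ[ℂ] ℂ) (hφ : φ ≠ 0)
    (h : LinearMap.range (f - μ • 1) ≤ LinearMap.ker φ)
    (hf : LinearMap.ker φ ≤ (LinearMap.ker φ).comap f) :
    f.charpoly = (f.restrict hf).charpoly * (Polynomial.X - Polynomial.C μ) := by
  refine Polynomial.funext fun x => ?_
  have he : LinearMap.ker φ ≤ (LinearMap.ker φ).comap (x • 1 - f : Module.End ℂ V) := by
    intro v hv
    have h1 : φ (f v) = 0 := hf hv
    have h2 : φ v = 0 := hv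
    simp [h1, h2]
  have hq : (LinearMap.ker φ).mapQ (LinearMap.ker φ) (x • 1 - f : Module.End ℂ V) he =
      (x - μ) • LinearMap.id := by
    ext v
    simp only [LinearMap.coe_comp, Function.comp_apply, Submodule.mkQ_apply, Submodule.mapQ_apply,
      LinearMap.smul_apply, LinearMap.id_apply, ← Submodule.Quotient.mk_smul]
    rw [Submodule.Quotient.eq]
    have h3 : (f - μ • 1 : Module.End ℂ V) v ∈ LinearMap.ker φ := h ⟨v, rfl⟩
    have : (x • 1 - f : Module.End ℂ V) v - (x - μ) • v = -((f - μ • 1 : Module.End ℂ V) v) := by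
      simp [sub_smul]
    rw [this]
    exact neg_mem h3
  have hr : LinearMap.restrict (x • 1 - f : Module.End ℂ V) he =
      x • (1 : Module.End ℂ (LinearMap.ker φ)) - LinearMap.restrict f hf := by
    ext v; simp
  have hd : Module.finrank ℂ (V ⧸ LinearMap.ker φ) = 1 := by
    rw [(φ.quotKerEquivOfSurjective (LinearMap.surjective hφ)).finrank_eq]
    simp
  have e : ∀ {W : Type _} [AddCommGroup W] [Module ℂ W] [FiniteDimensional ℂ W]
      (g : Module.End ℂ W), g.charpoly.eval x = LinearMap.det (x • 1 - g) := fun g => by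
    rw [LinearMap.eval_charpoly, Algebra.algebraMap_eq_smul_one]
  rw [Polynomial.eval_mul, e, LinearMap.det_eq_det_mul_det (LinearMap.ker φ) _ he, hq, hr]
  rw [LinearMap.eval_charpoly, Algebra.algebraMap_eq_smul_one]
  simp [hd]

/-- Since `f` need not be diagonalisable, eigenvectors would not suffice. If `s` omits a root `μ`,
the range of `f - μ` lies in a hyperplane, which is invariant and whose characteristic polynomial
has lost exactly that root. Descending in dimension one reaches a space whose roots are exactly `s`,
and there any basis will do. -/
theorem exists_invariant_family {V : Type*} [AddCommGroup V] [Module ℂ V] [FiniteDimensional ℂ V]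
    (f : Module.End ℂ V) (s : Multiset ℂ) (hs : s ≤ f.charpoly.roots) (j : ℕ)
    (hj : Multiset.card s = j) :
    ∃ (v : Fin j → V) (N : Matrix (Fin j) (Fin j) ℂ), LinearIndependent ℂ v ∧
      (∀ i, f (v i) = ∑ r, N i r • v r) ∧ N.trace = s.sum := by
  induction hn : Module.finrank ℂ V using Nat.strong_induction_on generalizing V with
  | _ n ih =>
  by_cases h : s = f.charpoly.roots
  · have hc : Module.finrank ℂ V = j := by
      rw [← LinearMap.charpoly_natDegree f, ← hj, h]
      exact (IsAlgClosed.splits f.charpoly).natDegree_eq_card_roots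
    let b := Module.finBasisOfFinrankEq ℂ V hc
    refine ⟨b, (LinearMap.toMatrix b b f).transpose, b.linearIndependent, fun i => ?_, ?_⟩
    · simp only [Matrix.transpose_apply, LinearMap.toMatrix_apply]
      exact (b.sum_repr _).symm
    · rw [Matrix.trace_transpose, ← LinearMap.trace_eq_matrix_trace, h,
        Module.End.trace_eq_sum_roots_charpoly_of_splits (IsAlgClosed.splits f.charpoly)]
  · obtain ⟨μ, hμ⟩ := Multiset.lt_iff_cons_le.1 (lt_of_le_of_ne hs h)
    have hroot : f.HasEigenvalue μ := by
      rw [hasEigenvalue_iff_isRoot_charpoly]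
      exact Polynomial.isRoot_of_mem_roots (Multiset.mem_of_le hμ (Multiset.mem_cons_self _ _))
    obtain ⟨w, hw⟩ := hroot.exists_hasEigenvector
    have hlt : LinearMap.range (f - μ • 1) < ⊤ := by
      refine lt_top_iff_ne_top.2 fun ht => ?_
      have hinj := LinearMap.injective_iff_surjective.2 (LinearMap.range_eq_top.1 ht)
      refine hw.2 (hinj ?_)
      simp [hw.apply_eq_smul]
    obtain ⟨φ, hφ, hle⟩ := Submodule.exists_le_ker_of_lt_top _ hlt
    have hf : LinearMap.ker φ ≤ (LinearMap.ker φ).comap f := by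
      intro v hv
      have h3 : (f - μ • 1 : Module.End ℂ V) v ∈ LinearMap.ker φ := hle ⟨v, rfl⟩
      have h4 := add_mem h3 (Submodule.smul_mem _ μ hv)
      simpa using h4
    have hchar := charpoly_eq_charpoly_restrict_ker_mul f μ φ hφ hle hf
    have hs' : s ≤ (f.restrict hf).charpoly.roots := by
      rw [hchar, Polynomial.roots_mul, Polynomial.roots_X_sub_C, add_comm,
        Multiset.singleton_add] at hμ
      · exact (Multiset.cons_le_cons_iff μ).1 hμ
      · exact mul_ne_zero (LinearMap.charpoly_monic _).ne_zero (Polynomial.X_sub_C_ne_zero μ)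
    have hdim : Module.finrank ℂ (LinearMap.ker φ) < n := by
      rw [← hn]
      refine Submodule.finrank_lt fun ht => hφ (LinearMap.ker_eq_top.1 ht)
    obtain ⟨v, N, hv, hN, htr⟩ := ih _ hdim (f.restrict hf) hs' rfl
    refine ⟨fun i => v i, N, hv.map' (LinearMap.ker φ).subtype (Submodule.ker_subtype _),
      fun i => ?_, htr⟩
    have := congrArg (LinearMap.ker φ).subtype (hN i)
    simpa using this

end Module.End

/-! ### Differentiation of a determinant, column by column -/

namespace Matrix

/-- By Cramer's rule the `i`-th summand is the diagonal entry of `A.adjugate * (M * A)`, and the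
trace is cyclic. -/
theorem sum_det_updateCol_mul {n R : Type*} [Fintype n] [DecidableEq n] [CommRing R]
    (M A : Matrix n n R) :
    ∑ i, (A.updateCol i fun r => (M * A) r i).det = M.trace * A.det := by
  have : ∀ i, (A.updateCol i fun r => (M * A) r i).det = (A.adjugate * (M * A)) i i := by
    intro i
    rw [← cramer_apply, cramer_eq_adjugate_mulVec]
    rfl
  simp only [this]
  change (A.adjugate * (M * A)).trace = _
  rw [trace_mul_comm, Matrix.mul_assoc, mul_adjugate]
  simp [mul_comm]

end Matrix

/-! ### Eigenforms of the derivation attached to sets of eigenvalues -/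

namespace Semidirect

/-- The alternating form `v ↦ det (⟨c i, v l⟩)` attached to `j` complex covectors `c`. -/
def complexDetForm {m j : ℕ} (c : Fin j → Fin m → ℂ) :
    EuclideanSpace ℝ (Fin m) [⋀^Fin j]→ₗ[ℝ] ℂ :=
  let L : EuclideanSpace ℝ (Fin m) →ₗ[ℝ] Fin j → ℂ :=
    { toFun := fun v i => ∑ a, c i a * (v a : ℂ)
      map_add' := fun v w => by ext i; simp [mul_add, Finset.sum_add_distrib]
      map_smul' := fun r v => by
        ext i; simp only [PiLp.smul_apply, smul_eq_mul, Complex.ofReal_mul, RingHom.id_apply,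
          Pi.smul_apply, Complex.real_smul, Finset.mul_sum]
        exact Finset.sum_congr rfl fun _ _ => by ring }
  { toFun := fun v => Matrix.detRowAlternating fun l => L (v l)
    map_update_add' := fun {_} v i x y => by
      have e : ∀ z, (fun l => L (Function.update v i z l)) =
          Function.update (fun l => L (v l)) i (L z) := fun z => by
        ext l : 1; by_cases h : l = i
        · subst h; simp
        · simp [h]
      cases Subsingleton.elim ‹DecidableEq (Fin j)› (instDecidableEqFin j)
      simp only [e, map_add, AlternatingMap.map_update_add]
    map_update_smul' := fun {_} v i x y => by
      have e : ∀ z, (fun l => L (Function.update v i z l)) =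
          Function.update (fun l => L (v l)) i (L z) := fun z => by
        ext l : 1; by_cases h : l = i
        · subst h; simp
        · simp [h]
      cases Subsingleton.elim ‹DecidableEq (Fin j)› (instDecidableEqFin j)
      simp only [e, map_smul, ← Complex.coe_smul (E := Fin j → ℂ),
        AlternatingMap.map_update_smul]
      exact Complex.coe_smul _ _
    map_eq_zero_of_eq' := fun v i i' h hne =>
      Matrix.detRowAlternating.map_eq_zero_of_eq _ (congrArg L h) hne }

theorem complexDetForm_apply {m j : ℕ} (c : Fin j → Fin m → ℂ)
    (v : Fin j → EuclideanSpace ℝ (Fin m)) :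
    complexDetForm c v = (Matrix.of fun i l => ∑ a, c i a * (v l a : ℂ)).det := by
  rw [← Matrix.det_transpose]
  rfl

/-- The covectors define a surjection ℂ^m → ℂ^j, so the determinant pulls back to a non-zero complex
alternating form. Such a form is determined by its values on the standard basis, whose vectors are
real. -/
theorem complexDetForm_ne_zero {m j : ℕ} {c : Fin j → Fin m → ℂ} (hc : LinearIndependent ℂ c) :
    complexDetForm c ≠ 0 := by
  intro h0
  have hr : (Matrix.of c).rank = j := by
    simpa using LinearIndependent.rank_matrix (M := Matrix.of c) hc
  have hsurj : Function.Surjective (Matrix.of c).mulVecLin := by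
    rw [← LinearMap.range_eq_top]
    exact Submodule.eq_top_of_finrank_eq (by simpa [Matrix.rank] using hr)
  choose w hw using fun i : Fin j => hsurj (Pi.single i 1)
  have hzero : (Matrix.detRowAlternating (n := Fin j) (R := ℂ)).compLinearMap
      (Matrix.of c).mulVecLin = 0 := by
    refine (Pi.basisFun ℂ (Fin m)).ext_alternating fun s _ => ?_
    have := congrArg (fun ω => ω fun l => EuclideanSpace.single (s l) (1 : ℝ)) h0
    simp only [complexDetForm_apply, PiLp.single_apply, AlternatingMap.zero_apply] at this
    rw [AlternatingMap.zero_apply, ← this, ← Matrix.det_transpose]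
    change Matrix.det _ = Matrix.det _
    congr 1
    ext i l
    simp [apply_ite Complex.ofReal]
  have h1 := congrArg (fun ω => ω w) hzero
  simp only [AlternatingMap.compLinearMap_apply, hw, AlternatingMap.zero_apply] at h1
  have h2 : Matrix.detRowAlternating (fun i : Fin j => (Pi.single i 1 : Fin j → ℂ)) = 1 := by
    have h3 : Matrix.of (fun i : Fin j => (Pi.single i 1 : Fin j → ℂ)) = 1 := by
      ext i l
      simp [Matrix.one_apply, Pi.single_apply, eq_comm]
    exact (congrArg Matrix.det h3).trans Matrix.det_one
  exact one_ne_zero (h2.symm.trans h1)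

/-- Every sub-multiset of `j` eigenvalues of `α` has a `j`-form on which the derivation induced by
`α` acts as the multiplication by its sum. -/
theorem exists_eigenform {m j : ℕ} (α : EuclideanSpace ℝ (Fin m) →L[ℝ] EuclideanSpace ℝ (Fin m))
    (s : Multiset ℂ) (hs : s ≤ eigenvalues α) (hj : Multiset.card s = j) :
    ∃ ω : EuclideanSpace ℝ (Fin m) [⋀^Fin j]→ₗ[ℝ] ℂ, ω ≠ 0 ∧
      ∀ v, ∑ i, ω (Function.update v i (α (v i))) = s.sum * ω v := by
  let b := (EuclideanSpace.basisFun (Fin m) ℝ).toBasis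
  let A : Matrix (Fin m) (Fin m) ℂ :=
    (LinearMap.toMatrix b b (α : EuclideanSpace ℝ (Fin m) →ₗ[ℝ] _)).map (algebraMap ℝ ℂ)
  have hA : ∀ (v : EuclideanSpace ℝ (Fin m)) a, ((α v) a : ℂ) = ∑ r, A a r * (v r : ℂ) := by
    intro v a
    have := congrFun (LinearMap.toMatrix_mulVec_repr b b (α : EuclideanSpace ℝ (Fin m) →ₗ[ℝ] _) v) a
    have h2 : (α v) a = ∑ r, LinearMap.toMatrix b b (α : EuclideanSpace ℝ (Fin m) →ₗ[ℝ] _) a r *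
        v r := by
      rw [Matrix.mulVec, dotProduct] at this
      simpa [b] using this.symm
    rw [h2]
    simp [A]
  -- The invariant family must consist of covectors, hence the transpose, which has the same
  -- characteristic polynomial.
  have hroots : eigenvalues α = (Matrix.toLin' A.transpose).charpoly.roots := by
    rw [Matrix.charpoly_toLin', Matrix.charpoly_transpose, Matrix.charpoly_map,
      LinearMap.charpoly_toMatrix]
    rfl
  rw [hroots] at hs
  obtain ⟨c, N, hc, hN, htr⟩ := Module.End.exists_invariant_family _ s hs j hj
  refine ⟨complexDetForm c, complexDetForm_ne_zero hc, fun v => ?_⟩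
  rw [← htr]
  simp only [complexDetForm_apply]
  -- Inserting `α (v i)` replaces column `i` of the matrix of the `c r (v l)` by the same column of
  -- its product with `N`.
  rw [← Matrix.sum_det_updateCol_mul]
  refine Finset.sum_congr rfl fun i _ => ?_
  congr 1
  ext r l
  by_cases hl : l = i
  · subst hl
    have h1 : ∀ a, ∑ x, A x a * c r x = ∑ q, N r q * c q a := by
      intro a
      have := congrFun (hN r) a
      rw [Matrix.toLin'_apply] at this
      simpa [Matrix.mulVec, dotProduct] using this
    simp only [Matrix.of_apply, Function.update_self, Matrix.updateCol_self, Matrix.mul_apply,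
      hA, Finset.mul_sum]
    rw [Finset.sum_comm, Finset.sum_comm (s := Finset.univ (α := Fin j))]
    refine Finset.sum_congr rfl fun a _ => ?_
    have h2 := congrArg (· * (v l a : ℂ)) (h1 a)
    simp only [Finset.sum_mul] at h2
    calc _ = ∑ x, A x a * c r x * (v l a : ℂ) := Finset.sum_congr rfl fun _ _ => by ring
      _ = _ := h2
      _ = _ := Finset.sum_congr rfl fun _ _ => by ring
  · simp [hl]

end Semidirect

/-! ### Alternating forms along the flow of a linear vector field -/

namespace AlternatingMap

variable {H F : Type*} [NormedAddCommGroup H] [NormedSpace ℝ H] [FiniteDimensional ℝ H]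
  [NormedAddCommGroup F] [NormedSpace ℝ F] {j : ℕ}

theorem continuous_of_finiteDimensional (ω : H [⋀^Fin j]→ₗ[ℝ] F) : Continuous ω := by
  let b := Module.finBasis ℝ H
  have h : ∀ v : Fin j → H, ω v =
      ∑ r : Fin j → Fin (Module.finrank ℝ H), (∏ l, b.repr (v l) (r l)) • ω fun l => b (r l) := by
    intro v
    have h1 : ω v = ω.toMultilinearMap fun l => ∑ a, b.repr (v l) a • b a := by
      simp only [b.sum_repr]; rfl
    rw [h1, MultilinearMap.map_sum]
    exact Finset.sum_congr rfl fun r _ => ω.toMultilinearMap.map_smul_univ _ _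
  have hc : ∀ a, Continuous fun x : H => b.repr x a := fun a =>
    (b.coord a).continuous_of_finiteDimensional
  rw [show (ω : (Fin j → H) → F) = _ from funext h]
  exact continuous_finsetSum _ fun r _ => (continuous_finsetProd _ fun l _ =>
    (hc (r l)).comp (continuous_apply l)).smul continuous_const

/-- An alternating map on a finite dimensional space as a continuous alternating map. -/
def toContinuous (ω : H [⋀^Fin j]→ₗ[ℝ] F) : H [⋀^Fin j]→L[ℝ] F :=
  { ω with cont := ω.continuous_of_finiteDimensional }

@[simp]
theorem toContinuous_apply (ω : H [⋀^Fin j]→ₗ[ℝ] F) (v : Fin j → H) : ω.toContinuous v = ω v := rfl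

end AlternatingMap

/-! ### Two facts on scalar functions of the time -/

theorem tendsto_one_add_pow_mul_exp_neg (n : ℕ) {δ : ℝ} (hδ : 0 < δ) :
    Tendsto (fun t : ℝ => (1 + t) ^ n * Real.exp (-(δ * t))) atTop (𝓝 0) := by
  have h1 : Tendsto (fun t : ℝ => δ * (1 + t)) atTop atTop :=
    (tendsto_atTop_add_const_left _ _ tendsto_id).const_mul_atTop hδ
  have h2 := ((Real.tendsto_pow_mul_exp_neg_atTop_nhds_zero n).comp h1).mul_const
    (Real.exp δ / δ ^ n)
  rw [zero_mul] at h2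
  refine h2.congr fun t => ?_
  have : Real.exp (-(δ * t)) = Real.exp (-(δ * (1 + t))) * Real.exp δ := by
    rw [← Real.exp_add]; congr 1; ring
  simp only [Function.comp_apply, mul_pow, this]
  field_simp

theorem eq_exp_mul_of_hasDerivAt {g : ℝ → ℂ} {z : ℂ} (h : ∀ t, HasDerivAt g (z * g t) t) (t : ℝ) :
    g t = Complex.exp (z * t) * g 0 := by
  have hd : ∀ s : ℝ, HasDerivAt (fun s : ℝ => Complex.exp (-z * s) * g s) 0 s := by
    intro s
    have h1 : HasDerivAt (fun s : ℝ => Complex.exp (-z * s)) (Complex.exp (-z * s) * (-z)) s := by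
      simpa using ((Complex.ofRealCLM.hasDerivAt (x := s)).const_mul (-z)).cexp
    exact (h1.mul (h s)).congr_deriv (by ring)
  have hc := is_const_of_deriv_eq_zero (fun s => (hd s).differentiableAt) (fun s => (hd s).deriv) t 0
  simp only [Complex.ofReal_zero, mul_zero, Complex.exp_zero, one_mul] at hc
  rw [← hc, ← mul_assoc, ← Complex.exp_add]
  simp

/-! ### Growth and decay of forms along the flow e^{tα} -/

namespace Semidirect

set_option linter.unusedSectionVars false

variable {H F : Type*} [NormedAddCommGroup H] [NormedSpace ℝ H] [FiniteDimensional ℝ H]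
  [NormedAddCommGroup F] [NormedSpace ℝ F] {j : ℕ}

/-- The endomorphism of the space of complex `j`-forms induced by `α` as a derivation. -/
def derivation (α : H →L[ℝ] H) : Module.End ℂ (H [⋀^Fin j]→L[ℝ] ℂ) where
  toFun ω := ω.fderivCompContinuousLinearMap (.id ℝ H) α
  map_add' ω η := by ext v; simp [Finset.sum_add_distrib]
  map_smul' z ω := by ext v; simp [Finset.mul_sum]

theorem derivation_apply (α : H →L[ℝ] H) (ω : H [⋀^Fin j]→L[ℝ] ℂ) (v : Fin j → H) :
    derivation α ω v = ∑ i, ω (Function.update v i (α (v i))) := by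
  rw [derivation, LinearMap.coe_mk, AddHom.coe_mk,
    ContinuousAlternatingMap.fderivCompContinuousLinearMap_apply]
  refine Finset.sum_congr rfl fun i _ => congrArg ω (funext fun l => ?_)
  by_cases h : l = i
  · subst h; simp
  · simp [h]

theorem derivation_neg (α : H →L[ℝ] H) :
    (derivation (-α) : Module.End ℂ (H [⋀^Fin j]→L[ℝ] ℂ)) = -derivation α := by
  ext ω v
  have (i : Fin j) : ω (Function.update v i (-α (v i))) = -ω (Function.update v i (α (v i))) := by
    rw [← neg_one_smul ℝ, ω.map_update_smul, neg_one_smul]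
  simp [derivation_apply, this]

theorem hasDerivAt_exp_apply (α : H →L[ℝ] H) (v : H) (t : ℝ) :
    HasDerivAt (fun s : ℝ => NormedSpace.exp (s • α) v) (α (NormedSpace.exp (t • α) v)) t := by
  have := (hasDerivAt_exp_smul_const' α t).clm_apply (hasDerivAt_const t v)
  simpa using this

theorem continuous_exp_apply (α : H →L[ℝ] H) (v : H) :
    Continuous fun s : ℝ => NormedSpace.exp (s • α) v :=
  continuous_iff_continuousAt.2 fun t => (hasDerivAt_exp_apply α v t).continuousAt

theorem hasDerivAt_flow (α : H →L[ℝ] H) (ω : H [⋀^Fin j]→L[ℝ] ℂ) (v : Fin j → H) (t : ℝ) :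
    HasDerivAt (fun s : ℝ => ω fun i => NormedSpace.exp (s • α) (v i))
      (derivation α ω fun i => NormedSpace.exp (t • α) (v i)) t := by
  have h := HasFDerivAt.multilinear_comp (f := ω.toContinuousMultilinearMap)
    (g := fun i (s : ℝ) => NormedSpace.exp (s • α) (v i)) (x := t)
    fun i => (hasDerivAt_exp_apply α (v i) t).hasFDerivAt
  exact h.hasDerivAt.congr_deriv (by simp [derivation_apply])

theorem flow_eigenform (α : H →L[ℝ] H) {ω : H [⋀^Fin j]→L[ℝ] ℂ} {z : ℂ}
    (h : derivation α ω = z • ω) (v : Fin j → H) (t : ℝ) :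
    ω (fun i => NormedSpace.exp (t • α) (v i)) = Complex.exp (z * t) * ω v := by
  have := eq_exp_mul_of_hasDerivAt (z := z) (fun t => by
    simpa [h] using hasDerivAt_flow α ω v t) t
  simpa [NormedSpace.exp_zero] using this

/-- The forms `ω` such that `(1 + t) e^{-ct} ω(e^{tα} v₁, …, e^{tα} v_j)` tends to `0` as `t` tends
to `+∞`, for all vectors `v₁, …, v_j`. -/
def decaying (α : H →L[ℝ] H) (c : ℝ) (F : Type*) [NormedAddCommGroup F] [NormedSpace ℝ F] (j : ℕ) :
    Submodule ℝ (H [⋀^Fin j]→L[ℝ] F) where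
  carrier := {ω | ∀ v : Fin j → H, Tendsto (fun t : ℝ => ((1 + t) * Real.exp (-(c * t))) •
    ω fun i => NormedSpace.exp (t • α) (v i)) atTop (𝓝 0)}
  zero_mem' v := by simp
  add_mem' {ω η} hω hη v := by simpa using (hω v).add (hη v)
  smul_mem' r ω hω v := by simpa [smul_comm _ r] using (hω v).const_smul r

theorem mem_decaying {α : H →L[ℝ] H} {c : ℝ} {ω : H [⋀^Fin j]→L[ℝ] F} :
    ω ∈ decaying α c F j ↔ ∀ v : Fin j → H, Tendsto (fun t : ℝ =>
      ((1 + t) * Real.exp (-(c * t))) • ω fun i => NormedSpace.exp (t • α) (v i)) atTop (𝓝 0) :=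
  Iff.rfl

theorem comp_mem_decaying {α : H →L[ℝ] H} {c : ℝ} {G : Type*} [NormedAddCommGroup G]
    [NormedSpace ℝ G] (L : F →L[ℝ] G) {ω : H [⋀^Fin j]→L[ℝ] F} (hω : ω ∈ decaying α c F j) :
    L.compContinuousAlternatingMap ω ∈ decaying α c G j := by
  intro v
  have := (L.continuous.tendsto 0).comp (hω v)
  simpa [Function.comp_def] using this

/-- The derivative of e^{-zt} ω(e^{tα}·) is the same expression for `(derivation α - z) ω`. Each
power of the nilpotent part thus costs one degree in `t`, by the mean value inequality. -/
theorem norm_exp_mul_flow_le (α : H →L[ℝ] H) (z : ℂ) (r : ℕ) : ∀ ω : H [⋀^Fin j]→L[ℝ] ℂ,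
    ((derivation α - z • 1) ^ r) ω = 0 → ∀ v : Fin j → H, ∃ C : ℝ, 0 ≤ C ∧ ∀ t : ℝ,
      ‖Complex.exp (-z * t) * ω fun i => NormedSpace.exp (t • α) (v i)‖ ≤ C * (1 + |t|) ^ r := by
  induction r with
  | zero => intro ω hω v; exact ⟨0, le_rfl, fun t => by simp_all⟩
  | succ r ih =>
    intro ω hω v
    obtain ⟨C, hC0, hC⟩ := ih ((derivation α - z • 1) ω) (by rw [pow_succ] at hω; exact hω) v
    have hd : ∀ s : ℝ, HasDerivAt
        (fun s : ℝ => Complex.exp (-z * s) * ω fun i => NormedSpace.exp (s • α) (v i))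
        (Complex.exp (-z * s) * ((derivation α - z • 1) ω) fun i => NormedSpace.exp (s • α) (v i))
        s := by
      intro s
      have h1 : HasDerivAt (fun s : ℝ => Complex.exp (-z * s)) (Complex.exp (-z * s) * (-z)) s := by
        simpa using ((Complex.ofRealCLM.hasDerivAt (x := s)).const_mul (-z)).cexp
      refine (h1.mul (hasDerivAt_flow α ω v s)).congr_deriv ?_
      simp only [LinearMap.sub_apply, LinearMap.smul_apply, Module.End.one_apply,
        ContinuousAlternatingMap.sub_apply, ContinuousAlternatingMap.smul_apply, smul_eq_mul]
      ring
    refine ⟨C + ‖ω v‖, by positivity, fun t => ?_⟩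
    have hb := (convex_Icc (-|t|) |t|).norm_image_sub_le_of_norm_hasDerivWithin_le
      (fun s _ => (hd s).hasDerivWithinAt) (C := C * (1 + |t|) ^ r) (fun s hs =>
        (hC s).trans (by have := abs_le.2 hs; gcongr)) (x := 0) (y := t)
      (by simp) (abs_le.1 le_rfl)
    simp only [Complex.ofReal_zero, mul_zero, Complex.exp_zero, one_mul, zero_smul,
      NormedSpace.exp_zero, one_apply_eq_self, sub_zero, Real.norm_eq_abs] at hb
    have h2 := norm_le_norm_add_norm_sub' (Complex.exp (-z * t) *
      ω fun i => NormedSpace.exp (t • α) (v i)) (ω v)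
    have h3 : (1 : ℝ) ≤ (1 + |t|) ^ (r + 1) := one_le_pow₀ (by linarith [abs_nonneg t])
    have h4 : C * (1 + |t|) ^ r * |t| ≤ C * (1 + |t|) ^ (r + 1) := by
      rw [mul_assoc, pow_succ]
      gcongr
      linarith
    calc _ ≤ _ := h2
      _ ≤ ‖ω v‖ * (1 + |t|) ^ (r + 1) + C * (1 + |t|) ^ (r + 1) :=
        add_le_add (le_mul_of_one_le_right (norm_nonneg _) h3) (hb.trans h4)
      _ = _ := by ring

/-- The exponential gap `c - z.re` beats the polynomial of degree `r` together with the extra factor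
`1 + t`. -/
theorem mem_decaying_of_pow_apply_eq_zero {α : H →L[ℝ] H} {c : ℝ} {z : ℂ} (hz : z.re < c) {r : ℕ}
    {ω : H [⋀^Fin j]→L[ℝ] ℂ} (hω : ((derivation α - z • 1) ^ r) ω = 0) :
    ω ∈ decaying α c ℂ j := by
  intro v
  obtain ⟨C, hC0, hC⟩ := norm_exp_mul_flow_le α z r ω hω v
  have h := (tendsto_one_add_pow_mul_exp_neg (r + 1) (sub_pos.2 hz)).const_mul C
  rw [mul_zero] at h
  refine squeeze_zero_norm' ?_ h
  filter_upwards [eventually_ge_atTop 0] with t ht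
  have h1 := hC t
  rw [norm_mul, Complex.norm_exp, abs_of_nonneg ht] at h1
  have h2 : (-z * t).re = -(z.re * t) := by simp
  rw [h2] at h1
  rw [norm_smul, norm_mul, Real.norm_eq_abs, Real.norm_eq_abs, Real.abs_exp,
    abs_of_nonneg (by linarith : 0 ≤ 1 + t)]
  have h3 : Real.exp (-(c * t)) = Real.exp (-((c - z.re) * t)) * Real.exp (-(z.re * t)) := by
    rw [← Real.exp_add]; congr 1; ring
  rw [h3]
  calc _ = (1 + t) * Real.exp (-((c - z.re) * t)) *
        (Real.exp (-(z.re * t)) * ‖ω fun i => NormedSpace.exp (t • α) (v i)‖) := by ring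
    _ ≤ (1 + t) * Real.exp (-((c - z.re) * t)) * (C * (1 + t) ^ r) := by gcongr
    _ = _ := by ring

instance : FiniteDimensional ℂ (H [⋀^Fin j]→L[ℝ] ℂ) := by
  let b := Module.finBasis ℝ H
  let L : (H [⋀^Fin j]→L[ℝ] ℂ) →ₗ[ℂ] (Fin j → Fin (Module.finrank ℝ H)) → ℂ :=
    { toFun := fun ω r => ω fun l => b (r l)
      map_add' := fun _ _ => rfl
      map_smul' := fun _ _ => rfl }
  refine FiniteDimensional.of_injective L fun ω η h => ?_
  exact ContinuousAlternatingMap.toAlternatingMap_injective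
    (b.ext_alternating fun r _ => congrFun h r)

/-- The forms are spanned by the generalised eigenspaces of the derivation. Those with real part
below `c` decay forwards, and those with real part above `c` decay backwards. -/
theorem exists_decaying_add_complex {α : H →L[ℝ] H} {c : ℝ}
    (hc : ∀ (z : ℂ) (ω : H [⋀^Fin j]→L[ℝ] ℂ), derivation α ω = z • ω → z.re = c → ω = 0)
    (ω : H [⋀^Fin j]→L[ℝ] ℂ) :
    ∃ ω₁ ∈ decaying α c ℂ j, ∃ ω₂ ∈ decaying (-α) (-c) ℂ j, ω₁ + ω₂ = ω := by
  have htop : ω ∈ ⨆ z, (derivation α).maxGenEigenspace z := by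
    rw [Module.End.iSup_maxGenEigenspace_eq_top]; trivial
  induction htop using Submodule.iSup_induction' with
  | mem z ω hω =>
    obtain ⟨r, hr⟩ := (Module.End.mem_maxGenEigenspace _ _ _).1 hω
    rcases lt_trichotomy z.re c with h | h | h
    · exact ⟨ω, mem_decaying_of_pow_apply_eq_zero h hr, 0, zero_mem _, add_zero _⟩
    -- There is no eigenvector for real part `c`, so the corresponding generalised eigenspace is
    -- zero too.
    · have hinj : Function.Injective
          (derivation α - z • 1 : Module.End ℂ (H [⋀^Fin j]→L[ℝ] ℂ)) := by
        rw [injective_iff_map_eq_zero]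
        exact fun η hη => hc z η (by simpa [sub_eq_zero] using hη) h
      rw [Module.End.pow_apply] at hr
      have := (hinj.iterate r) (hr.trans (Function.iterate_fixed (map_zero _) r).symm)
      exact ⟨0, zero_mem _, 0, zero_mem _, by simp [this]⟩
    · refine ⟨0, zero_mem _, ω, mem_decaying_of_pow_apply_eq_zero (z := -z) (r := r) (by simpa) ?_,
        zero_add _⟩
      have : (derivation (-α) - (-z) • 1 : Module.End ℂ (H [⋀^Fin j]→L[ℝ] ℂ)) =
          -(derivation α - z • 1) := by
        rw [derivation_neg, neg_smul]; abel
      rw [this, neg_pow]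
      simp [hr]
  | zero => exact ⟨0, zero_mem _, 0, zero_mem _, add_zero _⟩
  | add ω η _ _ h1 h2 =>
    obtain ⟨a, ha, b, hb, rfl⟩ := h1
    obtain ⟨a', ha', b', hb', rfl⟩ := h2
    exact ⟨a + a', add_mem ha ha', b + b', add_mem hb hb', by abel⟩

/-- Decay passes to real parts, so it is enough to split the form after extension of scalars to ℂ.
-/
theorem exists_decaying_add {α : H →L[ℝ] H} {p : ℝ} (hc : ¬ IsCritical α p j)
    (ω : H [⋀^Fin j]→L[ℝ] ℝ) :
    ∃ ω₁ ∈ decaying α (LinearMap.trace ℝ H (α : H →ₗ[ℝ] H) / p) ℝ j,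
      ∃ ω₂ ∈ decaying (-α) (-(LinearMap.trace ℝ H (α : H →ₗ[ℝ] H) / p)) ℝ j, ω₁ + ω₂ = ω := by
  have hc' : ∀ (z : ℂ) (ω : H [⋀^Fin j]→L[ℝ] ℂ), derivation α ω = z • ω →
      z.re = LinearMap.trace ℝ H (α : H →ₗ[ℝ] H) / p → ω = 0 := by
    intro z ω h hz
    by_contra hne
    refine hc ⟨z, ω.toAlternatingMap, fun h0 => hne ?_, fun v => ?_, hz⟩
    · exact ContinuousAlternatingMap.toAlternatingMap_injective h0
    · have := congrArg (fun η => η v) h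
      simpa [derivation_apply] using this
  obtain ⟨a, ha, b, hb, hab⟩ := exists_decaying_add_complex hc'
    (Complex.ofRealCLM.compContinuousAlternatingMap ω)
  refine ⟨_, comp_mem_decaying Complex.reCLM ha, _, comp_mem_decaying Complex.reCLM hb, ?_⟩
  ext v
  have := congrArg (fun η => (η v).re) hab
  simpa using this

/-- Along the flow an eigenform is multiplied by e^{zt}, which is at least e^{ct} in modulus for t ≥
0. If all real forms decayed, so would its real and imaginary parts. -/
theorem decaying_ne_top {α : H →L[ℝ] H} {c : ℝ} {z : ℂ} (hz : c ≤ z.re)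
    {ω : H [⋀^Fin j]→L[ℝ] ℂ} (hω : ω ≠ 0) (h : derivation α ω = z • ω) :
    decaying α c ℝ j ≠ ⊤ := by
  intro htop
  have hmem : ∀ η : H [⋀^Fin j]→L[ℝ] ℝ, η ∈ decaying α c ℝ j := fun η => htop ▸ trivial
  obtain ⟨v, hv⟩ : ∃ v, ω v ≠ 0 := by
    by_contra! h0
    exact hω (by ext v; simpa using h0 v)
  have hdec : Tendsto (fun t : ℝ => ((1 + t) * Real.exp (-(c * t))) •
      ω fun i => NormedSpace.exp (t • α) (v i)) atTop (𝓝 0) := by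
    have h1 := ((Complex.continuous_ofReal.tendsto 0).comp
      (hmem (Complex.reCLM.compContinuousAlternatingMap ω) v)).add
      (((Complex.continuous_ofReal.tendsto 0).comp
        (hmem (Complex.imCLM.compContinuousAlternatingMap ω) v)).mul_const Complex.I)
    simp only [Complex.ofReal_zero, zero_mul, add_zero] at h1
    have e : ∀ (r : ℝ) (x : ℂ), ((r • x.re : ℝ) : ℂ) + ((r • x.im : ℝ) : ℂ) * Complex.I = r • x := by
      intro r x
      apply Complex.ext <;> simp
    exact h1.congr fun t => e _ _
  have h2 : ∀ᶠ t : ℝ in atTop, ‖ω v‖ ≤ ‖((1 + t) * Real.exp (-(c * t))) •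
      ω fun i => NormedSpace.exp (t • α) (v i)‖ := by
    filter_upwards [eventually_ge_atTop 0] with t ht
    rw [flow_eigenform α h, norm_smul, norm_mul, norm_mul, Complex.norm_exp, Real.norm_eq_abs,
      Real.norm_eq_abs, Real.abs_exp, abs_of_nonneg (by linarith : 0 ≤ 1 + t), ← mul_assoc]
    refine le_mul_of_one_le_left (norm_nonneg _) ?_
    rw [mul_assoc, ← Real.exp_add]
    have : 1 ≤ Real.exp (-(c * t) + (z * t).re) := by
      rw [Real.one_le_exp_iff]
      simp only [Complex.mul_re, Complex.ofReal_re, Complex.ofReal_im, mul_zero, sub_zero]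
      nlinarith
    nlinarith
  have h3 := ge_of_tendsto hdec.norm h2
  simp at h3
  exact hv h3

/-- In top degree the determinant is an eigenform of the derivation, and its eigenvalue is the
trace. -/
theorem det_exp (α : H →L[ℝ] H) (t : ℝ) :
    LinearMap.det (NormedSpace.exp (t • α) : H →L[ℝ] H).toLinearMap =
      Real.exp (t * LinearMap.trace ℝ H (α : H →ₗ[ℝ] H)) := by
  let b := Module.finBasis ℝ H
  let ω : H [⋀^Fin (Module.finrank ℝ H)]→L[ℝ] ℂ :=
    Complex.ofRealCLM.compContinuousAlternatingMap b.det.toContinuous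
  have hω : derivation α ω = ((LinearMap.trace ℝ H (α : H →ₗ[ℝ] H) : ℝ) : ℂ) • ω := by
    ext v
    have h1 : ∑ i, b.det (Function.update v i (α (v i))) =
        LinearMap.trace ℝ H (α : H →ₗ[ℝ] H) * b.det v := by
      rw [LinearMap.trace_eq_matrix_trace ℝ b, Module.Basis.det_apply,
        ← Matrix.sum_det_updateCol_mul]
      refine Finset.sum_congr rfl fun i _ => ?_
      rw [Module.Basis.det_apply, Module.Basis.toMatrix_update]
      congr 2
      have := LinearMap.toMatrix_mulVec_repr b b (α : H →ₗ[ℝ] H) (v i)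
      exact this.symm
    have h2 := congrArg Complex.ofReal h1
    simpa [derivation_apply, ω] using h2
  have h := flow_eigenform α hω b t
  have h3 : b.det (fun i => NormedSpace.exp (t • α) (b i)) =
      LinearMap.det (NormedSpace.exp (t • α) : H →L[ℝ] H).toLinearMap := by
    have := b.det_comp (NormedSpace.exp (t • α) : H →L[ℝ] H).toLinearMap b
    rw [Module.Basis.det_self, mul_one] at this
    exact this
  rw [← h3]
  apply Complex.ofReal_injective
  have h4 : ω b = 1 := by simp [ω, b.det_self]
  rw [h4, mul_one] at h
  rw [Complex.ofReal_exp]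
  refine Eq.trans h ?_
  congr 1
  push_cast
  ring

end Semidirect

/-! ### Endomorphisms of the space of forms that preserve the multiples of every covector -/

section Wedge

variable {E : Type*} [NormedAddCommGroup E] [NormedSpace ℝ E] {l : ℕ}

/-- The exterior product `ξ ∧ c` of a covector and an alternating form. -/
def covectorWedge (ξ : E →L[ℝ] ℝ) (c : E [⋀^Fin l]→L[ℝ] ℝ) : E [⋀^Fin (l + 1)]→L[ℝ] ℝ :=
  ContinuousAlternatingMap.alternatizeUncurryFin (ξ.smulRight c)

theorem covectorWedge_apply (ξ : E →L[ℝ] ℝ) (c : E [⋀^Fin l]→L[ℝ] ℝ) (v : Fin (l + 1) → E) :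
    covectorWedge ξ c v = ∑ i : Fin (l + 1), (-1 : ℝ) ^ (i : ℕ) * (ξ (v i) * c (i.removeNth v)) := by
  simp [covectorWedge, ContinuousAlternatingMap.alternatizeUncurryFin_apply]

theorem covectorWedge_add (ξ ζ : E →L[ℝ] ℝ)
    (c : E [⋀^Fin l]→L[ℝ] ℝ) :
    covectorWedge (ξ + ζ) c = covectorWedge ξ c + covectorWedge ζ c := by
  ext v
  simp [covectorWedge_apply, add_mul, mul_add, Finset.sum_add_distrib]

theorem covectorWedge_smul (r : ℝ) (ξ : E →L[ℝ] ℝ)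
    (c : E [⋀^Fin l]→L[ℝ] ℝ) :
    covectorWedge (r • ξ) c = r • covectorWedge ξ c := by
  ext v
  simp only [covectorWedge_apply, smul_apply, smul_eq_mul,
    ContinuousAlternatingMap.smul_apply, Finset.mul_sum]
  exact Finset.sum_congr rfl fun _ _ => by ring

/-- On `v, w₁, …` with `ξ v ≠ 0`, only the first term of `ξ ∧ ω` survives. -/
theorem apply_eq_zero_of_covectorWedge_eq_zero {ξ : E →L[ℝ] ℝ} (hξ : ξ ≠ 0)
    {ω : E [⋀^Fin l]→L[ℝ] ℝ} (h : covectorWedge ξ ω = 0) (w : Fin l → E) (hw : ∀ i, ξ (w i) = 0) :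
    ω w = 0 := by
  obtain ⟨v, hv⟩ : ∃ v, ξ v ≠ 0 := by
    by_contra! h0
    exact hξ (by ext v; simpa using h0 v)
  have h1 := congrArg (fun η => η (Fin.cons v w)) h
  simp only [covectorWedge_apply, Fin.sum_univ_succ, Fin.cons_zero, Fin.cons_succ, hw] at h1
  simpa [hv] using h1

variable [FiniteDimensional ℝ E]

/-- The decomposable form `v ↦ det (φ i (v l))`. -/
def detForm (φ : Fin l → E →L[ℝ] ℝ) : E [⋀^Fin l]→L[ℝ] ℝ :=
  ((Matrix.detRowAlternating (n := Fin l) (R := ℝ)).compLinearMap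
    (LinearMap.pi fun i => (φ i).toLinearMap)).toContinuous

theorem detForm_apply (φ : Fin l → E →L[ℝ] ℝ) (v : Fin l → E) :
    detForm φ v = (Matrix.of fun r i => φ i (v r)).det := rfl

/-- Expansion along column `i`: a decomposable form is a multiple of each of its factors. -/
theorem detForm_eq_covectorWedge (φ : Fin (l + 1) → E →L[ℝ] ℝ) (i : Fin (l + 1)) :
    detForm φ = (-1 : ℝ) ^ (i : ℕ) • covectorWedge (φ i) (detForm (i.removeNth φ)) := by
  ext v
  rw [detForm_apply, Matrix.det_succ_column _ i, ContinuousAlternatingMap.smul_apply,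
    covectorWedge_apply, smul_eq_mul, Finset.mul_sum]
  refine Finset.sum_congr rfl fun r _ => ?_
  rw [pow_add, detForm_apply]
  simp only [Matrix.of_apply]
  have : (Matrix.of fun r i => (φ i) (v r)).submatrix r.succAbove i.succAbove =
      Matrix.of fun a b => (i.removeNth φ b) (r.removeNth v a) := rfl
  rw [this]
  ring

variable {P : (E [⋀^Fin (l + 1)]→L[ℝ] ℝ) →ₗ[ℝ] (E [⋀^Fin (l + 1)]→L[ℝ] ℝ)}

/-- The hypothesis `hP` says that `P` sends multiples of `ξ` to forms that vanish on the hyperplane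
`ξ = 0`. It applies to every factor of a decomposable form. -/
theorem map_detForm_apply_eq_zero
    (hP : ∀ (ξ : E →L[ℝ] ℝ) (c : E [⋀^Fin l]→L[ℝ] ℝ), covectorWedge ξ (P (covectorWedge ξ c)) = 0)
    (φ : Fin (l + 1) → E →L[ℝ] ℝ) (i : Fin (l + 1)) (hi : φ i ≠ 0) (w : Fin (l + 1) → E)
    (hw : ∀ r, φ i (w r) = 0) : P (detForm φ) w = 0 := by
  rw [detForm_eq_covectorWedge φ i, map_smul, ContinuousAlternatingMap.smul_apply,
    apply_eq_zero_of_covectorWedge_eq_zero hi (hP _ _) w hw, smul_zero]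

end Wedge

/-! ### Reduction to coordinate forms, and the choice of the splitting -/

section Coordinates

variable {m j : ℕ}

/-- The form `dx_{s 0} ∧ ⋯ ∧ dx_{s (j-1)}`. -/
def coordForm (s : Fin j → Fin m) : EuclideanSpace ℝ (Fin m) [⋀^Fin j]→L[ℝ] ℝ :=
  detForm fun i => EuclideanSpace.proj (s i)

/-- The vectors `e_{s 0}, …, e_{s (j-1)}` of the standard basis. -/
def coordVec (s : Fin j → Fin m) (i : Fin j) : EuclideanSpace ℝ (Fin m) :=
  EuclideanSpace.single (s i) 1

theorem coordForm_apply (s : Fin j → Fin m) (v : Fin j → EuclideanSpace ℝ (Fin m)) :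
    coordForm s v = (Matrix.of fun r i => v r (s i)).det := rfl

theorem coordForm_coordVec_self {s : Fin j → Fin m} (hs : Function.Injective s) :
    coordForm s (coordVec s) = 1 := by
  rw [coordForm_apply, ← Matrix.det_one (n := Fin j)]
  congr 1
  ext r i
  simp [coordVec, Matrix.one_apply, PiLp.single_apply, hs.eq_iff, eq_comm]

theorem coordForm_eq_zero_of_apply_eq_zero (s : Fin j → Fin m) (i : Fin j)
    (v : Fin j → EuclideanSpace ℝ (Fin m)) (h : ∀ r, v r (s i) = 0) : coordForm s v = 0 := by
  rw [coordForm_apply]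
  exact Matrix.det_eq_zero_of_column_eq_zero i fun r => h r

theorem coordForm_comp_perm (s : Fin j → Fin m) (σ : Equiv.Perm (Fin j)) :
    coordForm (s ∘ σ) = ((Equiv.Perm.sign σ : ℤ) : ℝ) • coordForm s := by
  ext v
  rw [ContinuousAlternatingMap.smul_apply, coordForm_apply, coordForm_apply, smul_eq_mul,
    ← Matrix.det_permute']
  rfl

theorem apply_comp_perm (ω : EuclideanSpace ℝ (Fin m) [⋀^Fin j]→L[ℝ] ℝ)
    (v : Fin j → EuclideanSpace ℝ (Fin m)) (σ : Equiv.Perm (Fin j)) :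
    ω (v ∘ σ) = ((Equiv.Perm.sign σ : ℤ) : ℝ) * ω v := by
  have := ω.toAlternatingMap.map_perm v σ
  rw [Units.smul_def, zsmul_eq_mul] at this
  exact this

theorem coordForm_eq_zero_of_not_injective {s : Fin j → Fin m} (hs : ¬ Function.Injective s) :
    coordForm s = 0 := by
  ext v
  simp only [Function.Injective, not_forall] at hs
  obtain ⟨a, b, hab, hne⟩ := hs
  rw [coordForm_apply, Matrix.det_zero_of_column_eq hne fun r => by simp [hab]]
  rfl

/-- The sum is over all maps, so each set of indices occurs in all `j!` orders. -/
theorem factorial_smul_eq_sum_coordForm (ω : EuclideanSpace ℝ (Fin m) [⋀^Fin j]→L[ℝ] ℝ) :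
    (j.factorial : ℝ) • ω = ∑ s : Fin j → Fin m, ω (coordVec s) • coordForm s := by
  ext v
  have hexp : ∀ w : Fin j → EuclideanSpace ℝ (Fin m),
      ω w = ∑ s : Fin j → Fin m, (∏ r, w r (s r)) * ω (coordVec s) := by
    intro w
    have h1 : ω w = ω.toAlternatingMap.toMultilinearMap
        fun r => ∑ a, (w r a) • EuclideanSpace.single a (1 : ℝ) := by
      have : ∀ r, ∑ a, (w r a) • EuclideanSpace.single a (1 : ℝ) = w r := fun r => by
        simpa using (EuclideanSpace.basisFun (Fin m) ℝ).sum_repr (w r)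
      simp only [this]
      rfl
    rw [h1, MultilinearMap.map_sum]
    exact Finset.sum_congr rfl fun s _ => ω.toAlternatingMap.toMultilinearMap.map_smul_univ _ _
  have hperm : ∀ σ : Equiv.Perm (Fin j),
      ω v = ((Equiv.Perm.sign σ : ℤ) : ℝ) * ω (v ∘ σ) := by
    intro σ
    rw [apply_comp_perm, ← mul_assoc, ← Int.cast_mul, ← Units.val_mul, Int.units_mul_self]
    simp
  calc ((j.factorial : ℝ) • ω) v = ∑ σ : Equiv.Perm (Fin j), ω v := by
        simp [Fintype.card_perm]
    _ = ∑ σ : Equiv.Perm (Fin j), ((Equiv.Perm.sign σ : ℤ) : ℝ) * ω (v ∘ σ) :=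
        Finset.sum_congr rfl fun σ _ => hperm σ
    _ = ∑ σ : Equiv.Perm (Fin j), ∑ s : Fin j → Fin m,
          ω (coordVec s) * (((Equiv.Perm.sign σ : ℤ) : ℝ) * ∏ r, v (σ r) (s r)) := by
        refine Finset.sum_congr rfl fun σ _ => ?_
        rw [hexp, Finset.mul_sum]
        exact Finset.sum_congr rfl fun s _ => by simp only [Function.comp_apply]; ring
    _ = ∑ s : Fin j → Fin m, ω (coordVec s) * coordForm s v := by
        rw [Finset.sum_comm]
        refine Finset.sum_congr rfl fun s _ => ?_
        rw [← Finset.mul_sum, coordForm_apply, Matrix.det_apply']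
        rfl
    _ = _ := by simp [ContinuousAlternatingMap.sum_apply]

variable {l : ℕ}
  {P : (EuclideanSpace ℝ (Fin m) [⋀^Fin (l + 1)]→L[ℝ] ℝ) →ₗ[ℝ]
    (EuclideanSpace ℝ (Fin m) [⋀^Fin (l + 1)]→L[ℝ] ℝ)}

/-- The image vanishes on every tuple of basis vectors that misses one of the indices `s i`. The
remaining tuples are permutations of `coordVec s`. -/
theorem map_coordForm_eq_smul
    (hP : ∀ ξ c, covectorWedge ξ (P (covectorWedge ξ c)) = 0)
    {s : Fin (l + 1) → Fin m} (hs : Function.Injective s) :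
    P (coordForm s) = P (coordForm s) (coordVec s) • coordForm s := by
  apply ContinuousAlternatingMap.toAlternatingMap_injective
  refine (EuclideanSpace.basisFun (Fin m) ℝ).toBasis.ext_alternating fun s' hs' => ?_
  have hv : (fun i => (EuclideanSpace.basisFun (Fin m) ℝ).toBasis (s' i)) = coordVec s' := by
    ext i : 1; simp [coordVec]
  rw [hv]
  change P (coordForm s) (coordVec s') = P (coordForm s) (coordVec s) * coordForm s (coordVec s')
  by_cases h : ∀ i, s i ∈ Set.range s'
  · choose τ hτ using h
    have hτi : Function.Injective τ := fun a b hab => hs (by rw [← hτ, ← hτ, hab])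
    let σ := Equiv.ofBijective τ (Finite.injective_iff_bijective.1 hτi)
    have hσ : coordVec s = coordVec s' ∘ σ := by
      ext i : 1
      simp [coordVec, σ, hτ]
    have h1 := coordForm_coordVec_self hs
    rw [hσ, apply_comp_perm] at h1 ⊢
    linear_combination (-(P (coordForm s) (coordVec s'))) * h1
  · push Not at h
    obtain ⟨i, hi⟩ := h
    have h0 : ∀ r, (coordVec s' r) (s i) = 0 := fun r => by
      simp only [coordVec, PiLp.single_apply, ite_eq_right_iff]
      exact fun h => absurd ⟨r, h.symm⟩ hi
    rw [coordForm_eq_zero_of_apply_eq_zero s i _ h0, mul_zero]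
    refine map_detForm_apply_eq_zero hP _ i ?_ _ h0
    intro h1
    have := congrArg (fun f => f (EuclideanSpace.single (s i) 1)) h1
    simp at this

/-- Polarisation: apply `P` to the decomposable form whose factor `i` is dx_{s i} + dx_b. Its image
vanishes when all arguments are in the kernel of this covector. With e_{s i} - e_b as argument `i`,
the value is the difference of the two scalars. -/
theorem map_coordForm_update
    (hP : ∀ ξ c, covectorWedge ξ (P (covectorWedge ξ c)) = 0)
    {s : Fin (l + 1) → Fin m} (hs : Function.Injective s) (i : Fin (l + 1)) (b : Fin m)
    (hb : b ∉ Set.range s) :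
    P (coordForm (Function.update s i b)) (coordVec (Function.update s i b)) =
      P (coordForm s) (coordVec s) := by
  have hb' : ∀ r, s r ≠ b := fun r h => hb ⟨r, h⟩
  have hs' : Function.Injective (Function.update s i b) := by
    intro x y hxy
    by_cases hx : x = i <;> by_cases hy : y = i
    · rw [hx, hy]
    · subst hx; simp [hy] at hxy; exact absurd hxy.symm (hb' y)
    · subst hy; simp [hx] at hxy; exact absurd hxy (hb' x)
    · simp [hx, hy] at hxy; exact hs hxy
  let φ : Fin (l + 1) → EuclideanSpace ℝ (Fin m) →L[ℝ] ℝ :=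
    Function.update (fun i => EuclideanSpace.proj (s i)) i
      (EuclideanSpace.proj (s i) + EuclideanSpace.proj b)
  let w : Fin (l + 1) → EuclideanSpace ℝ (Fin m) :=
    Function.update (coordVec s) i (EuclideanSpace.single (s i) 1 - EuclideanSpace.single b 1)
  have hφ : detForm φ = coordForm s + coordForm (Function.update s i b) := by
    ext v
    have hA : ∀ f : EuclideanSpace ℝ (Fin m) →L[ℝ] ℝ,
        (Matrix.of fun r a => (Function.update
          (fun i => (EuclideanSpace.proj (s i) : EuclideanSpace ℝ (Fin m) →L[ℝ] ℝ)) i f a) (v r)) =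
        (Matrix.of fun r a => v r (s a)).updateCol i fun r => f (v r) := by
      intro f
      ext r a
      by_cases ha : a = i
      · subst ha; simp
      · simp [ha]
    have h2 : coordForm (Function.update s i b) v =
        ((Matrix.of fun r a => v r (s a)).updateCol i fun r => v r b).det := by
      rw [coordForm_apply]
      congr 1
      ext r a
      by_cases ha : a = i
      · subst ha; simp
      · simp [ha]
    have h3 : coordForm s v = ((Matrix.of fun r a => v r (s a)).updateCol i fun r => v r (s i)).det := by
      rw [coordForm_apply]
      congr 1
      ext r a
      by_cases ha : a = i
      · subst ha; simp
      · simp [ha]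
    rw [ContinuousAlternatingMap.add_apply, h2, h3, detForm_apply, hA, ← Matrix.det_updateCol_add]
    rfl
  have hne : s i ≠ b := hb' i
  have hzero : P (detForm φ) w = 0 := by
    refine map_detForm_apply_eq_zero hP φ i ?_ w fun r => ?_
    · intro h1
      have := congrArg (fun f => f (EuclideanSpace.single b 1)) h1
      simp [φ, hne] at this
    · by_cases hr : r = i
      · subst hr; simp [φ, w, hne, hne.symm]
      · have h1 : s i ≠ s r := fun h => hr (hs h.symm)
        simp [φ, w, hr, coordVec, h1, (hb' r).symm]
  have hw : ∀ ω : EuclideanSpace ℝ (Fin m) [⋀^Fin (l + 1)]→L[ℝ] ℝ,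
      ω w = ω (coordVec s) - ω (coordVec (Function.update s i b)) := by
    intro ω
    have h1 := ω.toAlternatingMap.map_update_sub (coordVec s) i (EuclideanSpace.single (s i) 1)
      (EuclideanSpace.single b 1)
    have h2 : Function.update (coordVec s) i (EuclideanSpace.single (s i) 1) = coordVec s :=
      Function.update_eq_self i (coordVec s)
    have h3 : Function.update (coordVec s) i (EuclideanSpace.single b 1) =
        coordVec (Function.update s i b) := by
      ext r : 1
      by_cases hr : r = i
      · subst hr; simp [coordVec]
      · simp [coordVec, hr]
    rw [h2, h3] at h1
    exact h1
  have h4 : coordForm s (coordVec (Function.update s i b)) = 0 :=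
    coordForm_eq_zero_of_apply_eq_zero s i _ fun r => by
      by_cases hr : r = i
      · subst hr; simp [coordVec, hne]
      · have h1 : s i ≠ s r := fun h => hr (hs h.symm)
        simp [coordVec, hr, h1]
  have h5 : coordForm (Function.update s i b) (coordVec s) = 0 :=
    coordForm_eq_zero_of_apply_eq_zero _ i _ fun r => by simp [coordVec, (hb' r).symm]
  rw [hφ, map_add, map_coordForm_eq_smul hP hs, map_coordForm_eq_smul hP hs',
    ContinuousAlternatingMap.add_apply, ContinuousAlternatingMap.smul_apply,
    ContinuousAlternatingMap.smul_apply, hw, hw, coordForm_coordVec_self hs,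
    coordForm_coordVec_self hs', h4, h5] at hzero
  simp only [smul_eq_mul] at hzero
  linarith

/-- Exchange the indices of `s` outside the image of `s'` one at a time; the number of these indices
is the induction parameter. When none is left, `s` is a permutation of `s'` and the two signs
cancel. -/
theorem map_coordForm_const
    (hP : ∀ ξ c, covectorWedge ξ (P (covectorWedge ξ c)) = 0)
    {s s' : Fin (l + 1) → Fin m} (hs : Function.Injective s) (hs' : Function.Injective s') :
    P (coordForm s) (coordVec s) = P (coordForm s') (coordVec s') := by
  classical
  induction hn : (Finset.univ.image s \ Finset.univ.image s').card using Nat.strong_induction_on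
    generalizing s with
  | _ n ih =>
  by_cases h : ∀ i, s i ∈ Set.range s'
  · choose τ hτ using h
    have hτi : Function.Injective τ := fun a b hab => hs (by rw [← hτ, ← hτ, hab])
    let σ := Equiv.ofBijective τ (Finite.injective_iff_bijective.1 hτi)
    have hσ : s = s' ∘ σ := by
      ext i : 1
      simp [σ, hτ]
    have hσ' : coordVec (s' ∘ σ) = coordVec s' ∘ σ := rfl
    rw [hσ, hσ', coordForm_comp_perm, apply_comp_perm, map_smul,
      ContinuousAlternatingMap.smul_apply, smul_eq_mul, ← mul_assoc, ← Int.cast_mul,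
      ← Units.val_mul, Int.units_mul_self]
    simp
  · push Not at h
    obtain ⟨i, hi⟩ := h
    obtain ⟨b, hb', hb⟩ : ∃ b ∈ Finset.univ.image s', b ∉ Finset.univ.image s := by
      by_contra! hsub
      have := Finset.eq_of_subset_of_card_le (s := Finset.univ.image s')
        (t := Finset.univ.image s) hsub (by
          rw [Finset.card_image_of_injective _ hs, Finset.card_image_of_injective _ hs'])
      have h1 : s i ∈ Finset.univ.image s' := this ▸ Finset.mem_image_of_mem s (Finset.mem_univ i)
      exact hi (by simpa using h1)
    have hbr : b ∉ Set.range s := by simpa using hb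
    have hb'' : ∀ r, s r ≠ b := fun r h => hbr ⟨r, h⟩
    have hsu : Function.Injective (Function.update s i b) := by
      intro x y hxy
      by_cases hx : x = i <;> by_cases hy : y = i
      · rw [hx, hy]
      · subst hx; simp [hy] at hxy; exact absurd hxy.symm (hb'' y)
      · subst hy; simp [hx] at hxy; exact absurd hxy (hb'' x)
      · simp [hx, hy] at hxy; exact hs hxy
    rw [← map_coordForm_update hP hs i b hbr]
    refine ih _ ?_ hsu rfl
    rw [← hn]
    refine Finset.card_lt_card ⟨fun x hx => ?_, fun hsub => ?_⟩
    · rw [Finset.mem_sdiff, Finset.mem_image] at hx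
      obtain ⟨⟨r, -, hr⟩, hx'⟩ := hx
      by_cases hri : r = i
      · subst hri
        rw [Function.update_self] at hr
        exact absurd (hr ▸ hb') hx'
      · rw [Function.update_of_ne hri] at hr
        exact Finset.mem_sdiff.2 ⟨hr ▸ Finset.mem_image_of_mem s (Finset.mem_univ r), hx'⟩
    · have h1 : s i ∈ Finset.univ.image s \ Finset.univ.image s' := by simpa using hi
      have h2 := (Finset.mem_sdiff.1 (hsub h1)).1
      obtain ⟨r, -, hr⟩ := Finset.mem_image.1 h2
      by_cases hri : r = i
      · subst hri
        rw [Function.update_self] at hr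
        exact hb'' r hr.symm
      · rw [Function.update_of_ne hri] at hr
        exact hri (hs hr)

/-- An endomorphism of the space of `(l+1)`-forms that maps the multiples of every covector to
multiples of this covector is a homothety. -/
theorem exists_eq_smul_of_covectorWedge_map_eq_zero
    (hP : ∀ ξ c, covectorWedge ξ (P (covectorWedge ξ c)) = 0) : ∃ a : ℝ, ∀ ω, P ω = a • ω := by
  obtain ⟨a, ha⟩ : ∃ a : ℝ, ∀ s : Fin (l + 1) → Fin m, P (coordForm s) = a • coordForm s := by
    by_cases h : ∃ s : Fin (l + 1) → Fin m, Function.Injective s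
    · obtain ⟨s₀, hs₀⟩ := h
      refine ⟨P (coordForm s₀) (coordVec s₀), fun s => ?_⟩
      by_cases hs : Function.Injective s
      · rw [map_coordForm_eq_smul hP hs, map_coordForm_const hP hs hs₀]
      · simp [coordForm_eq_zero_of_not_injective hs]
    · push Not at h
      exact ⟨0, fun s => by simp [coordForm_eq_zero_of_not_injective (h s)]⟩
  refine ⟨a, fun ω => ?_⟩
  have hf : ((l + 1).factorial : ℝ) ≠ 0 := Nat.cast_ne_zero.2 (Nat.factorial_ne_zero _)
  have h1 := factorial_smul_eq_sum_coordForm ω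
  have h2 := congrArg P h1
  simp only [map_smul, map_sum, ha, smul_comm _ a] at h2
  rw [← Finset.smul_sum, ← h1, smul_comm a] at h2
  exact smul_right_injective _ hf h2

/-- Otherwise `P` would be a homothety with some factor `a`. Then `a = 0` gives `W = ⊤`, while `a ≠
0` gives `V = ⊤`. -/
theorem exists_split_covectorWedge
    (V W : Submodule ℝ (EuclideanSpace ℝ (Fin m) [⋀^Fin (l + 1)]→L[ℝ] ℝ))
    (hVW : ∀ ω, ∃ ω₁ ∈ V, ∃ ω₂ ∈ W, ω₁ + ω₂ = ω) (hV : V ≠ ⊤) (hW : W ≠ ⊤) :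
    ∃ (c : EuclideanSpace ℝ (Fin m) [⋀^Fin l]→L[ℝ] ℝ)
      (A B : (EuclideanSpace ℝ (Fin m) →L[ℝ] ℝ) →L[ℝ]
        EuclideanSpace ℝ (Fin m) [⋀^Fin (l + 1)]→L[ℝ] ℝ),
      (∀ ξ, A ξ ∈ V) ∧ (∀ ξ, B ξ ∈ W) ∧ (∀ ξ, A ξ + B ξ = covectorWedge ξ c) ∧
      ∃ ξ, covectorWedge ξ (A ξ) ≠ 0 := by
  let b := Module.Basis.ofVectorSpace ℝ (EuclideanSpace ℝ (Fin m) [⋀^Fin (l + 1)]→L[ℝ] ℝ)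
  -- `V` and `W` may intersect; decompositions chosen on a basis extend linearly all the same.
  choose f hf g hg hfg using fun i => hVW (b i)
  let P := b.constr ℝ f
  let Q := b.constr ℝ g
  have hPV : ∀ ω, P ω ∈ V := fun ω => by
    rw [Module.Basis.constr_apply]
    exact sum_mem fun i _ => V.smul_mem _ (hf i)
  have hQW : ∀ ω, Q ω ∈ W := fun ω => by
    rw [Module.Basis.constr_apply]
    exact sum_mem fun i _ => W.smul_mem _ (hg i)
  have hPQ : ∀ ω, P ω + Q ω = ω := by
    have : P + Q = LinearMap.id := b.ext fun i => by simp [P, Q, hfg]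
    exact fun ω => LinearMap.congr_fun this ω
  obtain ⟨ξ, c, hξ⟩ : ∃ ξ c, covectorWedge ξ (P (covectorWedge ξ c)) ≠ 0 := by
    by_contra! h
    obtain ⟨a, ha⟩ := exists_eq_smul_of_covectorWedge_map_eq_zero h
    by_cases h0 : a = 0
    · refine hW (Submodule.eq_top_iff'.2 fun ω => ?_)
      have := hPQ ω
      rw [ha, h0, zero_smul, zero_add] at this
      exact this ▸ hQW ω
    · refine hV (Submodule.eq_top_iff'.2 fun ω => ?_)
      have := V.smul_mem a⁻¹ (hPV ω)
      rwa [ha, smul_smul, inv_mul_cancel₀ h0, one_smul] at this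
  let L : (EuclideanSpace ℝ (Fin m) →L[ℝ] ℝ) →ₗ[ℝ]
      EuclideanSpace ℝ (Fin m) [⋀^Fin (l + 1)]→L[ℝ] ℝ :=
    { toFun := fun ζ => covectorWedge ζ c
      map_add' := fun _ _ => covectorWedge_add _ _ _
      map_smul' := fun _ _ => covectorWedge_smul _ _ _ }
  exact ⟨c, (P ∘ₗ L).toContinuousLinearMap, (Q ∘ₗ L).toContinuousLinearMap, fun _ => hPV _,
    fun _ => hQW _, fun _ => hPQ _, ξ, hξ⟩

end Coordinates

/-! ### Weak exterior derivatives and the torsion -/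

namespace LpCoh

variable {E : Type*} [NormedAddCommGroup E] [NormedSpace ℝ E] {ι : Type*}

theorem continuous_form_apply {k : ℕ} {ω : Form E k} (hω : Continuous ω) {v : E → Fin k → E}
    (hv : Continuous v) : Continuous fun x => ω x (v x) :=
  continuous_eval.comp (hω.prodMk hv)

theorem continuous_extDeriv {k : ℕ} {ω : Form E k} (hω : ContDiff ℝ 1 ω) :
    Continuous (extDeriv ω) :=
  (ContinuousAlternatingMap.alternatizeUncurryFinCLM ℝ E ℝ).continuous.comp
    (hω.continuous_fderiv one_ne_zero)

/-- The exterior derivative of a form of class `C^1` is its derivative in the sense of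
distributions. -/
theorem isWeakExtDeriv_extDeriv [MeasureSpace E] [BorelSpace E] [FiniteDimensional ℝ E]
    [(volume : Measure E).IsAddHaarMeasure] {k : ℕ} {ω : Form E k} (hω : ContDiff ℝ 1 ω) :
    IsWeakExtDeriv ω (extDeriv ω) where
  locallyIntegrable v :=
    (continuous_form_apply hω.continuous continuous_const).locallyIntegrable
  locallyIntegrable_deriv v :=
    (continuous_form_apply (continuous_extDeriv hω) continuous_const).locallyIntegrable
  integral_eq φ hφ hc v := by
    have hd : ∀ w : Fin k → E, ContDiff ℝ 1 fun x => ω x w := fun w =>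
      (ContinuousAlternatingMap.apply ℝ E ℝ w).contDiff.comp hω
    have hφ' : ∀ w, Continuous fun x => fderiv ℝ φ x w := fun w =>
      (hφ.continuous_fderiv (by simp)).clm_apply continuous_const
    have hω' : ∀ (w : Fin k → E) u, Continuous fun x => fderiv ℝ (fun y => ω y w) x u := fun w u =>
      ((hd w).continuous_fderiv one_ne_zero).clm_apply continuous_const
    have hint : ∀ i : Fin (k + 1),
        Integrable (fun x => φ x * fderiv ℝ (fun y => ω y (i.removeNth v)) x (v i)) := fun i =>
      (hφ.continuous.mul (hω' _ _)).integrable_of_hasCompactSupport hc.mul_right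
    have h1 : ∀ x, φ x * extDeriv ω x v = ∑ i : Fin (k + 1), (-1 : ℝ) ^ (i : ℕ) *
        (φ x * fderiv ℝ (fun y => ω y (i.removeNth v)) x (v i)) := by
      intro x
      rw [extDeriv_apply (hω.differentiable one_ne_zero x), Finset.mul_sum]
      refine Finset.sum_congr rfl fun i _ => ?_
      simp
      ring
    simp only [h1]
    rw [integral_finsetSum _ fun i _ => (hint i).const_mul _, ← Finset.sum_neg_distrib]
    refine Finset.sum_congr rfl fun i _ => ?_
    rw [integral_const_mul, integral_mul_fderiv_eq_neg_fderiv_mul_of_integrable, mul_neg]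
    · exact ((hφ' _).mul (hd _).continuous).integrable_of_hasCompactSupport
        (hc.fderiv_apply (𝕜 := ℝ) _).mul_right
    · exact hint i
    · exact (hφ.continuous.mul (hd _).continuous).integrable_of_hasCompactSupport hc.mul_right
    · exact fun x _ => hφ.differentiable (by simp) x
    · exact fun x _ => (hd _).differentiable one_ne_zero x

theorem extDeriv_const_smul_form {k : ℕ} (F : E → ℝ) (c : E [⋀^Fin k]→L[ℝ] ℝ) {x : E}
    (hF : DifferentiableAt ℝ F x) :
    extDeriv (fun y => F y • c) x = covectorWedge (fderiv ℝ F x) c := by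
  rw [extDeriv, covectorWedge, fderiv_smul_const hF]

theorem continuous_coeff {X : E → ι → E} (hX : Continuous X) {k : ℕ} {ω : Form E k}
    (hω : Continuous ω) : Continuous (coeff X ω) := by
  refine (PiLp.continuous_toLp 2 _).comp (continuous_pi fun f => ?_)
  exact continuous_const.mul (continuous_form_apply hω
    (continuous_pi fun i => (continuous_apply (f i)).comp hX))

theorem coeff_congr (X : E → ι → E) {k : ℕ} {ω η : Form E k} {x : E} (h : ω x = η x) :
    coeff X ω x = coeff X η x := by
  simp [coeff, h]

variable [Fintype ι]

theorem mem_lpForms_of_hasCompactSupport [MeasureSpace E] [BorelSpace E] {X : E → ι → E}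
    (hX : Continuous X) {μ : Measure E} [IsFiniteMeasureOnCompacts μ] {p : ℝ} {k : ℕ}
    {ω : Form E k} (hω : Continuous ω) (hc : HasCompactSupport ω) : ω ∈ lpForms X μ p k := by
  refine (continuous_coeff hX hω).memLp_of_hasCompactSupport (hc.mono' fun x hx => ?_)
  refine subset_tsupport _ fun h0 => hx ?_
  ext f
  simp [coeff, h0]

variable [MeasureSpace E] [BorelSpace E]

/-- If there are exact forms with disjoint supports and `L^p`-norms tending to `0` that pair to `1`
with test functions whose pairings are bounded on the differentials of the unit ball of `L^p`, then
the torsion does not vanish. -/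
theorem nontrivial_torsion_of_disjoint_exactForms (X : E → ι → E) (μ : Measure E) {p : ℝ}
    (hp : 1 < p) {k : ℕ} (v : Fin (k + 1) → E) (D : ℝ) (S : ℕ → Set E)
    (hS : Pairwise (Function.onFun Disjoint S)) (η : ℕ → Form E (k + 1)) (φ : ℕ → E → ℝ)
    (hη : ∀ j, η j ∈ exactForms X μ p (k + 1)) (hηS : ∀ j, ∀ x ∉ S j, η j x = 0)
    (hηn : ∀ j, eLpNorm (coeff X (η j)) (ENNReal.ofReal p) μ ≤ ENNReal.ofReal (4⁻¹ ^ j))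
    (hφ : ∀ j, ContDiff ℝ (⊤ : ℕ∞) (φ j)) (hφc : ∀ j, HasCompactSupport (φ j))
    (hφS : ∀ j, ∀ x ∉ S j, φ j x = 0) (hφη : ∀ j, ∫ x, φ j x * η j x v = 1)
    (hD : ∀ j, ∀ β ∈ lpForms X μ p k,
      |∑ i : Fin (k + 1), (-1 : ℝ) ^ (i : ℕ) *
        ∫ x, fderiv ℝ (φ j) x (v i) * β x (i.removeNth v)| ≤
      D * (eLpNorm (coeff X β) (ENNReal.ofReal p) μ).toReal) :
    Nontrivial (Torsion X μ p (k + 1)) := by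
  have hp0 : ENNReal.ofReal p ≠ 0 := by simp; linarith
  have hptop : ENNReal.ofReal p ≠ ⊤ := ENNReal.ofReal_ne_top
  have hp1 : 1 ≤ ENNReal.ofReal p := by
    rw [← ENNReal.ofReal_one]; exact ENNReal.ofReal_le_ofReal hp.le
  have hpr : (ENNReal.ofReal p).toReal = p := ENNReal.toReal_ofReal (by linarith)
  have hdis : ∀ {i j x}, x ∈ S j → i ≠ j → x ∉ S i := fun hx hij hx' =>
    Set.disjoint_left.1 (hS hij) hx' hx
  -- The weights 2^j leave norms at most 2^{-j}, still summable, while the pairing with `φ j`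
  -- becomes 2^j.
  let θ : ℕ → Form E (k + 1) := fun j => (2 : ℝ) ^ j • η j
  have hθ : ∀ j, θ j ∈ exactForms X μ p (k + 1) := fun j => Submodule.smul_mem _ _ (hη j)
  have hθS : ∀ j, ∀ x ∉ S j, θ j x = 0 := fun j x hx => by simp [θ, hηS j x hx]
  have hθn : ∀ j, eLpNorm (coeff X (θ j)) (ENNReal.ofReal p) μ ≤ ENNReal.ofReal (2⁻¹ ^ j) := by
    intro j
    rw [coeff_smul, eLpNorm_const_smul, ← ofReal_norm]
    refine (mul_le_mul_right (hηn j) _).trans ?_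
    rw [← ENNReal.ofReal_mul (norm_nonneg _)]
    refine ENNReal.ofReal_le_ofReal (le_of_eq ?_)
    rw [Real.norm_of_nonneg (by positivity), ← mul_pow]
    norm_num
  let Θ : Form E (k + 1) := fun x => ∑' j, θ j x
  have hΘ : ∀ j, ∀ x ∈ S j, Θ x = θ j x := fun j x hx =>
    tsum_eq_single j fun i hi => hθS i x (hdis hx hi)
  have hΘ0 : ∀ x, (∀ j, x ∉ S j) → Θ x = 0 := fun x hx => by
    simp only [Θ, fun j => hθS j x (hx j), tsum_zero]
  let T : ℕ → Form E (k + 1) := fun N => ∑ j ∈ Finset.range N, θ j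
  have hT : ∀ N, T N ∈ exactForms X μ p (k + 1) := fun N => sum_mem fun j _ => hθ j
  have hTx : ∀ N, ∀ j, ∀ x ∈ S j, T N x = if j < N then θ j x else 0 := by
    intro N j x hx
    have : ∀ i ∈ Finset.range N, θ i x = if i = j then θ j x else 0 := fun i _ => by
      split_ifs with h
      · rw [h]
      · exact hθS i x (hdis hx h)
    simp only [T, Finset.sum_apply]
    rw [Finset.sum_congr rfl this, Finset.sum_ite_eq']
    simp
  have hT0 : ∀ N x, (∀ j, x ∉ S j) → T N x = 0 := fun N x hx => by
    simp only [T, Finset.sum_apply, fun j => hθS j x (hx j), Finset.sum_const_zero]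
  -- As the supports are disjoint, at most one term of the tail is non-zero at each point, so p-th
  -- powers of norms add up.
  have hpow : ∀ (N : ℕ) x, ‖coeff X (Θ - T N) x‖ₑ ^ p = ∑' i, ‖coeff X (θ (i + N)) x‖ₑ ^ p := by
    intro N x
    have hz : ∀ ω : Form E (k + 1), ω x = 0 → ‖coeff X ω x‖ₑ ^ p = 0 := fun ω h => by
      have h1 : coeff X ω x = coeff X (0 : Form E (k + 1)) x := coeff_congr X h
      rw [h1, coeff_zero, Pi.zero_apply, enorm_zero, ENNReal.zero_rpow_of_pos (by linarith)]
    by_cases hx : ∃ j, x ∈ S j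
    · obtain ⟨j, hj⟩ := hx
      by_cases hjN : j < N
      · rw [hz _ (by simp [hΘ j x hj, hTx N j x hj, hjN])]
        refine (ENNReal.tsum_eq_zero.2 fun i => hz _ (hθS _ x (hdis hj (by omega)))).symm
      · rw [tsum_eq_single (j - N) fun i hi => hz _ (hθS _ x (hdis hj (by omega)))]
        congr 2
        refine coeff_congr X ?_
        have : j - N + N = j := by omega
        simp [hΘ j x hj, hTx N j x hj, hjN, this]
    · push Not at hx
      rw [hz _ (by simp [hΘ0 x hx, hT0 N x hx])]
      exact (ENNReal.tsum_eq_zero.2 fun i => hz _ (hθS _ x (hx _))).symm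
  have hθp : ∀ j, ∫⁻ x, ‖coeff X (θ j) x‖ₑ ^ p ∂μ ≤ 2⁻¹ ^ j := by
    intro j
    have h1 := hθn j
    rw [eLpNorm_eq_lintegral_rpow_enorm_toReal hp0 hptop, hpr] at h1
    have h2 : (ENNReal.ofReal (2⁻¹ ^ j) : ENNReal) = 2⁻¹ ^ j := by
      rw [ENNReal.ofReal_pow (by norm_num), ENNReal.ofReal_inv_of_pos two_pos, ENNReal.ofReal_ofNat]
    have h3 := ENNReal.rpow_le_rpow h1 (by linarith : 0 ≤ p)
    rw [← ENNReal.rpow_mul, one_div_mul_cancel (by linarith), ENNReal.rpow_one, h2] at h3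
    exact h3.trans (ENNReal.rpow_le_self_of_le_one (pow_le_one₀ bot_le (by simp)) hp.le)
  have hbound : ∀ N, ∫⁻ x, ‖coeff X (Θ - T N) x‖ₑ ^ p ∂μ ≤ ∑' i, 2⁻¹ ^ (i + N) := by
    intro N
    simp only [hpow]
    rw [lintegral_tsum fun i => (((hθ (i + N)).1.1.enorm).pow_const p)]
    exact ENNReal.tsum_le_tsum fun i => hθp _
  have hgeom : ∑' i : ℕ, (2⁻¹ : ENNReal) ^ i ≠ ⊤ := by
    rw [ENNReal.tsum_geometric]; simp
  have hlim : Tendsto (fun N => eLpNorm (coeff X (Θ - T N)) (ENNReal.ofReal p) μ) atTop (𝓝 0) := by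
    have h1 : Tendsto (fun N => ∫⁻ x, ‖coeff X (Θ - T N) x‖ₑ ^ p ∂μ) atTop (𝓝 0) :=
      tendsto_of_tendsto_of_tendsto_of_le_of_le tendsto_const_nhds
        (ENNReal.tendsto_sum_nat_add _ hgeom) (fun _ => bot_le) hbound
    have h2 := ((ENNReal.continuous_rpow_const (y := 1 / p)).tendsto 0).comp h1
    rw [ENNReal.zero_rpow_of_pos (by positivity)] at h2
    refine h2.congr fun N => ?_
    rw [eLpNorm_eq_lintegral_rpow_enorm_toReal hp0 hptop, hpr]
    rfl
  have hmeas : AEStronglyMeasurable (coeff X Θ) μ := by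
    refine aestronglyMeasurable_of_tendsto_ae atTop (fun N => (hT N).1.1)
      (Eventually.of_forall fun x => ?_)
    refine tendsto_const_nhds.congr' ?_
    by_cases hx : ∃ j, x ∈ S j
    · obtain ⟨j, hj⟩ := hx
      filter_upwards [eventually_gt_atTop j] with N hN
      exact coeff_congr X (by simp [hΘ j x hj, hTx N j x hj, hN])
    · push Not at hx
      exact Eventually.of_forall fun N => coeff_congr X (by rw [hΘ0 x hx, hT0 N x hx])
  have hmem : Θ ∈ lpForms X μ p (k + 1) := by
    refine ⟨hmeas, ?_⟩
    have h1 : Θ = Θ - T 0 := by simp [T]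
    rw [h1, eLpNorm_eq_lintegral_rpow_enorm_toReal hp0 hptop, hpr]
    refine ENNReal.rpow_lt_top_of_nonneg (by positivity) (ne_top_of_le_ne_top ?_ (hbound 0))
    simp
  have hcl : Θ ∈ closedExactForms X μ p (k + 1) := ⟨hmem, T, hT, hlim⟩
  refine Submodule.Quotient.nontrivial_iff.2 fun htop => ?_
  have hex : Θ ∈ exactForms X μ p (k + 1) := by
    have : (⟨Θ, hcl⟩ : closedExactForms X μ p (k + 1)) ∈
      (exactForms X μ p (k + 1)).submoduleOf (closedExactForms X μ p (k + 1)) := htop ▸ trivial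
    exact this
  obtain ⟨-, β, hβ, hβΘ⟩ := hex
  -- If the sum were dβ, its pairing with `φ j` would be 2^j, against the bound `hD` which does not
  -- depend on `j`.
  obtain ⟨j, hj⟩ := pow_unbounded_of_one_lt
    (D * (eLpNorm (coeff X β) (ENNReal.ofReal p) μ).toReal) (one_lt_two (α := ℝ))
  have h1 := hβΘ.integral_eq (φ j) (hφ j) (hφc j) v
  have h2 : ∀ x, φ j x * Θ x v = 2 ^ j * (φ j x * η j x v) := by
    intro x
    by_cases hx : x ∈ S j
    · rw [hΘ j x hx]
      simp only [θ, Pi.smul_apply, ContinuousAlternatingMap.smul_apply, smul_eq_mul]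
      ring
    · simp [hφS j x hx]
  simp only [h2] at h1
  rw [integral_const_mul, hφη, mul_one] at h1
  have h3 := hD j β hβ
  have h4 := neg_le_abs (∑ i : Fin (k + 1), (-1 : ℝ) ^ (i : ℕ) *
        ∫ x, fderiv ℝ (φ j) x (v i) * β x (i.removeNth v))
  linarith

end LpCoh

/-! ### The Riemannian volume and the `L^p`-norm of forms supported in cylinders -/

namespace Semidirect

open LpCoh

variable {m : ℕ} {ι : Type*}

theorem continuous_leftFrame (α : EuclideanSpace ℝ (Fin m) →L[ℝ] EuclideanSpace ℝ (Fin m))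
    (b : ι → EuclideanSpace ℝ (Fin m) × ℝ) : Continuous (leftFrame α b) := by
  refine continuous_pi fun i => ?_
  simp only [leftFrame_apply]
  exact ((continuous_exp_apply α _).comp continuous_snd).prodMk continuous_const

instance : (volume : Measure (EuclideanSpace ℝ (Fin m) × ℝ)).IsAddHaarMeasure :=
  Measure.prod.instIsAddHaarMeasure _ _

theorem det_leftFrame [Fintype ι] [DecidableEq ι]
    (α : EuclideanSpace ℝ (Fin m) →L[ℝ] EuclideanSpace ℝ (Fin m))
    (b : Module.Basis ι ℝ (EuclideanSpace ℝ (Fin m) × ℝ)) (x : EuclideanSpace ℝ (Fin m) × ℝ) :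
    b.det (leftFrame α b x) = Real.exp (x.2 * LinearMap.trace ℝ _
      (α : EuclideanSpace ℝ (Fin m) →ₗ[ℝ] EuclideanSpace ℝ (Fin m))) := by
  have h : leftFrame α b x = (LinearMap.prodMap
      (NormedSpace.exp (x.2 • α) : EuclideanSpace ℝ (Fin m) →L[ℝ] _).toLinearMap
      (LinearMap.id : ℝ →ₗ[ℝ] ℝ)) ∘ b := by
    ext1 i
    rw [leftFrame_apply]
    rfl
  rw [h, Module.Basis.det_comp, Module.Basis.det_self, mul_one, LinearMap.det_prodMap, det_exp,
    LinearMap.det_id, mul_one]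

/-- The density is the inverse of det e^{tα} = e^{t tr α}; the constant `κ` compares Haar measure
normalised by `b` with Lebesgue measure. -/
theorem exists_frameVolume_eq [Fintype ι] [DecidableEq ι]
    (α : EuclideanSpace ℝ (Fin m) →L[ℝ] EuclideanSpace ℝ (Fin m))
    (b : Module.Basis ι ℝ (EuclideanSpace ℝ (Fin m) × ℝ)) :
    ∃ κ : NNReal, κ ≠ 0 ∧ frameVolume b (leftFrame α b) =
      (κ : ENNReal) • (volume : Measure (EuclideanSpace ℝ (Fin m) × ℝ)).withDensity fun x =>
        ENNReal.ofReal (Real.exp (-(x.2 * LinearMap.trace ℝ _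
          (α : EuclideanSpace ℝ (Fin m) →ₗ[ℝ] EuclideanSpace ℝ (Fin m))))) := by
  refine ⟨Measure.addHaarScalarFactor b.addHaar volume,
    (Measure.addHaarScalarFactor_pos_of_isAddHaarMeasure _ _).ne', ?_⟩
  rw [frameVolume, ← withDensity_smul_measure]
  congr 1
  · exact Measure.isAddLeftInvariant_eq_smul _ _
  · ext x
    rw [det_leftFrame, Real.abs_exp, Real.exp_neg]

theorem volume_cylinder (z : EuclideanSpace ℝ (Fin m)) {R : ℝ} (hR : 0 ≤ R) (s t : ℝ) :
    (volume : Measure (EuclideanSpace ℝ (Fin m) × ℝ)) (Metric.closedBall z R ×ˢ Set.Icc s t) =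
      ENNReal.ofReal (R ^ m) * volume (Metric.closedBall (0 : EuclideanSpace ℝ (Fin m)) 1) *
        ENNReal.ofReal (t - s) := by
  rw [Measure.volume_eq_prod, Measure.prod_prod, Real.volume_Icc, Measure.addHaar_closedBall' _ _ hR]
  simp

theorem norm_coeff_le [Fintype ι] {k : ℕ} {X : EuclideanSpace ℝ (Fin m) × ℝ → ι → EuclideanSpace ℝ (Fin m) × ℝ}
    (ω : Form (EuclideanSpace ℝ (Fin m) × ℝ) k) (x : EuclideanSpace ℝ (Fin m) × ℝ) {δ : ℝ}
    (h : ∀ f : Fin k → ι, |ω x fun i => X x (f i)| ≤ δ) :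
    ‖coeff X ω x‖ ≤ Fintype.card (Fin k → ι) * δ := by
  have h1 : (Real.sqrt (k.factorial : ℝ))⁻¹ ≤ 1 := by
    apply inv_le_one_of_one_le₀
    rw [Real.one_le_sqrt]
    exact_mod_cast Nat.one_le_iff_ne_zero.2 (Nat.factorial_ne_zero k)
  have h2 : ‖coeff X ω x‖ ≤ ∑ f, ‖coeff X ω x f‖ := by
    rw [EuclideanSpace.norm_eq]
    refine Real.sqrt_le_iff.2 ⟨Finset.sum_nonneg fun _ _ => norm_nonneg _, ?_⟩
    exact Finset.sum_sq_le_sq_sum_of_nonneg fun _ _ => norm_nonneg _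
  refine h2.trans ((Finset.sum_le_card_nsmul _ _ δ fun f _ => ?_).trans (by simp))
  simp only [coeff]
  rw [norm_mul, Real.norm_eq_abs, Real.norm_eq_abs, abs_of_nonneg (by positivity)]
  exact (mul_le_of_le_one_left (abs_nonneg _) h1).trans (h f)

/-! ### Estimates of norms and of pairings -/

section Norms

variable [Fintype ι] [DecidableEq ι]
  (α : EuclideanSpace ℝ (Fin m) →L[ℝ] EuclideanSpace ℝ (Fin m))
  (b : Module.Basis ι ℝ (EuclideanSpace ℝ (Fin m) × ℝ)) {p : ℝ} {k : ℕ}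

instance : IsFiniteMeasureOnCompacts (frameVolume b (leftFrame α b)) := by
  obtain ⟨κ, -, h⟩ := exists_frameVolume_eq α b
  rw [h]
  have : IsLocallyFiniteMeasure ((volume : Measure (EuclideanSpace ℝ (Fin m) × ℝ)).withDensity
      fun x => ENNReal.ofReal (Real.exp (-(x.2 * LinearMap.trace ℝ _
          (α : EuclideanSpace ℝ (Fin m) →ₗ[ℝ] EuclideanSpace ℝ (Fin m)))))) :=
    IsLocallyFiniteMeasure.withDensity_ofReal (by fun_prop)
  refine ⟨fun K hK => ?_⟩
  rw [Measure.smul_apply, smul_eq_mul]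
  exact ENNReal.mul_lt_top ENNReal.coe_lt_top hK.measure_lt_top

/-- A bound for the `L^p`-norm of a form supported in a cylinder. -/
theorem exists_eLpNorm_coeff_le (hp : 1 < p) : ∃ C : ℝ, 0 ≤ C ∧
    ∀ (ω : Form (EuclideanSpace ℝ (Fin m) × ℝ) k) (z : EuclideanSpace ℝ (Fin m)) (R T δ : ℝ),
      0 ≤ R → 0 ≤ T → 0 ≤ δ →
      (∀ x ∉ Metric.closedBall z R ×ˢ Set.Icc (-T) T, ω x = 0) →
      (∀ x, ∀ f : Fin k → ι, Real.exp (-(LinearMap.trace ℝ _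
        (α : EuclideanSpace ℝ (Fin m) →ₗ[ℝ] EuclideanSpace ℝ (Fin m)) / p * x.2)) *
          |ω x fun i => leftFrame α b x (f i)| ≤ δ) →
      eLpNorm (coeff (leftFrame α b) ω) (ENNReal.ofReal p) (frameVolume b (leftFrame α b)) ≤
        ENNReal.ofReal (C * δ * (R ^ m * T) ^ p⁻¹) := by
  obtain ⟨κ, -, hκ⟩ := exists_frameVolume_eq α b
  have hp0 : ENNReal.ofReal p ≠ 0 := by simp; linarith
  have hptop : ENNReal.ofReal p ≠ ⊤ := ENNReal.ofReal_ne_top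
  have hpr : (ENNReal.ofReal p).toReal = p := ENNReal.toReal_ofReal (by linarith)
  set τ := LinearMap.trace ℝ _ (α : EuclideanSpace ℝ (Fin m) →ₗ[ℝ] EuclideanSpace ℝ (Fin m))
  let V : ℝ := (volume (Metric.closedBall (0 : EuclideanSpace ℝ (Fin m)) 1)).toReal
  have hV : ENNReal.ofReal V = volume (Metric.closedBall (0 : EuclideanSpace ℝ (Fin m)) 1) :=
    ENNReal.ofReal_toReal measure_closedBall_lt_top.ne
  have hV0 : 0 ≤ V := ENNReal.toReal_nonneg
  let N : ℝ := Fintype.card (Fin k → ι)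
  have hN0 : 0 ≤ N := Nat.cast_nonneg _
  refine ⟨N * (κ * V * 2) ^ p⁻¹, by positivity, fun ω z R T δ hR hT hδ hsupp hbound => ?_⟩
  rw [eLpNorm_eq_lintegral_rpow_enorm_toReal hp0 hptop, hpr, hκ, lintegral_smul_measure, one_div]
  set K := Metric.closedBall z R ×ˢ Set.Icc (-T) T with hK
  have hKm : MeasurableSet K := measurableSet_closedBall.prod measurableSet_Icc
  have h1 : ∫⁻ x, ‖coeff (leftFrame α b) ω x‖ₑ ^ p ∂(volume.withDensity fun x =>
      ENNReal.ofReal (Real.exp (-(x.2 * τ)))) ≤ ENNReal.ofReal ((N * δ) ^ p) * volume K := by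
    refine (lintegral_withDensity_le_lintegral_mul _ (by fun_prop) _).trans ?_
    rw [← setLIntegral_const, ← lintegral_indicator hKm]
    refine lintegral_mono fun x => ?_
    by_cases hx : x ∈ K
    · rw [Set.indicator_of_mem hx, Pi.mul_apply, ← ofReal_norm,
        ENNReal.ofReal_rpow_of_nonneg (norm_nonneg _) (by linarith),
        ← ENNReal.ofReal_mul (Real.exp_nonneg _)]
      refine ENNReal.ofReal_le_ofReal ?_
      -- The volume density is the p-th power of the weight e^{-(τ/p)t} in the pointwise bound.
      have h2 : Real.exp (-(x.2 * τ)) = Real.exp (-(τ / p * x.2)) ^ p := by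
        rw [← Real.exp_mul]; congr 1; field_simp
      rw [h2, ← Real.mul_rpow (Real.exp_nonneg _) (norm_nonneg _)]
      refine Real.rpow_le_rpow (by positivity) ?_ (by linarith)
      have h3 := norm_coeff_le (X := leftFrame α b) ω x (δ := δ * Real.exp (τ / p * x.2)) fun f => by
        have := hbound x f
        rw [Real.exp_neg, inv_mul_le_iff₀ (Real.exp_pos _)] at this
        linarith
      rw [Real.exp_neg, inv_mul_le_iff₀ (Real.exp_pos _)]
      calc _ ≤ _ := h3
        _ = _ := by simp only [N]; ring
    · have h0 : coeff (leftFrame α b) ω x = 0 := by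
        have := coeff_congr (leftFrame α b) (ω := ω) (η := 0) (x := x) (by simp [hsupp x hx])
        rw [this, coeff_zero]
        rfl
      rw [Pi.mul_apply, h0, enorm_zero, ENNReal.zero_rpow_of_pos (by linarith), mul_zero]
      exact bot_le
  rw [hK, volume_cylinder z hR, ← hV, ← ENNReal.ofReal_mul (by positivity),
    ← ENNReal.ofReal_mul (by positivity), ← ENNReal.ofReal_mul (by positivity)] at h1
  have h4 := ENNReal.rpow_le_rpow (mul_le_mul_right h1 (κ : ENNReal)) (by positivity : 0 ≤ p⁻¹)
  refine h4.trans (le_of_eq ?_)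
  have h5 : (κ : ENNReal) = ENNReal.ofReal κ := by simp
  rw [h5, ← ENNReal.ofReal_mul (by positivity), ENNReal.ofReal_rpow_of_nonneg (by
    have : 0 ≤ T - -T := by linarith
    positivity) (by positivity)]
  congr 1
  have h6 : (κ : ℝ) * ((N * δ) ^ p * (R ^ m * V * (T - -T))) =
      (N * δ) ^ p * ((κ * V * 2) * (R ^ m * T)) := by ring
  rw [h6, Real.mul_rpow (by positivity) (by positivity), Real.rpow_rpow_inv (by positivity)
    (by linarith), Real.mul_rpow (by positivity) (by positivity)]
  ring

/-- Constant vectors have coefficients in the left-invariant frame that depend only on `t`,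
continuously, hence are bounded for 0 ≤ t ≤ 1. -/
theorem exists_abs_apply_le (w : Fin k → EuclideanSpace ℝ (Fin m) × ℝ) : ∃ C : ℝ, 0 ≤ C ∧
    ∀ (β : Form (EuclideanSpace ℝ (Fin m) × ℝ) k) (x : EuclideanSpace ℝ (Fin m) × ℝ),
      x.2 ∈ Set.Icc (0 : ℝ) 1 → |β x w| ≤ C * ‖coeff (leftFrame α b) β x‖ := by
  let G : ℝ → EuclideanSpace ℝ (Fin m) × ℝ → ι → ℝ := fun t u a =>
    b.repr (NormedSpace.exp ((-t) • α) u.1, u.2) a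
  have hG : ∀ (x u : EuclideanSpace ℝ (Fin m) × ℝ), ∑ a, G x.2 u a • leftFrame α b x a = u := by
    intro x u
    have h1 : ∀ a, leftFrame α b x a = (LinearMap.prodMap
        (NormedSpace.exp (x.2 • α) : EuclideanSpace ℝ (Fin m) →L[ℝ] _).toLinearMap
        (LinearMap.id : ℝ →ₗ[ℝ] ℝ)) (b a) := fun a => by rw [leftFrame_apply]; rfl
    simp only [h1, ← map_smul, ← map_sum, G]
    rw [b.sum_repr]
    have h2 := exp_add_apply α x.2 (-x.2) u.1
    rw [add_neg_cancel, zero_smul, NormedSpace.exp_zero] at h2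
    exact Prod.ext h2.symm rfl
  have hGc : ∀ u a, Continuous fun t => G t u a := by
    intro u a
    have h1 : Continuous fun y => b.repr y a := (b.coord a).continuous_of_finiteDimensional
    exact h1.comp (((continuous_exp_apply α u.1).comp continuous_neg).prodMk continuous_const)
  let S : ℝ → ℝ := fun t => ∑ r : Fin k → ι, ∏ i, |G t (w i) (r i)|
  have hS : Continuous S := continuous_finsetSum _ fun r _ => continuous_finsetProd _ fun i _ =>
    (hGc _ _).abs
  obtain ⟨C, hC⟩ := isCompact_Icc.exists_bound_of_continuousOn (s := Set.Icc (0 : ℝ) 1) hS.continuousOn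
  have hC0 : 0 ≤ C := (norm_nonneg _).trans (hC 0 (by simp))
  refine ⟨C * Real.sqrt (k.factorial : ℝ), by positivity, fun β x hx => ?_⟩
  have hk : 0 < Real.sqrt (k.factorial : ℝ) :=
    Real.sqrt_pos.2 (Nat.cast_pos.2 (Nat.factorial_pos k))
  have h1 : β x w = ∑ r : Fin k → ι,
      (∏ i, G x.2 (w i) (r i)) * β x fun i => leftFrame α b x (r i) := by
    have h2 : β x w = (β x).toAlternatingMap.toMultilinearMap
        fun i => ∑ a, G x.2 (w i) a • leftFrame α b x a := by
      simp only [hG]; rfl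
    rw [h2, MultilinearMap.map_sum]
    exact Finset.sum_congr rfl fun s _ => (β x).toAlternatingMap.toMultilinearMap.map_smul_univ _ _
  have h3 : ∀ r : Fin k → ι, |β x fun i => leftFrame α b x (r i)| ≤
      Real.sqrt (k.factorial : ℝ) * ‖coeff (leftFrame α b) β x‖ := by
    intro r
    have h4 := PiLp.norm_apply_le (coeff (leftFrame α b) β x) r
    simp only [coeff] at h4 ⊢
    rw [norm_mul, norm_inv, Real.norm_of_nonneg hk.le, inv_mul_le_iff₀ hk] at h4
    exact h4
  calc |β x w| ≤ ∑ r : Fin k → ι, (∏ i, |G x.2 (w i) (r i)|) *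
        (Real.sqrt (k.factorial : ℝ) * ‖coeff (leftFrame α b) β x‖) := by
        rw [h1]
        refine (Finset.abs_sum_le_sum_abs _ _).trans (Finset.sum_le_sum fun r _ => ?_)
        rw [abs_mul, Finset.abs_prod]
        exact mul_le_mul_of_nonneg_left (h3 r) (Finset.prod_nonneg fun _ _ => abs_nonneg _)
    _ = S x.2 * (Real.sqrt (k.factorial : ℝ) * ‖coeff (leftFrame α b) β x‖) := by
        rw [← Finset.sum_mul]
    _ ≤ C * (Real.sqrt (k.factorial : ℝ) * ‖coeff (leftFrame α b) β x‖) :=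
        mul_le_mul_of_nonneg_right ((le_abs_self _).trans (hC _ hx)) (by positivity)
    _ = _ := by ring

/-- On the slab 0 ≤ t ≤ 1 the density lies between two positive constants. Test functions are
supported there, so Lebesgue pairings can be estimated by L^p-norms for the Riemannian volume. -/
theorem exists_measure_bounds : ∃ c C : ℝ, 0 < c ∧ 0 ≤ C ∧
    ∀ A : Set (EuclideanSpace ℝ (Fin m) × ℝ), MeasurableSet A → (∀ x ∈ A, x.2 ∈ Set.Icc (0 : ℝ) 1) →
      volume A ≤ ENNReal.ofReal c * frameVolume b (leftFrame α b) A ∧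
      frameVolume b (leftFrame α b) A ≤ ENNReal.ofReal C * volume A := by
  obtain ⟨κ, hκ0, hκ⟩ := exists_frameVolume_eq α b
  set τ := LinearMap.trace ℝ _ (α : EuclideanSpace ℝ (Fin m) →ₗ[ℝ] EuclideanSpace ℝ (Fin m))
  have hκ' : 0 < (κ : ℝ) := NNReal.coe_pos.2 (pos_iff_ne_zero.2 hκ0)
  have hκe : (κ : ENNReal) = ENNReal.ofReal κ := by simp
  refine ⟨(κ * Real.exp (-|τ|))⁻¹, κ * Real.exp |τ|, by positivity, by positivity,
    fun A hA hA1 => ?_⟩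
  have hx : ∀ x ∈ A, |x.2 * τ| ≤ |τ| := fun x hx => by
    have := hA1 x hx
    rw [abs_mul, abs_of_nonneg this.1]
    exact mul_le_of_le_one_left (abs_nonneg _) this.2
  rw [hκ, Measure.smul_apply, withDensity_apply _ hA, smul_eq_mul]
  constructor
  · have h1 : ENNReal.ofReal (Real.exp (-|τ|)) * volume A ≤
        ∫⁻ x in A, ENNReal.ofReal (Real.exp (-(x.2 * τ))) := by
      rw [← setLIntegral_const]
      refine setLIntegral_mono' hA fun x hxA => ENNReal.ofReal_le_ofReal (Real.exp_le_exp.2 ?_)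
      linarith [hx x hxA, le_abs_self (x.2 * τ)]
    calc volume A = ENNReal.ofReal ((κ * Real.exp (-|τ|))⁻¹) *
          (κ * (ENNReal.ofReal (Real.exp (-|τ|)) * volume A)) := by
          rw [hκe, ← mul_assoc, ← mul_assoc, ← ENNReal.ofReal_mul (by positivity),
            ← ENNReal.ofReal_mul (by positivity), mul_assoc, inv_mul_cancel₀ (by positivity)]
          simp
      _ ≤ _ := by gcongr
  · have h1 : ∫⁻ x in A, ENNReal.ofReal (Real.exp (-(x.2 * τ))) ≤
        ENNReal.ofReal (Real.exp |τ|) * volume A := by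
      rw [← setLIntegral_const]
      refine setLIntegral_mono' hA fun x hxA => ENNReal.ofReal_le_ofReal (Real.exp_le_exp.2 ?_)
      linarith [hx x hxA, neg_abs_le (x.2 * τ)]
    rw [ENNReal.ofReal_mul hκ'.le, ← hκe, mul_assoc]
    gcongr

/-- A bound for the pairing of an `L^p` form with a function supported in a cylinder. -/
theorem exists_abs_integral_le (hp : 1 < p) (w : Fin k → EuclideanSpace ℝ (Fin m) × ℝ) :
    ∃ C : ℝ, 0 ≤ C ∧ ∀ (ψ : EuclideanSpace ℝ (Fin m) × ℝ → ℝ) (z : EuclideanSpace ℝ (Fin m))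
      (R M : ℝ), 0 ≤ R → (∀ x, |ψ x| ≤ M) →
      (∀ x ∉ Metric.closedBall z R ×ˢ Set.Icc (0 : ℝ) 1, ψ x = 0) →
      ∀ β ∈ lpForms (leftFrame α b) (frameVolume b (leftFrame α b)) p k,
        |∫ x, ψ x * β x w| ≤ C * M * (R ^ m) ^ (1 - p⁻¹) *
          (eLpNorm (coeff (leftFrame α b) β) (ENNReal.ofReal p)
            (frameVolume b (leftFrame α b))).toReal := by
  obtain ⟨C₁, hC₁, h1⟩ := exists_abs_apply_le α b w
  obtain ⟨c, C, hc, hC, h2⟩ := exists_measure_bounds α b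
  set μ := frameVolume b (leftFrame α b)
  let V : ℝ := (volume (Metric.closedBall (0 : EuclideanSpace ℝ (Fin m)) 1)).toReal
  have hV : ENNReal.ofReal V = volume (Metric.closedBall (0 : EuclideanSpace ℝ (Fin m)) 1) :=
    ENNReal.ofReal_toReal measure_closedBall_lt_top.ne
  have hV0 : 0 ≤ V := ENNReal.toReal_nonneg
  have hp' : 0 ≤ 1 - p⁻¹ := by rw [sub_nonneg]; exact inv_le_one_of_one_le₀ hp.le
  refine ⟨C₁ * c * (C * V) ^ (1 - p⁻¹), by positivity, fun ψ z R M hR hM hsupp β hβ => ?_⟩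
  have hM0 : 0 ≤ M := (abs_nonneg _).trans (hM 0)
  set K := Metric.closedBall z R ×ˢ Set.Icc (0 : ℝ) 1 with hK
  have hKm : MeasurableSet K := measurableSet_closedBall.prod measurableSet_Icc
  have hβm : MemLp (coeff (leftFrame α b) β) (ENNReal.ofReal p) μ := hβ
  have hle : volume.restrict K ≤ ENNReal.ofReal c • μ.restrict K := by
    refine Measure.le_iff.2 fun A hA => ?_
    rw [Measure.smul_apply, Measure.restrict_apply hA, Measure.restrict_apply hA, smul_eq_mul]
    exact (h2 _ (hA.inter hKm) fun x hx => hx.2.2).1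
  have hμK : μ K ≤ ENNReal.ofReal (C * (R ^ m * V)) := by
    refine (h2 K hKm fun x hx => hx.2).2.trans (le_of_eq ?_)
    rw [hK, volume_cylinder z hR, ← hV, sub_zero, ENNReal.ofReal_one, mul_one,
      ← ENNReal.ofReal_mul (by positivity), ← ENNReal.ofReal_mul hC]
  -- Hölder's inequality on the cylinder; its volume, of order R^m, enters with the exponent 1 -
  -- 1/p.
  have h3 : ∫⁻ x in K, ‖coeff (leftFrame α b) β x‖ₑ ∂μ ≤
      eLpNorm (coeff (leftFrame α b) β) (ENNReal.ofReal p) μ *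
        ENNReal.ofReal (C * (R ^ m * V)) ^ (1 - p⁻¹) := by
    rw [← eLpNorm_one_eq_lintegral_enorm]
    refine (eLpNorm_le_eLpNorm_mul_rpow_measure_univ (q := ENNReal.ofReal p) ?_
      hβm.1.restrict).trans ?_
    · rw [← ENNReal.ofReal_one]; exact ENNReal.ofReal_le_ofReal hp.le
    · rw [ENNReal.toReal_ofReal (by linarith), ENNReal.toReal_one, Measure.restrict_apply_univ,
        div_one, one_div]
      exact mul_le_mul' (eLpNorm_restrict_le _ _ _ _) (ENNReal.rpow_le_rpow hμK hp')
  have h4 : ‖∫ x, ψ x * β x w‖ₑ ≤ ENNReal.ofReal (M * C₁) * (ENNReal.ofReal c *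
      ∫⁻ x in K, ‖coeff (leftFrame α b) β x‖ₑ ∂μ) := by
    calc ‖∫ x, ψ x * β x w‖ₑ ≤ ∫⁻ x, ‖ψ x * β x w‖ₑ := enorm_integral_le_lintegral_enorm _
      _ ≤ ∫⁻ x in K, ENNReal.ofReal (M * C₁) * ‖coeff (leftFrame α b) β x‖ₑ := by
        rw [← lintegral_indicator hKm]
        refine lintegral_mono fun x => ?_
        by_cases hx : x ∈ K
        · rw [Set.indicator_of_mem hx, ← ofReal_norm, ← ofReal_norm,
            ← ENNReal.ofReal_mul (by positivity)]
          refine ENNReal.ofReal_le_ofReal ?_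
          rw [norm_mul, Real.norm_eq_abs, Real.norm_eq_abs, mul_assoc]
          exact mul_le_mul (hM x) (h1 β x hx.2) (abs_nonneg _) hM0
        · simp [hsupp x hx]
      _ = ENNReal.ofReal (M * C₁) * ∫⁻ x in K, ‖coeff (leftFrame α b) β x‖ₑ :=
        lintegral_const_mul' _ _ ENNReal.ofReal_ne_top
      _ ≤ _ := by
        gcongr
        rw [← smul_eq_mul, ← lintegral_smul_measure]
        exact lintegral_mono' hle le_rfl
  have h5 := h4.trans (mul_le_mul_right (mul_le_mul_right h3 _) _)
  rw [← ENNReal.ofReal_toReal hβm.eLpNorm_ne_top, ENNReal.ofReal_rpow_of_nonneg (by positivity) hp',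
    ← ENNReal.ofReal_mul ENNReal.toReal_nonneg, ← ENNReal.ofReal_mul hc.le,
    ← ENNReal.ofReal_mul (by positivity), ← ofReal_norm,
    ENNReal.ofReal_le_ofReal_iff (by positivity), Real.norm_eq_abs] at h5
  refine h5.trans (le_of_eq ?_)
  have h6 : C * (R ^ m * V) = C * V * R ^ m := by ring
  rw [h6, Real.mul_rpow (by positivity) (by positivity)]
  ring

end Norms

end Semidirect

/-! ### Exact forms built from a function on `H` and cut-off functions of the time -/

namespace Semidirect

open LpCoh

variable {H : Type*} [NormedAddCommGroup H] [NormedSpace ℝ H] {l j : ℕ}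

/-- The pull-back of alternating forms by the projection `H × ℝ → H`. -/
def pullFst : (H [⋀^Fin j]→L[ℝ] ℝ) →L[ℝ] ((H × ℝ) [⋀^Fin j]→L[ℝ] ℝ) :=
  ContinuousAlternatingMap.compContinuousLinearMapCLM (ContinuousLinearMap.fst ℝ H ℝ)

theorem pullFst_apply (ω : H [⋀^Fin j]→L[ℝ] ℝ) (v : Fin j → H × ℝ) :
    pullFst ω v = ω fun i => (v i).1 := rfl

theorem covectorWedge_comp_fst (ξ : H →L[ℝ] ℝ) (c : H [⋀^Fin l]→L[ℝ] ℝ) :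
    covectorWedge (ξ.comp (ContinuousLinearMap.fst ℝ H ℝ)) (pullFst c) =
      pullFst (covectorWedge ξ c) := by
  ext v
  rw [pullFst_apply, covectorWedge_apply, covectorWedge_apply]
  rfl

/-- The exterior derivative of the form `x ↦ A (dρ x)`. -/
def hessForm (A : (H →L[ℝ] ℝ) →L[ℝ] H [⋀^Fin j]→L[ℝ] ℝ) (ρ : H → ℝ) (x : H) :
    H [⋀^Fin (j + 1)]→L[ℝ] ℝ :=
  ContinuousAlternatingMap.alternatizeUncurryFin (A.comp (fderiv ℝ (fderiv ℝ ρ) x))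

theorem hessForm_apply (A : (H →L[ℝ] ℝ) →L[ℝ] H [⋀^Fin j]→L[ℝ] ℝ) (ρ : H → ℝ) (x : H)
    (v : Fin (j + 1) → H) : hessForm A ρ x v =
      ∑ i : Fin (j + 1), (-1 : ℝ) ^ (i : ℕ) * A (fderiv ℝ (fderiv ℝ ρ) x (v i)) (i.removeNth v) := by
  simp [hessForm, ContinuousAlternatingMap.alternatizeUncurryFin_apply]

theorem contDiff_fderiv_of_smooth {F : Type*} [NormedAddCommGroup F] [NormedSpace ℝ F] {ρ : H → F}
    (hρ : ContDiff ℝ (⊤ : ℕ∞) ρ) : ContDiff ℝ (⊤ : ℕ∞) (fderiv ℝ ρ) :=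
  hρ.fderiv_right (by simp)

theorem contDiff_hessForm (A : (H →L[ℝ] ℝ) →L[ℝ] H [⋀^Fin j]→L[ℝ] ℝ) {ρ : H → ℝ}
    (hρ : ContDiff ℝ (⊤ : ℕ∞) ρ) : ContDiff ℝ (⊤ : ℕ∞) (hessForm A ρ) :=
  (ContinuousAlternatingMap.alternatizeUncurryFinCLM ℝ H ℝ).contDiff.comp
    (contDiff_const.clm_comp (contDiff_fderiv_of_smooth (contDiff_fderiv_of_smooth hρ)))

/-- This is d(d(ρc)) = 0, since A(dρ) + B(dρ) = d(ρc). -/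
theorem hessForm_add_hessForm {A B : (H →L[ℝ] ℝ) →L[ℝ] H [⋀^Fin (l + 1)]→L[ℝ] ℝ}
    {c : H [⋀^Fin l]→L[ℝ] ℝ} (hAB : ∀ ξ, A ξ + B ξ = covectorWedge ξ c) {ρ : H → ℝ}
    (hρ : ContDiff ℝ (⊤ : ℕ∞) ρ) (x : H) : hessForm A ρ x + hessForm B ρ x = 0 := by
  have h1 : extDeriv (fun y => ρ y • c) = fun y => (A + B) (fderiv ℝ ρ y) := by
    funext y
    rw [extDeriv_const_smul_form _ _ (hρ.differentiable (by simp) y), ← hAB]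
    rfl
  have h2 := extDeriv_extDeriv_apply (x := x) (r := (2 : ℕ∞)) (ω := fun y => ρ y • c)
    ((hρ.smul contDiff_const).of_le (by exact_mod_cast le_top)).contDiffAt
    (by simp [minSmoothness_of_isRCLikeNormedField])
  rw [h1, extDeriv] at h2
  have h3 : fderiv ℝ (fun y => (A + B) (fderiv ℝ ρ y)) x =
      (A + B).comp (fderiv ℝ (fderiv ℝ ρ) x) :=
    ((A + B).hasFDerivAt.comp x
      ((contDiff_fderiv_of_smooth hρ).differentiable (by simp) x).hasFDerivAt).fderiv
  rw [h3, ContinuousLinearMap.add_comp, ContinuousAlternatingMap.alternatizeUncurryFin_add] at h2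
  exact h2

section Block

variable (A B : (H →L[ℝ] ℝ) →L[ℝ] H [⋀^Fin (l + 1)]→L[ℝ] ℝ) (c : H [⋀^Fin l]→L[ℝ] ℝ) (ρ : H → ℝ)
  (f g : ℝ → ℝ)

/-- The form `f(t) A (dρ) + g(t) B (dρ)` on `H × ℝ`. -/
def blockPrimitive : Form (H × ℝ) (l + 1) := fun x =>
  f x.2 • pullFst (A (fderiv ℝ ρ x.1)) + g x.2 • pullFst (B (fderiv ℝ ρ x.1))

/-- The form `(f - g)(t) A (dρ) - g'(t) ρ dt ∧ c` on `H × ℝ`, which differs from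
`f(t) A (dρ) + g(t) B (dρ)` by an exact form if `A ξ + B ξ = ξ ∧ c`. -/
def blockForm : Form (H × ℝ) (l + 1) := fun x =>
  (f x.2 - g x.2) • pullFst (A (fderiv ℝ ρ x.1)) -
    (deriv g x.2 * ρ x.1) • covectorWedge (ContinuousLinearMap.snd ℝ H ℝ) (pullFst c)

variable {A B c ρ f g}

theorem contDiff_pullFst_fderiv (C : (H →L[ℝ] ℝ) →L[ℝ] H [⋀^Fin j]→L[ℝ] ℝ)
    (hρ : ContDiff ℝ (⊤ : ℕ∞) ρ) :
    ContDiff ℝ (⊤ : ℕ∞) fun x : H × ℝ => pullFst (C (fderiv ℝ ρ x.1)) := by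
  have h1 : ContDiff ℝ (⊤ : ℕ∞) fun x : H × ℝ => fderiv ℝ ρ x.1 :=
    (contDiff_fderiv_of_smooth hρ).comp contDiff_fst
  exact (pullFst.comp C).contDiff.comp h1

theorem contDiff_comp_snd (hf : ContDiff ℝ (⊤ : ℕ∞) f) :
    ContDiff ℝ (⊤ : ℕ∞) fun x : H × ℝ => f x.2 :=
  hf.comp contDiff_snd

theorem contDiff_blockForm (hρ : ContDiff ℝ (⊤ : ℕ∞) ρ) (hf : ContDiff ℝ (⊤ : ℕ∞) f)
    (hg : ContDiff ℝ (⊤ : ℕ∞) g) : ContDiff ℝ (⊤ : ℕ∞) (blockForm A c ρ f g) := by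
  have hg' : ContDiff ℝ (⊤ : ℕ∞) (deriv g) := (contDiff_infty_iff_deriv.1 hg).2
  have h1 : ContDiff ℝ (⊤ : ℕ∞) fun x : H × ℝ => deriv g x.2 * ρ x.1 :=
    (contDiff_comp_snd hg').mul (hρ.comp contDiff_fst)
  unfold blockForm
  exact (((contDiff_comp_snd hf).sub (contDiff_comp_snd hg)).smul
    (contDiff_pullFst_fderiv A hρ)).sub (h1.smul contDiff_const)

/-- The two forms differ by d(gρc). The primitive `blockPrimitive` equals dρ ∧ c wherever f = g = 1
and so need not have compact support. `blockForm` vanishes where f = g and g' = 0, which makes it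
the L^p primitive to be used. -/
theorem extDeriv_blockForm (hAB : ∀ ξ, A ξ + B ξ = covectorWedge ξ c)
    (hρ : ContDiff ℝ (⊤ : ℕ∞) ρ) (hf : ContDiff ℝ (⊤ : ℕ∞) f) (hg : ContDiff ℝ (⊤ : ℕ∞) g) :
    extDeriv (blockForm A c ρ f g) = extDeriv (blockPrimitive A B ρ f g) := by
  let σ : Form (H × ℝ) l := fun x => (g x.2 * ρ x.1) • pullFst c
  have hF : ContDiff ℝ (⊤ : ℕ∞) fun x : H × ℝ => g x.2 * ρ x.1 :=
    (hg.comp contDiff_snd).mul (hρ.comp contDiff_fst)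
  have hσ : ContDiff ℝ (⊤ : ℕ∞) σ := hF.smul contDiff_const
  have hdσ : ∀ x, extDeriv σ x = g x.2 • pullFst (covectorWedge (fderiv ℝ ρ x.1) c) +
      (deriv g x.2 * ρ x.1) • covectorWedge (ContinuousLinearMap.snd ℝ H ℝ) (pullFst c) := by
    intro x
    have h1 : HasFDerivAt (fun x : H × ℝ => g x.2)
        (deriv g x.2 • ContinuousLinearMap.snd ℝ H ℝ) x :=
      ((hg.differentiable (by simp) x.2).hasDerivAt).comp_hasFDerivAt x hasFDerivAt_snd
    have h2 : HasFDerivAt (fun x : H × ℝ => ρ x.1)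
        ((fderiv ℝ ρ x.1).comp (ContinuousLinearMap.fst ℝ H ℝ)) x :=
      (hρ.differentiable (by simp) x.1).hasFDerivAt.comp x hasFDerivAt_fst
    have h3 : fderiv ℝ (fun x : H × ℝ => g x.2 * ρ x.1) x = _ := (h1.mul h2).fderiv
    rw [extDeriv_const_smul_form _ _ (hF.differentiable (by simp) x), h3,
      covectorWedge_add, covectorWedge_smul, covectorWedge_smul, covectorWedge_smul,
      covectorWedge_comp_fst, smul_smul, mul_comm (ρ x.1)]
  have hsum : blockPrimitive A B ρ f g = blockForm A c ρ f g + extDeriv σ := by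
    funext x
    rw [Pi.add_apply, hdσ, ← hAB, map_add]
    simp only [blockPrimitive, blockForm, sub_smul, smul_add]
    abel
  have hdσ' : Differentiable ℝ (extDeriv σ) := by
    refine ((ContinuousAlternatingMap.alternatizeUncurryFinCLM ℝ (H × ℝ) ℝ).contDiff.comp
      (contDiff_fderiv_of_smooth hσ)).differentiable (n := (⊤ : ℕ∞)) (by simp)
  funext x
  rw [hsum, extDeriv_add ((contDiff_blockForm hρ hf hg).differentiable (by simp) x) (hdσ' x),
    extDeriv_extDeriv (r := (2 : ℕ∞)) (hσ.of_le (by exact_mod_cast le_top))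
      (by simp [minSmoothness_of_isRCLikeNormedField])]
  simp

/-- The terms with dt carry f' and g'. The remaining ones combine to (f - g) dA(dρ), because dB(dρ)
= -dA(dρ). -/
theorem extDeriv_blockPrimitive_apply (hAB : ∀ ξ, A ξ + B ξ = covectorWedge ξ c)
    (hρ : ContDiff ℝ (⊤ : ℕ∞) ρ) (hf : ContDiff ℝ (⊤ : ℕ∞) f) (hg : ContDiff ℝ (⊤ : ℕ∞) g)
    (x : H × ℝ) (v : Fin (l + 2) → H × ℝ) :
    extDeriv (blockPrimitive A B ρ f g) x v =
      ∑ i : Fin (l + 2), (-1 : ℝ) ^ (i : ℕ) * ((v i).2 *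
        (deriv f x.2 * A (fderiv ℝ ρ x.1) (i.removeNth fun r => (v r).1) +
          deriv g x.2 * B (fderiv ℝ ρ x.1) (i.removeNth fun r => (v r).1))) +
      (f x.2 - g x.2) * hessForm A ρ x.1 fun r => (v r).1 := by
  have key : ∀ (C : (H →L[ℝ] ℝ) →L[ℝ] H [⋀^Fin (l + 1)]→L[ℝ] ℝ) (f : ℝ → ℝ),
      ContDiff ℝ (⊤ : ℕ∞) f → HasFDerivAt (fun x : H × ℝ => f x.2 • pullFst (C (fderiv ℝ ρ x.1)))
        (f x.2 • (pullFst.comp (C.comp ((fderiv ℝ (fderiv ℝ ρ) x.1).comp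
          (ContinuousLinearMap.fst ℝ H ℝ)))) +
          (deriv f x.2 • ContinuousLinearMap.snd ℝ H ℝ).smulRight
            (pullFst (C (fderiv ℝ ρ x.1)))) x := by
    intro C f hf
    have h1 : HasFDerivAt (fun x : H × ℝ => f x.2)
        (deriv f x.2 • ContinuousLinearMap.snd ℝ H ℝ) x :=
      ((hf.differentiable (by simp) x.2).hasDerivAt).comp_hasFDerivAt x hasFDerivAt_snd
    have h2 : HasFDerivAt (fun x : H × ℝ => fderiv ℝ ρ x.1)
        ((fderiv ℝ (fderiv ℝ ρ) x.1).comp (ContinuousLinearMap.fst ℝ H ℝ)) x :=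
      ((contDiff_fderiv_of_smooth hρ).differentiable (by simp) x.1).hasFDerivAt.comp x
        hasFDerivAt_fst
    exact h1.smul ((pullFst.comp C).hasFDerivAt.comp x h2)
  have hd : fderiv ℝ (blockPrimitive A B ρ f g) x = _ := ((key A f hf).add (key B g hg)).fderiv
  have hneg : hessForm B ρ x.1 = -hessForm A ρ x.1 :=
    eq_neg_of_add_eq_zero_right (hessForm_add_hessForm hAB hρ x.1)
  have h3 : (f x.2 - g x.2) * hessForm A ρ x.1 (fun r => (v r).1) =
      f x.2 * hessForm A ρ x.1 (fun r => (v r).1) + g x.2 * hessForm B ρ x.1 fun r => (v r).1 := by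
    rw [hneg, ContinuousAlternatingMap.neg_apply]; ring
  rw [h3, hessForm_apply, hessForm_apply, extDeriv, hd,
    ContinuousAlternatingMap.alternatizeUncurryFin_apply, Finset.mul_sum, Finset.mul_sum,
    ← Finset.sum_add_distrib, ← Finset.sum_add_distrib]
  refine Finset.sum_congr rfl fun i _ => ?_
  have hr : (fun r => (i.removeNth v r).1) = i.removeNth fun r => (v r).1 := rfl
  simp only [add_apply, smul_apply,
    ContinuousLinearMap.smulRight_apply, ContinuousLinearMap.comp_apply,
    ContinuousLinearMap.coe_fst', ContinuousLinearMap.coe_snd', ContinuousAlternatingMap.add_apply,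
    ContinuousAlternatingMap.smul_apply, pullFst_apply, hr, smul_eq_mul, zsmul_eq_mul,
    Int.reduceNeg, Int.cast_pow, Int.cast_neg, Int.cast_one]
  ring

end Block

end Semidirect

/-! ### Rescaled profiles and cut-off functions -/

theorem fderiv_eq_zero_of_eq_zero_off {E F : Type*} [NormedAddCommGroup E] [NormedSpace ℝ E]
    [NormedAddCommGroup F] [NormedSpace ℝ F] {f : E → F} {K : Set E} (hK : IsClosed K)
    (h : ∀ x ∉ K, f x = 0) {x : E} (hx : x ∉ K) : fderiv ℝ f x = 0 := by
  have h1 : tsupport f ⊆ K := closure_minimal (fun y hy => by_contra fun hyK => hy (h y hyK)) hK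
  exact fderiv_of_notMem_tsupport (𝕜 := ℝ) fun hx' => hx (h1 hx')

theorem fderiv_rescale {E F : Type*} [NormedAddCommGroup E] [NormedSpace ℝ E]
    [NormedAddCommGroup F] [NormedSpace ℝ F] (g : E → F) (r : ℝ) (z x : E) :
    fderiv ℝ (fun y => g (r • (y - z))) x = r • fderiv ℝ g (r • (x - z)) := by
  have h1 := fderiv_comp_sub (𝕜 := ℝ) (f := fun y => g (r • y)) (x := x) z
  rw [h1, fderiv_comp_smul]

theorem smul_sub_mem_closedBall_iff {E : Type*} [NormedAddCommGroup E] [NormedSpace ℝ E] {R : ℝ}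
    (hR : 0 < R) {x z : E} :
    R⁻¹ • (x - z) ∈ Metric.closedBall (0 : E) 1 ↔ x ∈ Metric.closedBall z R := by
  rw [mem_closedBall_zero_iff, norm_smul, norm_inv, Real.norm_of_nonneg hR.le,
    inv_mul_le_iff₀ hR, mul_one, mem_closedBall_iff_norm]

theorem contDiff_rescale {E F : Type*} [NormedAddCommGroup E] [NormedSpace ℝ E]
    [NormedAddCommGroup F] [NormedSpace ℝ F] {g : E → F} (hg : ContDiff ℝ (⊤ : ℕ∞) g) (r : ℝ)
    (z : E) : ContDiff ℝ (⊤ : ℕ∞) fun y => g (r • (y - z)) :=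
  hg.comp (contDiff_const.smul (contDiff_id.sub contDiff_const))

theorem exists_bound_of_eq_zero_off {E F : Type*} [TopologicalSpace E]
    [NormedAddCommGroup F] {f : E → F} {K : Set E} (hK : IsCompact K) (hf : Continuous f)
    (h : ∀ x ∉ K, f x = 0) : ∃ M : ℝ, 0 ≤ M ∧ ∀ x, ‖f x‖ ≤ M := by
  obtain ⟨M, hM⟩ := hK.exists_bound_of_continuousOn hf.continuousOn
  refine ⟨max M 0, le_max_right _ _, fun x => ?_⟩
  by_cases hx : x ∈ K
  · exact (hM x hx).trans (le_max_left _ _)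
  · simp [h x hx]

/-- A smooth function that is `1` for `t ≤ 0` and `0` for `t ≥ 1`. -/
theorem exists_smooth_cutoff : ∃ θ : ℝ → ℝ, ContDiff ℝ (⊤ : ℕ∞) θ ∧ (∀ t ≤ 0, θ t = 1) ∧
    (∀ t, 1 ≤ t → θ t = 0) ∧ (∀ t, 0 ≤ θ t) ∧ (∀ t, θ t ≤ 1) ∧
    (∀ t ∉ Set.Icc (0 : ℝ) 1, deriv θ t = 0) ∧ ∃ M : ℝ, 0 ≤ M ∧ ∀ t, |deriv θ t| ≤ M := by
  have h0 : ContDiff ℝ (⊤ : ℕ∞) fun t : ℝ => Real.smoothTransition (1 - t) :=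
    Real.smoothTransition.contDiff.comp (contDiff_const.sub contDiff_id)
  have h1 : ∀ t ≤ (0 : ℝ), Real.smoothTransition (1 - t) = 1 := fun t ht =>
    Real.smoothTransition.one_of_one_le (by linarith)
  have h2 : ∀ t, (1 : ℝ) ≤ t → Real.smoothTransition (1 - t) = 0 := fun t ht =>
    Real.smoothTransition.zero_of_nonpos (by linarith)
  have h3 : ∀ t ∉ Set.Icc (0 : ℝ) 1, deriv (fun t : ℝ => Real.smoothTransition (1 - t)) t = 0 := by
    intro t ht
    rw [Set.mem_Icc, not_and_or, not_le, not_le] at ht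
    rcases ht with ht | ht
    · have : (fun t : ℝ => Real.smoothTransition (1 - t)) =ᶠ[𝓝 t] fun _ => 1 := by
        filter_upwards [eventually_lt_nhds ht] with s hs using h1 s hs.le
      rw [this.deriv_eq, deriv_const]
    · have : (fun t : ℝ => Real.smoothTransition (1 - t)) =ᶠ[𝓝 t] fun _ => 0 := by
        filter_upwards [eventually_gt_nhds ht] with s hs using h2 s hs.le
      rw [this.deriv_eq, deriv_const]
  exact ⟨_, h0, h1, h2, fun t => Real.smoothTransition.nonneg _,
    fun t => Real.smoothTransition.le_one _, h3,
    exists_bound_of_eq_zero_off isCompact_Icc (h0.continuous_deriv (by simp)) h3⟩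

namespace Semidirect

open LpCoh

/-! ### Functions on `H` with a prescribed second derivative at the origin -/

section Profile

variable {H : Type*} [NormedAddCommGroup H] [NormedSpace ℝ H] {j l : ℕ}

theorem hessForm_rescale (A : (H →L[ℝ] ℝ) →L[ℝ] H [⋀^Fin j]→L[ℝ] ℝ) (ρ : H → ℝ) (r : ℝ) (z x : H) :
    hessForm A (fun y => ρ (r • (y - z))) x = (r ^ 2) • hessForm A ρ (r • (x - z)) := by
  have h1 : fderiv ℝ (fun y => ρ (r • (y - z))) = r • fun y => fderiv ℝ ρ (r • (y - z)) :=
    funext fun y => fderiv_rescale ρ r z y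
  have h2 : fderiv ℝ (fderiv ℝ fun y => ρ (r • (y - z))) x =
      (r ^ 2) • fderiv ℝ (fderiv ℝ ρ) (r • (x - z)) := by
    rw [h1, fderiv_const_smul_field, Pi.smul_apply, fderiv_rescale, smul_smul, sq]
  rw [hessForm, h2, hessForm, ContinuousLinearMap.comp_smul,
    ContinuousAlternatingMap.alternatizeUncurryFin_smul]

theorem hessForm_eq_zero_off (A : (H →L[ℝ] ℝ) →L[ℝ] H [⋀^Fin j]→L[ℝ] ℝ) {ρ : H → ℝ} {K : Set H}
    (hK : IsClosed K) (h : ∀ x ∉ K, ρ x = 0) {x : H} (hx : x ∉ K) : hessForm A ρ x = 0 := by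
  have h1 := fderiv_eq_zero_of_eq_zero_off hK
    (fun y hy => fderiv_eq_zero_of_eq_zero_off hK h hy) hx
  ext v
  simp [hessForm_apply, h1]

/-- Near the origin take ρ = ξ²/2, whose second derivative is ξ ⊗ ξ, and cut it off. -/
theorem exists_profile [FiniteDimensional ℝ H] (A : (H →L[ℝ] ℝ) →L[ℝ] H [⋀^Fin j]→L[ℝ] ℝ)
    (ξ : H →L[ℝ] ℝ) : ∃ ρ : H → ℝ, ContDiff ℝ (⊤ : ℕ∞) ρ ∧
      (∀ x ∉ Metric.closedBall (0 : H) 1, ρ x = 0) ∧ hessForm A ρ 0 = covectorWedge ξ (A ξ) := by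
  let χ : ContDiffBump (0 : H) := ⟨1 / 2, 1, by norm_num, by norm_num⟩
  let q : H → ℝ := fun x => 2⁻¹ * ξ x ^ 2
  refine ⟨fun x => χ x * q x, χ.contDiff.mul (contDiff_const.mul (ξ.contDiff.pow 2)), fun x hx => ?_, ?_⟩
  · beta_reduce
    rw [χ.zero_of_le_dist, zero_mul]
    rw [Metric.mem_closedBall, not_le] at hx
    exact hx.le
  · have h1 : (fun x => χ x * q x) =ᶠ[𝓝 0] q := by
      filter_upwards [χ.eventuallyEq_one] with x hx
      rw [hx, Pi.one_apply, one_mul]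
    have h2 : fderiv ℝ q = fun x => (ξ.smulRight ξ) x := by
      funext x
      have h3 : HasFDerivAt q ((ξ.smulRight ξ) x) x := by
        have := ((ξ.hasFDerivAt (x := x)).pow 2).const_mul (2 : ℝ)⁻¹
        refine this.congr_fderiv ?_
        ext v
        simp
        ring
      exact h3.fderiv
    rw [hessForm, (h1.fderiv (𝕜 := ℝ)).fderiv_eq, h2, (ξ.smulRight ξ).fderiv, covectorWedge]
    congr 1
    ext v : 1
    simp

end Profile

end Semidirect

namespace Semidirect

open LpCoh

/-! ### Exact forms with small norm -/

section ExactBlock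

variable {m l : ℕ} {ι : Type*} [Fintype ι]

theorem continuousLinearMap_eq_sum_proj (ζ : EuclideanSpace ℝ (Fin m) →L[ℝ] ℝ) :
    ζ = ∑ a, ζ (EuclideanSpace.single a 1) • (EuclideanSpace.proj a) := by
  ext x
  conv_lhs => rw [← (EuclideanSpace.basisFun (Fin m) ℝ).sum_repr x]
  simp [mul_comm]

/-- Decay is known for each covector and each tuple separately. By linearity in `ζ` only finitely
many coordinate covectors and frame tuples matter, so one threshold `T₀` serves all `ζ`. -/
theorem exists_decaying_bound {α : EuclideanSpace ℝ (Fin m) →L[ℝ] EuclideanSpace ℝ (Fin m)} {c : ℝ}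
    {j : ℕ} {A : (EuclideanSpace ℝ (Fin m) →L[ℝ] ℝ) →L[ℝ] EuclideanSpace ℝ (Fin m) [⋀^Fin j]→L[ℝ] ℝ}
    (hA : ∀ ζ, A ζ ∈ decaying α c ℝ j) (b : ι → EuclideanSpace ℝ (Fin m)) {ε : ℝ} (hε : 0 < ε) :
    ∃ T₀ : ℝ, ∀ t ≥ T₀, ∀ ζ, ∀ r : Fin j → ι,
      |(1 + t) * Real.exp (-(c * t)) * A ζ fun i => NormedSpace.exp (t • α) (b (r i))| ≤
        ε * ‖ζ‖ := by
  let G : (EuclideanSpace ℝ (Fin m) →L[ℝ] ℝ) → (Fin j → ι) → ℝ → ℝ := fun ζ r t =>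
    (1 + t) * Real.exp (-(c * t)) * A ζ fun i => NormedSpace.exp (t • α) (b (r i))
  have hG : ∀ ζ r, Tendsto (fun t => |G ζ r t|) atTop (𝓝 0) := fun ζ r => by
    have := (mem_decaying.1 (hA ζ) fun i => b (r i)).norm
    rw [norm_zero] at this
    exact this
  have hsum : Tendsto (fun t => ∑ r, ∑ a, |G (EuclideanSpace.proj a) r t|) atTop (𝓝 0) := by
    have := tendsto_finsetSum Finset.univ fun r _ => tendsto_finsetSum Finset.univ fun a _ =>
      hG (EuclideanSpace.proj a) r
    simpa using this
  obtain ⟨T₀, hT₀⟩ := eventually_atTop.1 (hsum.eventually (eventually_le_nhds hε))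
  refine ⟨T₀, fun t ht ζ r => ?_⟩
  have h1 : G ζ r t = ∑ a, ζ (EuclideanSpace.single a 1) * G (EuclideanSpace.proj a) r t := by
    simp only [G]
    conv_lhs => rw [continuousLinearMap_eq_sum_proj ζ]
    simp only [map_sum, map_smul, ContinuousAlternatingMap.sum_apply,
      ContinuousAlternatingMap.smul_apply, smul_eq_mul, Finset.mul_sum]
    exact Finset.sum_congr rfl fun a _ => by ring
  calc |G ζ r t| ≤ ∑ a, ‖ζ‖ * |G (EuclideanSpace.proj a) r t| := by
        rw [h1]
        refine (Finset.abs_sum_le_sum_abs _ _).trans (Finset.sum_le_sum fun a _ => ?_)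
        rw [abs_mul]
        refine mul_le_mul_of_nonneg_right ?_ (abs_nonneg _)
        simpa using ζ.le_opNorm (EuclideanSpace.single a 1)
    _ = ‖ζ‖ * ∑ a, |G (EuclideanSpace.proj a) r t| := (Finset.mul_sum _ _ _).symm
    _ ≤ ‖ζ‖ * ε := mul_le_mul_of_nonneg_left ((Finset.single_le_sum
        (f := fun r => ∑ a, |G (EuclideanSpace.proj a) r t|)
        (fun r _ => Finset.sum_nonneg fun a _ => abs_nonneg _) (Finset.mem_univ r)).trans
        (hT₀ t ht)) (norm_nonneg _)
    _ = ε * ‖ζ‖ := mul_comm _ _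

theorem exists_hessForm_bound (α : EuclideanSpace ℝ (Fin m) →L[ℝ] EuclideanSpace ℝ (Fin m)) (c : ℝ)
    {j : ℕ} (A : (EuclideanSpace ℝ (Fin m) →L[ℝ] ℝ) →L[ℝ] EuclideanSpace ℝ (Fin m) [⋀^Fin j]→L[ℝ] ℝ)
    {ρ : EuclideanSpace ℝ (Fin m) → ℝ} (hρ : ContDiff ℝ (⊤ : ℕ∞) ρ)
    (hρ0 : ∀ x ∉ Metric.closedBall 0 1, ρ x = 0) (b : ι → EuclideanSpace ℝ (Fin m)) (S : ℝ) :
    ∃ K : ℝ, 0 ≤ K ∧ ∀ y, ∀ t ∈ Set.Icc (-S) S, ∀ r : Fin (j + 1) → ι,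
      Real.exp (-(c * t)) * |hessForm A ρ y fun i => NormedSpace.exp (t • α) (b (r i))| ≤ K := by
  let G : EuclideanSpace ℝ (Fin m) × ℝ → (Fin (j + 1) → ι) → ℝ := fun x r =>
    Real.exp (-(c * x.2)) * |hessForm A ρ x.1 fun i => NormedSpace.exp (x.2 • α) (b (r i))|
  have hG : Continuous G := by
    refine continuous_pi fun r => Continuous.mul (by fun_prop) (Continuous.abs ?_)
    exact continuous_eval.comp (((contDiff_hessForm A hρ).continuous.comp continuous_fst).prodMk
      (continuous_pi fun i => (continuous_exp_apply α _).comp continuous_snd))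
  obtain ⟨K, hK⟩ := ((isCompact_closedBall (0 : EuclideanSpace ℝ (Fin m)) 1).prod
    (isCompact_Icc (a := -S) (b := S))).exists_bound_of_continuousOn hG.continuousOn
  refine ⟨max K 0, le_max_right _ _, fun y t ht r => ?_⟩
  by_cases hy : y ∈ Metric.closedBall (0 : EuclideanSpace ℝ (Fin m)) 1
  · exact ((le_abs_self _).trans ((norm_le_pi_norm (G (y, t)) r).trans (hK (y, t) ⟨hy, ht⟩))).trans
      (le_max_left _ _)
  · rw [hessForm_eq_zero_off A Metric.isClosed_closedBall hρ0 hy]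
    simp

variable [DecidableEq ι]

/-- The order of choices is essential: `T` depends on `ε` and makes the terms with f' and g' small;
then `R` depends on `T` and makes the middle term small. First derivatives of the rescaled profile
are of order R⁻¹ and second ones of order R⁻², so the middle term gains a factor R⁻¹. The constant
`C` depends on neither `ε` nor `R`. -/
theorem exists_exact_block (α : EuclideanSpace ℝ (Fin m) →L[ℝ] EuclideanSpace ℝ (Fin m))
    (b : Module.Basis ι ℝ (EuclideanSpace ℝ (Fin m) × ℝ)) {p : ℝ} (hp : 1 < p)
    {A B : (EuclideanSpace ℝ (Fin m) →L[ℝ] ℝ) →L[ℝ] EuclideanSpace ℝ (Fin m) [⋀^Fin (l + 1)]→L[ℝ] ℝ}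
    {c : EuclideanSpace ℝ (Fin m) [⋀^Fin l]→L[ℝ] ℝ}
    (hA : ∀ ζ, A ζ ∈ decaying α (LinearMap.trace ℝ _
      (α : EuclideanSpace ℝ (Fin m) →ₗ[ℝ] EuclideanSpace ℝ (Fin m)) / p) ℝ (l + 1))
    (hB : ∀ ζ, B ζ ∈ decaying (-α) (-(LinearMap.trace ℝ _
      (α : EuclideanSpace ℝ (Fin m) →ₗ[ℝ] EuclideanSpace ℝ (Fin m)) / p)) ℝ (l + 1))
    (hAB : ∀ ζ, A ζ + B ζ = covectorWedge ζ c)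
    {ρ : EuclideanSpace ℝ (Fin m) → ℝ} (hρ : ContDiff ℝ (⊤ : ℕ∞) ρ)
    (hρ0 : ∀ x ∉ Metric.closedBall 0 1, ρ x = 0) :
    ∃ C : ℝ, 0 ≤ C ∧ ∀ ε > 0, ∃ R > 0, ∀ z : EuclideanSpace ℝ (Fin m),
      ∃ η ∈ exactForms (leftFrame α b) (frameVolume b (leftFrame α b)) p (l + 2),
        (∀ x ∉ Metric.closedBall z R ×ˢ Set.univ, η x = 0) ∧
        eLpNorm (coeff (leftFrame α b) η) (ENNReal.ofReal p) (frameVolume b (leftFrame α b)) ≤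
          ENNReal.ofReal (C * ε * (R⁻¹ * (R ^ m) ^ p⁻¹)) ∧
        ∀ x, x.2 ∈ Set.Icc (0 : ℝ) 1 → ∀ u : Fin (l + 2) → EuclideanSpace ℝ (Fin m),
          η x (fun i => (u i, 0)) = R⁻¹ ^ 2 * hessForm A ρ (R⁻¹ • (x.1 - z)) u := by
  set c₀ := LinearMap.trace ℝ _
    (α : EuclideanSpace ℝ (Fin m) →ₗ[ℝ] EuclideanSpace ℝ (Fin m)) / p with hc₀
  obtain ⟨θ, hθ, hθ1, hθ0, hθnn, hθle, hθ', Mθ, hMθ0, hMθ⟩ := exists_smooth_cutoff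
  obtain ⟨Mρ, hMρ0, hMρ⟩ := exists_bound_of_eq_zero_off (isCompact_closedBall _ _)
    (contDiff_fderiv_of_smooth hρ).continuous
    fun x hx => fderiv_eq_zero_of_eq_zero_off Metric.isClosed_closedBall hρ0 hx
  obtain ⟨C₀, hC₀, hnorm⟩ := exists_eLpNorm_coeff_le (k := l + 2) α b hp
  let β : ℝ := ∑ i, |(b i).2|
  have hβ0 : 0 ≤ β := Finset.sum_nonneg fun i _ => abs_nonneg _
  have hβ : ∀ i, |(b i).2| ≤ β := fun i =>
    Finset.single_le_sum (f := fun i => |(b i).2|) (fun i _ => abs_nonneg _) (Finset.mem_univ i)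
  -- There are l + 2 summands containing a time component of the basis, each with one term in f' and
  -- one in g'; the final 1 is for the middle term.
  let C₁ : ℝ := (l + 2 : ℕ) * (β * (Mθ * Mρ + Mθ * Mρ)) + 1
  have hC₁ : 0 ≤ C₁ := by positivity
  refine ⟨C₀ * C₁, by positivity, fun ε hε => ?_⟩
  obtain ⟨T₀, hT₀⟩ := exists_decaying_bound hA (fun i => (b i).1) hε
  obtain ⟨T₁, hT₁⟩ := exists_decaying_bound hB (fun i => (b i).1) hε
  obtain ⟨T, hT, hTT₀, hTT₁⟩ : ∃ T : ℝ, 1 ≤ T ∧ T₀ ≤ T ∧ T₁ ≤ T :=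
    ⟨max 1 (max T₀ T₁), le_max_left _ _, (le_max_left _ _).trans (le_max_right _ _),
      (le_max_right _ _).trans (le_max_right _ _)⟩
  obtain ⟨K, hK0, hK⟩ := exists_hessForm_bound α c₀ A hρ hρ0 (fun i => (b i).1) (T + 1)
  -- This size of `R` gives R⁻² K ≤ ε R⁻¹ / (1 + T).
  obtain ⟨R, hR, hRK⟩ : ∃ R : ℝ, 0 < R ∧ K * (1 + T) / ε ≤ R :=
    ⟨max 1 (K * (1 + T) / ε), lt_max_of_lt_left one_pos, le_max_right _ _⟩
  refine ⟨R, hR, fun z => ?_⟩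
  let ρR : EuclideanSpace ℝ (Fin m) → ℝ := fun y => ρ (R⁻¹ • (y - z))
  -- `f` drops from 1 to 0 on [T, T + 1] and `g` on [-(T + 1), -T]. As T ≥ 1, one has f = 1 and g =
  -- 0 on the slab [0, 1] where the test functions live.
  let f : ℝ → ℝ := fun t => θ (t - T)
  let g : ℝ → ℝ := fun t => θ (t + (T + 1))
  have hρR : ContDiff ℝ (⊤ : ℕ∞) ρR := contDiff_rescale hρ _ _
  have hf : ContDiff ℝ (⊤ : ℕ∞) f := hθ.comp (contDiff_id.sub contDiff_const)
  have hg : ContDiff ℝ (⊤ : ℕ∞) g := hθ.comp (contDiff_id.add contDiff_const)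
  have hf' : ∀ t, deriv f t = deriv θ (t - T) := fun t => deriv_comp_sub_const θ T t
  have hg' : ∀ t, deriv g t = deriv θ (t + (T + 1)) := fun t => deriv_comp_add_const θ (T + 1) t
  have hρR0 : ∀ x ∉ Metric.closedBall z R, ρR x = 0 := fun x hx =>
    hρ0 _ fun h => hx ((smul_sub_mem_closedBall_iff hR).1 h)
  have hdρR : ∀ x, ‖fderiv ℝ ρR x‖ ≤ R⁻¹ * Mρ := fun x => by
    have : fderiv ℝ ρR x = R⁻¹ • fderiv ℝ ρ (R⁻¹ • (x - z)) := fderiv_rescale ρ R⁻¹ z x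
    rw [this, norm_smul, norm_inv, Real.norm_of_nonneg hR.le]
    exact mul_le_mul_of_nonneg_left (hMρ _) (by positivity)
  have hfg : ∀ t ∉ Set.Icc (-(T + 1)) (T + 1), f t - g t = 0 ∧ deriv g t = 0 := by
    intro t ht
    constructor
    · rw [Set.mem_Icc, not_and_or, not_le, not_le] at ht
      rcases ht with ht | ht
      · simp only [f, g]
        rw [hθ1 _ (by linarith), hθ1 _ (by linarith), sub_self]
      · simp only [f, g]
        rw [hθ0 _ (by linarith), hθ0 _ (by linarith), sub_self]
    · rw [hg']
      refine hθ' _ fun h => ht ⟨by linarith [h.1], by linarith [h.2]⟩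
  have hfg1 : ∀ t, |f t - g t| ≤ 1 := fun t => by
    rw [abs_le]
    constructor <;> linarith [hθnn (t - T), hθle (t - T), hθnn (t + (T + 1)), hθle (t + (T + 1))]
  let Kset : Set (EuclideanSpace ℝ (Fin m) × ℝ) :=
    Metric.closedBall z R ×ˢ Set.Icc (-(T + 1)) (T + 1)
  have hKc : IsCompact Kset := (isCompact_closedBall z R).prod isCompact_Icc
  let γ : Form (EuclideanSpace ℝ (Fin m) × ℝ) (l + 1) := blockForm A c ρR f g
  have hγ : ContDiff ℝ (⊤ : ℕ∞) γ := contDiff_blockForm hρR hf hg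
  have hγ1 : ContDiff ℝ 1 γ := hγ.of_le (by exact_mod_cast le_top)
  have hγ0 : ∀ x ∉ Kset, γ x = 0 := by
    intro x hx
    rw [Set.mem_prod, not_and_or] at hx
    rcases hx with hx | hx
    · simp only [γ, blockForm, hρR0 _ hx,
        fderiv_eq_zero_of_eq_zero_off Metric.isClosed_closedBall hρR0 hx]
      simp
    · simp only [γ, blockForm, (hfg _ hx).1, (hfg _ hx).2]
      simp
  have hη0 : ∀ x ∉ Kset, extDeriv γ x = 0 := fun x hx => by
    rw [extDeriv, fderiv_eq_zero_of_eq_zero_off hKc.isClosed hγ0 hx]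
    exact map_zero (ContinuousAlternatingMap.alternatizeUncurryFinCLM ℝ _ ℝ)
  have hηf := extDeriv_blockPrimitive_apply hAB hρR hf hg
  rw [← extDeriv_blockForm hAB hρR hf hg] at hηf
  have hX := continuous_leftFrame α b
  refine ⟨extDeriv γ, ⟨mem_lpForms_of_hasCompactSupport hX (continuous_extDeriv hγ1)
    (HasCompactSupport.intro hKc hη0), γ, mem_lpForms_of_hasCompactSupport hX hγ.continuous
    (HasCompactSupport.intro hKc hγ0), isWeakExtDeriv_extDeriv hγ1⟩,
    fun x hx => hη0 x fun h => hx ⟨h.1, trivial⟩, ?_, fun x hx u => ?_⟩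
  -- The factor 1 / (1 + T) comes from the weight 1 + t in `decaying`, and pays for the length of
  -- the time interval in the norm estimate.
  · set Q : ℝ := ε * R⁻¹ / (1 + T) with hQ
    have hQ0 : 0 ≤ Q := by positivity
    have htrans : ∀ {t s a e : ℝ} {ζ : EuclideanSpace ℝ (Fin m) →L[ℝ] ℝ}, T ≤ t → |s| ≤ Mθ →
        ‖ζ‖ ≤ R⁻¹ * Mρ → 0 ≤ e → |(1 + t) * e * a| ≤ ε * ‖ζ‖ → e * |s * a| ≤ Mθ * Mρ * Q := by
      intro t s a e ζ ht hs hζ he h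
      rw [abs_mul, abs_mul, abs_of_nonneg he, abs_of_nonneg (by linarith : (0 : ℝ) ≤ 1 + t)] at h
      have h1 : e * |a| ≤ ε * (R⁻¹ * Mρ) / (1 + T) := by
        rw [le_div_iff₀ (by linarith)]
        calc e * |a| * (1 + T) ≤ e * |a| * (1 + t) := by gcongr
          _ = (1 + t) * e * |a| := by ring
          _ ≤ _ := h
          _ ≤ _ := by gcongr
      calc e * |s * a| = |s| * (e * |a|) := by rw [abs_mul]; ring
        _ ≤ Mθ * (ε * (R⁻¹ * Mρ) / (1 + T)) := by gcongr
        _ = Mθ * Mρ * Q := by rw [hQ]; ring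
    have hbound : ∀ x, ∀ r : Fin (l + 2) → ι, Real.exp (-(c₀ * x.2)) *
        |extDeriv γ x fun i => leftFrame α b x (r i)| ≤ C₁ * Q := by
      intro x r
      rw [hηf]
      simp only [leftFrame_apply]
      set w : Fin (l + 2) → EuclideanSpace ℝ (Fin m) :=
        fun i => NormedSpace.exp (x.2 • α) (b (r i)).1 with hw
      have h1 : ∀ i : Fin (l + 2), Real.exp (-(c₀ * x.2)) *
          |deriv f x.2 * A (fderiv ℝ ρR x.1) (i.removeNth w)| ≤ Mθ * Mρ * Q := by
        intro i
        by_cases ht : x.2 - T ∈ Set.Icc (0 : ℝ) 1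
        · refine htrans (t := x.2) (by linarith [ht.1]) (by rw [hf']; exact hMθ _) (hdρR x.1)
            (Real.exp_nonneg _) ?_
          exact hT₀ x.2 (by linarith [ht.1]) (fderiv ℝ ρR x.1) (i.removeNth r)
        · rw [hf', hθ' _ ht]
          simp only [zero_mul, abs_zero, mul_zero]
          positivity
      have h2 : ∀ i : Fin (l + 2), Real.exp (-(c₀ * x.2)) *
          |deriv g x.2 * B (fderiv ℝ ρR x.1) (i.removeNth w)| ≤ Mθ * Mρ * Q := by
        intro i
        by_cases ht : x.2 + (T + 1) ∈ Set.Icc (0 : ℝ) 1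
        · refine htrans (t := -x.2) (by linarith [ht.2]) (by rw [hg']; exact hMθ _) (hdρR x.1)
            (Real.exp_nonneg _) ?_
          -- Forward decay along `-α` at the time -t is backward decay along `α` at the time t.
          have := hT₁ (-x.2) (by linarith [ht.2]) (fderiv ℝ ρR x.1) (i.removeNth r)
          rw [neg_mul_neg, neg_smul_neg] at this
          exact this
        · rw [hg', hθ' _ ht]
          simp only [zero_mul, abs_zero, mul_zero]
          positivity
      have h3 : Real.exp (-(c₀ * x.2)) * |(f x.2 - g x.2) * hessForm A ρR x.1 w| ≤ Q := by
        by_cases ht : x.2 ∈ Set.Icc (-(T + 1)) (T + 1)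
        · have h4 := hK (R⁻¹ • (x.1 - z)) x.2 ht r
          have h5 : hessForm A ρR x.1 w = R⁻¹ ^ 2 * hessForm A ρ (R⁻¹ • (x.1 - z)) w := by
            rw [hessForm_rescale]; rfl
          rw [div_le_iff₀ hε] at hRK
          calc _ = |f x.2 - g x.2| * (R⁻¹ ^ 2 *
                (Real.exp (-(c₀ * x.2)) * |hessForm A ρ (R⁻¹ • (x.1 - z)) w|)) := by
                rw [h5, abs_mul, abs_mul, abs_of_nonneg (by positivity : 0 ≤ R⁻¹ ^ 2)]; ring
            _ ≤ 1 * (R⁻¹ ^ 2 * K) := by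
                gcongr
                exact hfg1 _
            _ ≤ Q := by
                rw [hQ, le_div_iff₀ (by linarith)]
                calc 1 * (R⁻¹ ^ 2 * K) * (1 + T) = R⁻¹ ^ 2 * (K * (1 + T)) := by ring
                  _ ≤ R⁻¹ ^ 2 * (R * ε) := by gcongr
                  _ = ε * R⁻¹ := by field_simp
        · rw [(hfg _ ht).1]
          simpa using hQ0
      set e := Real.exp (-(c₀ * x.2)) with he
      have he0 : 0 ≤ e := Real.exp_nonneg _
      have h6 : ∀ i : Fin (l + 2), e * |(-1 : ℝ) ^ (i : ℕ) * ((b (r i)).2 *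
          (deriv f x.2 * A (fderiv ℝ ρR x.1) (i.removeNth w) +
            deriv g x.2 * B (fderiv ℝ ρR x.1) (i.removeNth w)))| ≤
          β * (Mθ * Mρ * Q + Mθ * Mρ * Q) := by
        intro i
        rw [abs_mul, abs_pow, abs_neg, abs_one, one_pow, one_mul, abs_mul, mul_left_comm]
        refine mul_le_mul (hβ _) ?_ (by positivity) hβ0
        calc _ ≤ e * (|deriv f x.2 * A (fderiv ℝ ρR x.1) (i.removeNth w)| +
            |deriv g x.2 * B (fderiv ℝ ρR x.1) (i.removeNth w)|) := by
              gcongr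
              exact abs_add_le _ _
          _ ≤ _ := by
              rw [mul_add]
              exact add_le_add (h1 i) (h2 i)
      calc _ ≤ e * (∑ i : Fin (l + 2), |(-1 : ℝ) ^ (i : ℕ) * ((b (r i)).2 *
          (deriv f x.2 * A (fderiv ℝ ρR x.1) (i.removeNth w) +
            deriv g x.2 * B (fderiv ℝ ρR x.1) (i.removeNth w)))| +
            |(f x.2 - g x.2) * hessForm A ρR x.1 w|) := by
            refine mul_le_mul_of_nonneg_left ?_ he0
            exact (abs_add_le _ _).trans (add_le_add_left (Finset.abs_sum_le_sum_abs _ _) _)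
        _ ≤ ∑ _i : Fin (l + 2), β * (Mθ * Mρ * Q + Mθ * Mρ * Q) + Q := by
            rw [mul_add, Finset.mul_sum]
            exact add_le_add (Finset.sum_le_sum fun i _ => h6 i) h3
        _ = C₁ * Q := by
            rw [Finset.sum_const, Finset.card_univ, Fintype.card_fin, nsmul_eq_mul]
            simp only [C₁]
            ring
    refine (hnorm (extDeriv γ) z R (T + 1) (C₁ * Q) hR.le (by linarith) (by positivity) hη0
      hbound).trans (ENNReal.ofReal_le_ofReal ?_)
    -- The length of the interval enters with the exponent 1/p < 1, so the factor 1 / (1 + T) in `Q`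
    -- absorbs it.
    have h7 : (T + 1) ^ p⁻¹ ≤ T + 1 := by
      calc (T + 1) ^ p⁻¹ ≤ (T + 1) ^ (1 : ℝ) :=
            Real.rpow_le_rpow_of_exponent_le (by linarith) (inv_le_one_of_one_le₀ hp.le)
        _ = T + 1 := Real.rpow_one _
    rw [Real.mul_rpow (by positivity) (by linarith)]
    calc C₀ * (C₁ * Q) * ((R ^ m) ^ p⁻¹ * (T + 1) ^ p⁻¹) ≤
        C₀ * (C₁ * Q) * ((R ^ m) ^ p⁻¹ * (T + 1)) := by gcongr
      _ = _ := by
        rw [hQ]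
        field_simp
        ring
  · rw [hηf]
    have h1 : f x.2 = 1 := hθ1 _ (by linarith [hx.2])
    have h2 : g x.2 = 0 := hθ0 _ (by linarith [hx.1])
    have h3 : hessForm A ρR x.1 u = R⁻¹ ^ 2 * hessForm A ρ (R⁻¹ • (x.1 - z)) u := by
      rw [hessForm_rescale]; rfl
    simp [h1, h2, h3]

end ExactBlock

end Semidirect

namespace Semidirect

open LpCoh

/-! ### Test functions -/

section TestFunction

variable {m l : ℕ} {ι : Type*} [Fintype ι] [DecidableEq ι]

/-- Using the rescaled `h` itself as spatial factor makes the pairing a multiple of ∫ h² > 0. The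
vectors `(u i, 0)` are horizontal, so only `h` is differentiated: this gives R⁻¹, and Hölder's
inequality gives R^{m(1 - 1/p)}. -/
theorem exists_test_function (α : EuclideanSpace ℝ (Fin m) →L[ℝ] EuclideanSpace ℝ (Fin m))
    (b : Module.Basis ι ℝ (EuclideanSpace ℝ (Fin m) × ℝ)) {p : ℝ} (hp : 1 < p)
    (u : Fin (l + 1) → EuclideanSpace ℝ (Fin m)) {h : EuclideanSpace ℝ (Fin m) → ℝ}
    (hh : ContDiff ℝ (⊤ : ℕ∞) h) (hh0 : ∀ x ∉ Metric.closedBall 0 1, h x = 0) (h00 : h 0 ≠ 0) :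
    ∃ D J : ℝ, 0 ≤ D ∧ 0 < J ∧ ∀ R > 0, ∀ z : EuclideanSpace ℝ (Fin m),
      ∃ φ : EuclideanSpace ℝ (Fin m) × ℝ → ℝ, ContDiff ℝ (⊤ : ℕ∞) φ ∧
        (∀ x ∉ Metric.closedBall z R ×ˢ Set.Icc (0 : ℝ) 1, φ x = 0) ∧
        ∫ x, φ x * h (R⁻¹ • (x.1 - z)) = J * R ^ m ∧
        ∀ β ∈ lpForms (leftFrame α b) (frameVolume b (leftFrame α b)) p l,
          |∑ i : Fin (l + 1), (-1 : ℝ) ^ (i : ℕ) *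
            ∫ x, fderiv ℝ φ x (u i, 0) * β x (i.removeNth fun r => (u r, 0))| ≤
          D * (R⁻¹ * (R ^ m) ^ (1 - p⁻¹)) * (eLpNorm (coeff (leftFrame α b) β) (ENNReal.ofReal p)
            (frameVolume b (leftFrame α b))).toReal := by
  let τ : ContDiffBump (1 / 2 : ℝ) := ⟨1 / 4, 1 / 2, by norm_num, by norm_num⟩
  have hτ0 : ∀ t ∉ Set.Icc (0 : ℝ) 1, τ t = 0 := by
    intro t ht
    refine τ.zero_of_le_dist (le_of_not_gt fun hlt => ht ?_)
    rw [Real.dist_eq, abs_lt] at hlt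
    change _ < _ ∧ _ < (1 / 2 : ℝ) at hlt
    have h1 : -(1 / 2 : ℝ) < t - 1 / 2 := hlt.1
    exact ⟨by linarith, by linarith [hlt.2]⟩
  have hint : Integrable (fun y => h y * h y) := (hh.continuous.mul hh.continuous
    ).integrable_of_hasCompactSupport (HasCompactSupport.intro (isCompact_closedBall _ _)
      fun x hx => by rw [Pi.mul_apply, hh0 x hx, zero_mul])
  have hJ : 0 < ∫ y, h y * h y :=
    integral_pos_of_integrable_nonneg_nonzero (x := 0) (hh.continuous.mul hh.continuous) hint
      (fun y => mul_self_nonneg _) (mul_ne_zero h00 h00)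
  obtain ⟨M, hM0, hM⟩ := exists_bound_of_eq_zero_off (isCompact_closedBall _ _)
    (contDiff_fderiv_of_smooth hh).continuous
    fun x hx => fderiv_eq_zero_of_eq_zero_off Metric.isClosed_closedBall hh0 hx
  choose C hC hCb using fun i : Fin (l + 1) =>
    exists_abs_integral_le α b hp (i.removeNth fun r => ((u r, 0) : EuclideanSpace ℝ (Fin m) × ℝ))
  refine ⟨∑ i, C i * (M * ‖u i‖), (∫ y, h y * h y) * ∫ t, τ t,
    Finset.sum_nonneg fun i _ => mul_nonneg (hC i) (by positivity),
    mul_pos hJ τ.integral_pos, fun R hR z => ?_⟩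
  have hhR : ContDiff ℝ (⊤ : ℕ∞) fun y => h (R⁻¹ • (y - z)) := contDiff_rescale hh _ _
  have hhR0 : ∀ x ∉ Metric.closedBall z R, h (R⁻¹ • (x - z)) = 0 := fun x hx =>
    hh0 _ fun h => hx ((smul_sub_mem_closedBall_iff hR).1 h)
  refine ⟨fun x => h (R⁻¹ • (x.1 - z)) * τ x.2, (hhR.comp contDiff_fst).mul
    (τ.contDiff.comp contDiff_snd), fun x hx => ?_, ?_, fun β hβ => ?_⟩
  · rw [Set.mem_prod, not_and_or] at hx
    rcases hx with hx | hx
    · simp only [hhR0 _ hx, zero_mul]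
    · simp only [hτ0 _ hx, mul_zero]
  · have h1 : ∀ x : EuclideanSpace ℝ (Fin m) × ℝ,
        h (R⁻¹ • (x.1 - z)) * τ x.2 * h (R⁻¹ • (x.1 - z)) =
          (h (R⁻¹ • (x.1 - z)) * h (R⁻¹ • (x.1 - z))) * τ x.2 := fun x => by ring
    simp only [h1]
    rw [Measure.volume_eq_prod, integral_prod_mul
      (fun y : EuclideanSpace ℝ (Fin m) => h (R⁻¹ • (y - z)) * h (R⁻¹ • (y - z))) fun t => τ t,
      integral_sub_right_eq_self (fun y => h (R⁻¹ • y) * h (R⁻¹ • y)) z,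
      Measure.integral_comp_inv_smul_of_nonneg volume (fun y => h y * h y) hR.le]
    simp
    ring
  · have hd : ∀ x : EuclideanSpace ℝ (Fin m) × ℝ, ∀ w : EuclideanSpace ℝ (Fin m),
        fderiv ℝ (fun x : EuclideanSpace ℝ (Fin m) × ℝ => h (R⁻¹ • (x.1 - z)) * τ x.2) x (w, 0) =
          τ x.2 * (R⁻¹ * fderiv ℝ h (R⁻¹ • (x.1 - z)) w) := by
      intro x w
      have h1 : HasFDerivAt (fun x : EuclideanSpace ℝ (Fin m) × ℝ => h (R⁻¹ • (x.1 - z)))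
          ((R⁻¹ • fderiv ℝ h (R⁻¹ • (x.1 - z))).comp (ContinuousLinearMap.fst ℝ _ ℝ)) x := by
        rw [← fderiv_rescale]
        exact (hhR.differentiable (by simp) x.1).hasFDerivAt.comp x hasFDerivAt_fst
      have h2 : HasFDerivAt (fun x : EuclideanSpace ℝ (Fin m) × ℝ => τ x.2)
          (deriv τ x.2 • ContinuousLinearMap.snd ℝ _ ℝ) x :=
        ((τ.contDiff (n := 1)).differentiable one_ne_zero x.2).hasDerivAt.comp_hasFDerivAt x
          hasFDerivAt_snd
      have h3 : fderiv ℝ (fun x : EuclideanSpace ℝ (Fin m) × ℝ => h (R⁻¹ • (x.1 - z)) * τ x.2) x =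
          _ := (h1.mul h2).fderiv
      rw [h3]
      simp
    have hb : ∀ i : Fin (l + 1), ∀ x,
        |fderiv ℝ (fun x : EuclideanSpace ℝ (Fin m) × ℝ => h (R⁻¹ • (x.1 - z)) * τ x.2) x (u i, 0)| ≤
          R⁻¹ * (M * ‖u i‖) := by
      intro i x
      rw [hd, abs_mul, abs_mul, abs_of_nonneg τ.nonneg, abs_of_nonneg (by positivity : 0 ≤ R⁻¹)]
      refine (mul_le_of_le_one_left (by positivity) τ.le_one).trans ?_
      refine mul_le_mul_of_nonneg_left ?_ (by positivity)
      exact (ContinuousLinearMap.le_opNorm _ _).trans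
        (mul_le_mul_of_nonneg_right (hM _) (norm_nonneg _))
    have hz : ∀ i : Fin (l + 1), ∀ x ∉ Metric.closedBall z R ×ˢ Set.Icc (0 : ℝ) 1,
        fderiv ℝ (fun x : EuclideanSpace ℝ (Fin m) × ℝ => h (R⁻¹ • (x.1 - z)) * τ x.2) x (u i, 0) =
          0 := by
      intro i x hx
      rw [hd]
      rw [Set.mem_prod, not_and_or] at hx
      rcases hx with hx | hx
      · rw [fderiv_eq_zero_of_eq_zero_off Metric.isClosed_closedBall hh0 fun h' =>
          hx ((smul_sub_mem_closedBall_iff hR).1 h')]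
        simp
      · rw [hτ0 _ hx, zero_mul]
    set N := (eLpNorm (coeff (leftFrame α b) β) (ENNReal.ofReal p)
      (frameVolume b (leftFrame α b))).toReal
    calc _ ≤ ∑ i : Fin (l + 1), C i * (R⁻¹ * (M * ‖u i‖)) * (R ^ m) ^ (1 - p⁻¹) * N := by
          refine (Finset.abs_sum_le_sum_abs _ _).trans (Finset.sum_le_sum fun i _ => ?_)
          rw [abs_mul, abs_pow, abs_neg, abs_one, one_pow, one_mul]
          exact hCb i _ z R _ hR.le (hb i) (hz i) β hβ
      _ = _ := by
          rw [Finset.sum_mul, Finset.sum_mul]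
          exact Finset.sum_congr rfl fun i _ => by ring

end TestFunction

/-! ### Non-vanishing of the torsion -/

section Torsion

variable {m l : ℕ} {ι : Type*} [Fintype ι] [DecidableEq ι]

/-- All powers of `R` cancel after normalisation, so `D` is independent of `ε`, `R` and the centre
`z`. This uniformity is what the argument with disjoint blocks needs. -/
theorem exists_block (α : EuclideanSpace ℝ (Fin m) →L[ℝ] EuclideanSpace ℝ (Fin m))
    (b : Module.Basis ι ℝ (EuclideanSpace ℝ (Fin m) × ℝ)) {p : ℝ} (hp : 1 < p)
    (hcrit : ¬IsCritical α p (l + 1))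
    (hα : decaying α (LinearMap.trace ℝ _
      (α : EuclideanSpace ℝ (Fin m) →ₗ[ℝ] EuclideanSpace ℝ (Fin m)) / p) ℝ (l + 1) ≠ ⊤)
    (hα' : decaying (-α) (-(LinearMap.trace ℝ _
      (α : EuclideanSpace ℝ (Fin m) →ₗ[ℝ] EuclideanSpace ℝ (Fin m)) / p)) ℝ (l + 1) ≠ ⊤) :
    ∃ (v : Fin (l + 2) → EuclideanSpace ℝ (Fin m) × ℝ) (D : ℝ), ∀ ε > 0, ∃ R > 0,
      ∀ z : EuclideanSpace ℝ (Fin m),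
      ∃ η ∈ exactForms (leftFrame α b) (frameVolume b (leftFrame α b)) p (l + 2),
      ∃ φ : EuclideanSpace ℝ (Fin m) × ℝ → ℝ, ContDiff ℝ (⊤ : ℕ∞) φ ∧ HasCompactSupport φ ∧
        (∀ x ∉ Metric.closedBall z R ×ˢ Set.univ, η x = 0) ∧
        (∀ x ∉ Metric.closedBall z R ×ˢ Set.univ, φ x = 0) ∧
        eLpNorm (coeff (leftFrame α b) η) (ENNReal.ofReal p) (frameVolume b (leftFrame α b)) ≤
          ENNReal.ofReal ε ∧
        ∫ x, φ x * η x v = 1 ∧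
        ∀ β ∈ lpForms (leftFrame α b) (frameVolume b (leftFrame α b)) p (l + 1),
          |∑ i : Fin (l + 2), (-1 : ℝ) ^ (i : ℕ) * ∫ x, fderiv ℝ φ x (v i) * β x (i.removeNth v)| ≤
          D * (eLpNorm (coeff (leftFrame α b) β) (ENNReal.ofReal p)
            (frameVolume b (leftFrame α b))).toReal := by
  obtain ⟨c, A, B, hA, hB, hAB, ξ, hξ⟩ :=
    exists_split_covectorWedge _ _ (exists_decaying_add hcrit) hα hα'
  obtain ⟨ρ, hρ, hρ0, hρξ⟩ := exists_profile A ξ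
  obtain ⟨u, hu⟩ : ∃ u, hessForm A ρ 0 u ≠ 0 := by
    by_contra! h
    exact hξ (hρξ ▸ ContinuousAlternatingMap.ext h)
  obtain ⟨C, hC, hblock⟩ := exists_exact_block α b hp hA hB hAB hρ hρ0
  have hh : ContDiff ℝ (⊤ : ℕ∞) fun y => hessForm A ρ y u :=
    (ContinuousAlternatingMap.apply ℝ _ ℝ u).contDiff.comp (contDiff_hessForm A hρ)
  obtain ⟨D, J, hD, hJ, htest⟩ := exists_test_function (l := l + 1) α b hp u hh
    (fun x hx => by rw [hessForm_eq_zero_off A Metric.isClosed_closedBall hρ0 hx]; rfl) hu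
  refine ⟨fun i => (u i, 0), D / J, fun ε hε => ?_⟩
  obtain ⟨R, hR, hη⟩ := hblock (ε / (C + 1)) (by positivity)
  refine ⟨R, hR, fun z => ?_⟩
  obtain ⟨η, hη1, hη2, hη3, hη4⟩ := hη z
  obtain ⟨φ, hφ1, hφ2, hφ3, hφ4⟩ := htest R hR z
  have hRm : 0 < R ^ m := by positivity
  set P := (R ^ m) ^ p⁻¹ with hP
  have hP0 : 0 < P := Real.rpow_pos_of_pos hRm _
  have hP1 : (R ^ m) ^ (1 - p⁻¹) = R ^ m / P := by rw [Real.rpow_sub hRm, Real.rpow_one]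
  -- With P = R^{m/p}, the factor `s` undoes the R⁻¹ P in the norm of `η`. Then `q` is determined by
  -- q · s · R⁻² · J R^m = 1.
  let s : ℝ := R * P⁻¹
  let q : ℝ := R * P / (R ^ m * J)
  have hs : 0 < s := by positivity
  have hq : 0 < q := by positivity
  refine ⟨s • η, Submodule.smul_mem _ _ hη1, q • φ, contDiff_const.smul hφ1, ?_,
    fun x hx => by simp [hη2 x hx], fun x hx => ?_, ?_, ?_, fun β hβ => ?_⟩
  · refine HasCompactSupport.intro ((isCompact_closedBall z R).prod
      (isCompact_Icc (a := (0 : ℝ)) (b := 1))) fun x hx => ?_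
    simp [hφ2 x hx]
  · simp [hφ2 x fun h => hx ⟨h.1, trivial⟩]
  · rw [coeff_smul, eLpNorm_const_smul, ← ofReal_norm, Real.norm_of_nonneg hs.le]
    refine (mul_le_mul_right hη3 _).trans ?_
    rw [← ENNReal.ofReal_mul hs.le]
    refine ENNReal.ofReal_le_ofReal ?_
    calc s * (C * (ε / (C + 1)) * (R⁻¹ * P)) = C / (C + 1) * ε := by
          simp only [s]; field_simp
      _ ≤ 1 * ε := by
          gcongr
          rw [div_le_one (by linarith)]
          linarith
      _ = ε := one_mul _
  · have h1 : ∀ x, (q • φ) x * (s • η) x (fun i => (u i, 0)) =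
        (q * s * R⁻¹ ^ 2) * (φ x * hessForm A ρ (R⁻¹ • (x.1 - z)) u) := by
      intro x
      rw [Pi.smul_apply, Pi.smul_apply, ContinuousAlternatingMap.smul_apply, smul_eq_mul,
        smul_eq_mul]
      by_cases hx : x.2 ∈ Set.Icc (0 : ℝ) 1
      · rw [hη4 x hx]; ring
      · rw [hφ2 x fun h => hx h.2]; ring
    simp only [h1]
    rw [integral_const_mul, hφ3]
    simp only [q, s]
    field_simp
  · have h1 : ∀ x w, fderiv ℝ (q • φ) x w = q * fderiv ℝ φ x w := fun x w => by
      rw [fderiv_const_smul_field]; rfl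
    simp only [h1, mul_assoc, integral_const_mul]
    have h2 := hφ4 β hβ
    simp only [mul_left_comm _ q, ← Finset.mul_sum]
    rw [abs_mul, abs_of_pos hq]
    refine (mul_le_mul_of_nonneg_left h2 hq.le).trans (le_of_eq ?_)
    rw [hP1]
    simp only [q]
    field_simp

/-- The radii do not depend on the centres, so they are fixed first and the balls are then placed
far apart along a line in `H`. -/
theorem nontrivial_torsion_of_decaying_ne_top [Nonempty (Fin m)]
    (α : EuclideanSpace ℝ (Fin m) →L[ℝ] EuclideanSpace ℝ (Fin m))
    (b : Module.Basis ι ℝ (EuclideanSpace ℝ (Fin m) × ℝ)) {p : ℝ} (hp : 1 < p)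
    (hcrit : ¬IsCritical α p (l + 1))
    (hα : decaying α (LinearMap.trace ℝ _
      (α : EuclideanSpace ℝ (Fin m) →ₗ[ℝ] EuclideanSpace ℝ (Fin m)) / p) ℝ (l + 1) ≠ ⊤)
    (hα' : decaying (-α) (-(LinearMap.trace ℝ _
      (α : EuclideanSpace ℝ (Fin m) →ₗ[ℝ] EuclideanSpace ℝ (Fin m)) / p)) ℝ (l + 1) ≠ ⊤) :
    Nontrivial (Semidirect.Torsion α b p (l + 2)) := by
  obtain ⟨v, D, hblock⟩ := exists_block α b hp hcrit hα hα'
  choose R hR hblock using fun j : ℕ => hblock (4⁻¹ ^ j) (by positivity)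
  obtain ⟨e, he⟩ := exists_norm_eq (EuclideanSpace ℝ (Fin m)) zero_le_one
  -- For i < j this gives s j - s i ≥ R i + R j + 2, so the closed balls are disjoint.
  let s : ℕ → ℝ := fun j => 2 * ∑ i ∈ Finset.range j, (R i + 1) + R j
  have hs : ∀ i j, i < j → R i + R j < s j - s i := by
    intro i j hij
    have h1 : ∑ i ∈ Finset.range (i + 1), (R i + 1) ≤ ∑ i ∈ Finset.range j, (R i + 1) :=
      Finset.sum_le_sum_of_subset_of_nonneg (Finset.range_mono hij) fun r _ _ => by
        linarith [hR r]
    rw [Finset.sum_range_succ] at h1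
    simp only [s]
    linarith
  have hdist : ∀ i j, i < j → R i + R j < dist (s i • e) (s j • e) := by
    intro i j hij
    rw [dist_eq_norm, ← sub_smul, norm_smul, he, mul_one, Real.norm_eq_abs, abs_sub_comm]
    exact (hs i j hij).trans_le (le_abs_self _)
  choose η hη φ hφ hφc hηS hφS hηn hφη hD using fun j => hblock j (s j • e)
  refine nontrivial_torsion_of_disjoint_exactForms _ _ hp v D
    (fun j => Metric.closedBall (s j • e) (R j) ×ˢ Set.univ) (fun i j hij => ?_) η φ hη hηS hηn hφ
    hφc hφS hφη hD
  refine Set.disjoint_prod.2 (Or.inl ?_)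
  rcases lt_or_gt_of_ne hij with hlt | hlt
  · exact Metric.closedBall_disjoint_closedBall (hdist i j hlt)
  · exact (Metric.closedBall_disjoint_closedBall (hdist j i hlt)).symm

end Torsion

end Semidirect

/-! ### Sums of real parts of eigenvalues -/

/-- The numbers `lam` only record real parts; this lifts a choice of real parts to a choice of
complex eigenvalues. -/
theorem Multiset.exists_le_map_eq {β γ : Type*} {f : β → γ} {s : Multiset β} {t : Multiset γ}
    (h : t ≤ s.map f) : ∃ r ≤ s, r.map f = t := by
  obtain ⟨s, rfl⟩ := Quot.exists_rep s
  obtain ⟨t, rfl⟩ := Quot.exists_rep t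
  obtain ⟨l, hl, hls⟩ := (Multiset.coe_le.1 h : t.Subperm (s.map f))
  obtain ⟨r, hr, rfl⟩ := List.sublist_map_iff.1 hls
  exact ⟨r, Multiset.coe_le.2 hr.subperm, Multiset.coe_eq_coe.2 hl⟩

namespace Semidirect

section Eigenvalues

variable {m : ℕ} {α : EuclideanSpace ℝ (Fin m) →L[ℝ] EuclideanSpace ℝ (Fin m)}
  {lam : Fin m → ℝ}

theorem sum_eigenvalues (α : EuclideanSpace ℝ (Fin m) →L[ℝ] EuclideanSpace ℝ (Fin m)) :
    (eigenvalues α).sum = (LinearMap.trace ℝ _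
      (α : EuclideanSpace ℝ (Fin m) →ₗ[ℝ] EuclideanSpace ℝ (Fin m)) : ℝ) := by
  let b := (EuclideanSpace.basisFun (Fin m) ℝ).toBasis
  rw [eigenvalues, LinearMap.trace_eq_matrix_trace ℝ b, ← LinearMap.charpoly_toMatrix _ b,
    ← Matrix.charpoly_map, ← Matrix.trace_eq_sum_roots_charpoly]
  simp [Matrix.trace]

theorem lowerSum_eq_trace
    (hlam : Finset.univ.val.map lam = (eigenvalues α).map Complex.re) :
    lowerSum lam m = LinearMap.trace ℝ _
      (α : EuclideanSpace ℝ (Fin m) →ₗ[ℝ] EuclideanSpace ℝ (Fin m)) := by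
  have h1 : lowerSum lam m = (Finset.univ.val.map lam).sum := by
    simp [lowerSum, Finset.sum]
  have h2 := congrArg Complex.re (sum_eigenvalues α)
  rw [Complex.ofReal_re] at h2
  rw [h1, hlam, ← h2]
  exact (map_multiset_sum Complex.reAddGroupHom _).symm

theorem exists_eigenform_of_finset
    (hlam : Finset.univ.val.map lam = (eigenvalues α).map Complex.re) (J : Finset (Fin m)) {j : ℕ}
    (hJ : J.card = j) : ∃ (z : ℂ) (ω : EuclideanSpace ℝ (Fin m) [⋀^Fin j]→L[ℝ] ℂ),
      z.re = ∑ i ∈ J, lam i ∧ ω ≠ 0 ∧ derivation α ω = z • ω := by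
  obtain ⟨s, hs, hsJ⟩ := Multiset.exists_le_map_eq
    (hlam ▸ Multiset.map_le_map (Finset.val_le_iff.2 (Finset.subset_univ J)))
  have hcard : Multiset.card s = j := by
    rw [← Multiset.card_map Complex.re s, hsJ, Multiset.card_map, Finset.card_val, hJ]
  obtain ⟨ω, hω, h⟩ := exists_eigenform α s hs hcard
  refine ⟨s.sum, ω.toContinuous, ?_, fun h0 => hω ?_, ?_⟩
  · have h1 : s.sum.re = (s.map Complex.re).sum := map_multiset_sum Complex.reAddGroupHom s
    rw [h1, hsJ]
    rfl
  · ext v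
    exact congrArg (fun η => η v) h0
  · ext v
    rw [derivation_apply]
    exact h v

/-- The last `j` indices give an eigenform that grows like e^{tW_j}, too fast for the weight
e^{-ct}. -/
theorem decaying_ne_top_of_le_upperSum
    (hlam : Finset.univ.val.map lam = (eigenvalues α).map Complex.re) {j : ℕ} (hj : j ≤ m) {c : ℝ}
    (hc : c ≤ upperSum lam j) : decaying α c ℝ j ≠ ⊤ := by
  have hcard : (Finset.univ.filter fun i : Fin m => m ≤ (i : ℕ) + j).card = j := by
    have h1 : (Finset.univ.filter fun i : Fin m => m ≤ (i : ℕ) + j) =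
        (Finset.univ.filter fun i : Fin m => (i : ℕ) < m - j)ᶜ := by
      ext i
      simp
    rw [h1, Finset.card_compl, Fintype.card_fin, Fin.card_filter_val_lt]
    omega
  obtain ⟨z, ω, hz, hω, h⟩ := exists_eigenform_of_finset hlam _ hcard
  exact decaying_ne_top (hz ▸ hc) hω h

/-- The eigenform of the first `j` indices has for `-α` an eigenvalue with real part -w_j ≥ -c. -/
theorem decaying_neg_ne_top_of_lowerSum_le
    (hlam : Finset.univ.val.map lam = (eigenvalues α).map Complex.re) {j : ℕ} (hj : j ≤ m) {c : ℝ}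
    (hc : lowerSum lam j ≤ c) : decaying (-α) (-c) ℝ j ≠ ⊤ := by
  have hcard : (Finset.univ.filter fun i : Fin m => (i : ℕ) < j).card = j := by
    rw [Fin.card_filter_val_lt]
    omega
  obtain ⟨z, ω, hz, hω, h⟩ := exists_eigenform_of_finset hlam _ hcard
  refine decaying_ne_top (z := -z) ?_ hω ?_
  · rw [Complex.neg_re, hz]
    exact neg_le_neg hc
  · rw [derivation_neg, LinearMap.neg_apply, h, neg_smul]

end Eigenvalues

end Semidirect

end

/-! ### The main theorem -/

theorem mainTheorem6 (n k : ℕ) (hk : 1 ≤ k) (hkn : k ≤ n)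
    (α : EuclideanSpace ℝ (Fin (n - 1)) →L[ℝ] EuclideanSpace ℝ (Fin (n - 1)))
    (lam : Fin (n - 1) → ℝ) (hmono : Monotone lam)
    (hlam : Finset.univ.val.map lam = (Semidirect.eigenvalues α).map Complex.re)
    (b : Module.Basis (Fin n) ℝ (EuclideanSpace ℝ (Fin (n - 1)) × ℝ))
    (p : ℝ) (hp : 1 < p)
    (hlow : Semidirect.lowerSum lam (k - 1) < Semidirect.lowerSum lam (n - 1) / p)
    (hupp : Semidirect.lowerSum lam (n - 1) / p < Semidirect.upperSum lam (k - 1))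
    (hcrit : ¬ Semidirect.IsCritical α p (k - 1)) :
    Nontrivial (Semidirect.Torsion α b p k) := by
  rw [Semidirect.lowerSum_eq_trace hlam] at hlow hupp
  obtain rfl | ⟨l, rfl⟩ : k = 1 ∨ ∃ l, k = l + 2 := by
    rcases k with _ | _ | l
    · omega
    · exact Or.inl rfl
    · exact Or.inr ⟨l, rfl⟩
  -- In degree k = 1 both sums are empty, and the inequalities would read 0 < c₀ < 0.
  · have h1 : Semidirect.lowerSum lam (1 - 1) = 0 := by simp [Semidirect.lowerSum]
    have h2 : Semidirect.upperSum lam (1 - 1) = 0 := by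
      refine Finset.sum_eq_zero fun i hi => absurd i.isLt ?_
      have := (Finset.mem_filter.1 hi).2
      omega
    linarith
  -- Here 2 ≤ k ≤ n, so `H` is not zero and contains a line along which to place the blocks.
  · have : Nonempty (Fin (n - 1)) := ⟨⟨0, by omega⟩⟩
    exact Semidirect.nontrivial_torsion_of_decaying_ne_top α b hp hcrit
      (Semidirect.decaying_ne_top_of_le_upperSum hlam (by omega) hupp.le)
      (Semidirect.decaying_neg_ne_top_of_lowerSum_le hlam (by omega) hlow.le)
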